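/- Let $p\in(0,1)$ and let $m$ be a probability measure on $(0,\infty)$. On a probability space, let $(x_n)_{n\ge1}$ be a renewal process whose interdistances $x_1,x_2-x_1,x_3-x_2,\dots$ are i.i.d. with law $m$; let $(v_n)_{n\ge1}$ be i.i.d. with $\mathbb P(v_n=0)=p$ and $\mathbb P(v_n=1)=\mathbb P(v_n=-1)=\frac{1-p}2$, independent of $(x_n)_n$; and let $(s_n)_{n\ge1}$ be i.i.d. uniform on $\{-1,+1\}$, independent of $((x_n)_n,(v_n)_n)$. Consider ballistic annihilation on the half-line: at time $0$ the particle $n$ starts from $x_n$, and it moves at constant velocity $v_n$ until it is annihilated. When exactly two particles meet, both are annihilated. When three particles meet (necessarily one of each velocity), the static particle, say $n$, and one of the two moving particles are annihilated, while the moving particle whose velocity equals the spin $s_n$ survives and continues its motion unperturbed. Annihilated particles are removed from the system. Let $q$ be the probability that $0$ is reached by some particle, i.e. that some particle $n$ with $v_n=-1$ is not annihilated when or before it reaches $0$. Then the event in question is measurable up to null sets, and $$(1-q)\bigl(1-p(1+q)^2\bigr)=0 .$$ Hence either $q=1$ or $q=\frac1{\sqrt p}-1$, and in particular $q=1$ if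 $p\le\frac14$. -/

import Mathlib

open MeasureTheory ProbabilityTheory

namespace BallisticAnnihilation

/-- An initial configuration of particles indexed by `ι`: initial locations, velocities (in
`{-1, 0, 1}`) and spins (in `{-1, 1}`). -/
structure Config (ι : Type*) where
  x : ι → ℝ
  v : ι → ℤ
  s : ι → ℤ

namespace Config

variable {ι : Type*} (c : Config ι)

/-- The virtual trajectories `t ↦ x i + v i * t` and `t ↦ x j + v j * t` of two distinct particles
intersect at time `t ≥ 0`. -/
def Meet (i j : ι) (t : ℝ) : Prop :=
  i ≠ j ∧ 0 ≤ t ∧ c.x i + c.v i * t = c.x j + c.v j * t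

/-- If `i`, `j`, `k` take part in a triple collision, one of `i` and `j` is the static particle and
its spin designates `k` as the surviving (moving) particle. -/
def SpinSaves (k i j : ι) : Prop :=
  (c.v i = 0 ∧ c.s i = c.v k) ∨ (c.v j = 0 ∧ c.s j = c.v k)

/-- Given a relation `R` (`R k k' u` stands for: `k` and `k'` annihilate each other at time `u`),
the condition for `i` and `j` to annihilate each other at time `t`: they meet at time `t`;
neither is annihilated earlier, that is, every other particle `k` that would meet `i` or `j`
at a time `u < t` is annihilated, before time `u` or in a collision at time `u`, with a third
particle; and every particle `k` that would meet both of them at time `t` is either annihilated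
before time `t` or is the survivor of the triple collision. -/
def CollisionRule (R : ι → ι → ℝ → Prop) (i j : ι) (t : ℝ) : Prop :=
  c.Meet i j t ∧
  (∀ (k : ι) (u : ℝ), k ≠ i → k ≠ j → u < t → (c.Meet k i u ∨ c.Meet k j u) →
    ∃ (k' : ι) (u' : ℝ), k' ≠ i ∧ k' ≠ j ∧ u' ≤ u ∧ R k k' u') ∧
  (∀ k : ι, c.Meet k i t → c.Meet k j t →
    c.SpinSaves k i j ∨ ∃ (k' : ι) (u' : ℝ), u' < t ∧ R k k' u')

/-- `c.Annihilate i j t`: the particles `i` and `j` annihilate each other at time `t`. This is the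
least relation closed under the (monotone) collision rule. The rule at time `t` only involves
annihilations at times strictly before `t`, so for locally finite configurations this is the
recursive definition, and it is the only relation equivalent to its own collision rule. -/
def Annihilate (i j : ι) (t : ℝ) : Prop :=
  ∀ R : ι → ι → ℝ → Prop, (∀ i j t, c.CollisionRule R i j t → R i j t) → R i j t

/-- The particle `i` crosses the location `y` from the right: it starts to the right of `y`, has
velocity `-1`, and is not annihilated when or before it reaches `y` (at time `x i - y`). -/
def CrossesFromRight (y : ℝ) (i : ι) : Prop :=
  c.v i = -1 ∧ y < c.x i ∧ ∀ (j : ι) (t : ℝ), t ≤ c.x i - y → ¬ c.Annihilate i j t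

end Config

variable {Ω : Type*} [MeasurableSpace Ω]

/-- The random initial configuration of parameter `p` and interdistance law `m` on the half-line.
The particle called `n + 1` in the usual numbering from `1` has index `n` here. -/
structure IsBallisticModel (μ : Measure Ω) (m : Measure ℝ) (p : ℝ)
    (x : ℕ → Ω → ℝ) (v s : ℕ → Ω → ℤ) : Prop where
  measurable_x : ∀ n, Measurable (x n)
  measurable_v : ∀ n, Measurable (v n)
  measurable_s : ∀ n, Measurable (s n)
  /-- `x₁, x₂ - x₁, x₃ - x₂, …` are independent with law `m`. -/
  law_first : μ.map (x 0) = m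
  law_gap : ∀ n, μ.map (fun ω => x (n + 1) ω - x n ω) = m
  indep_gaps : iIndepFun (fun (n : ℕ) (ω : Ω) => if n = 0 then x 0 ω else x n ω - x (n - 1) ω) μ
  /-- The velocities are independent with the symmetric law on `{-1, 0, 1}`. -/
  prob_static : ∀ n, μ.real {ω | v n ω = 0} = p
  prob_left : ∀ n, μ.real {ω | v n ω = -1} = (1 - p) / 2
  prob_right : ∀ n, μ.real {ω | v n ω = 1} = (1 - p) / 2
  indep_v : iIndepFun v μ
  /-- The spins are independent Rademacher variables. -/
  prob_spin_neg : ∀ n, μ.real {ω | s n ω = -1} = 1 / 2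
  prob_spin_pos : ∀ n, μ.real {ω | s n ω = 1} = 1 / 2
  indep_s : iIndepFun s μ
  /-- The velocities are independent of the locations, and the spins of both. -/
  indep_v_x : IndepFun (fun ω n => v n ω) (fun ω n => x n ω) μ
  indep_s_xv : IndepFun (fun ω n => s n ω) (fun ω => ((fun n => x n ω), (fun n => v n ω))) μ

/-- The event that `0` is reached by some particle. -/
def originReached (x : ℕ → Ω → ℝ) (v s : ℕ → Ω → ℤ) : Set Ω :=
  {ω | ∃ i : ℕ, Config.CrossesFromRight
    { x := fun n => x n ω, v := fun n => v n ω, s := fun n => s n ω } 0 i}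

/-- The probability `q` that `0` is reached by some particle. -/
noncomputable def hitProb (μ : Measure Ω) (x : ℕ → Ω → ℝ) (v s : ℕ → Ω → ℤ) : ℝ :=
  μ.real (originReached x v s)

end BallisticAnnihilation

/-! Let `q` be the probability that `0` is reached, `M` the probability that the first particle
moves right and annihilates with a left-moving one, and `Z` the probability that the first particle
moves right, annihilates with a static particle, and `0` is then reached by the first particle that
would have hit that static particle from the right. Two linear relations and one symmetry determine
the equation for `q`.

Arrival decomposition (`reachEv_eq`, `measure_reachEv`). A first particle moving left reaches `0`. A
static one absorbs the first arrival, and a second, independent arrival is needed. One moving right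
has to be annihilated first, either by a left-moving particle, after which a fresh arrival is
needed, or by a static one. Hence `q = (1 - p)/2 + p q² + M q + Z`.

Symmetry (`measure_rightEv`). Reflecting a finite block exchanges the two particles that compete for
a static one. Ties are decided by the spin, whose sign is reversed, so exactly one side wins and
each side wins with the same probability: `2 Z = p q²`. This works for laws `m` with atoms.

Fate of a right-moving first particle (`measure_velEv_one_add`). Among the particles `0, …, n` it
crosses the block, annihilates with a left-moving particle, or annihilates with a static one. The
last event means being the first to reach the static particle from the left, minus the cases won by
the other side. If `q < 1`, the particles crossing `0` form a terminating renewal process with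
finite mean number, so the crossing probability tends to `0` (`tendsto_measure_crossEv`). Letting `n
→ ∞` gives `(1 - p)/2 + Z = M + p q`. Eliminating `M` and `Z` yields the equation; for `q = 1` it is
trivial.

The deterministic input is that finite systems have a unique dynamics (`exists_isDyn`,
`IsDyn.unique`), that a collision depends only on its backward light cone (`ruleOn_local`), and that
certain neighbouring blocks do not interact (`ann_union_wall`, `ann_union_of_dead`). The
probabilistic input is the independence of a block and the particles after it
(`measure_inter_shift`), on a canonical product space to which the given model is mapped. -/

namespace BallisticAnnihilation
namespace Config

/-! ### Outcomes of meetings in a finite system. -/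

variable {ι κ : Type*} {c : Config ι}

/-- Distinct particles start from distinct locations, velocities are in `{-1, 0, 1}` and spins in
`{-1, 1}`. -/
structure Regular (c : Config ι) : Prop where
  inj : Function.Injective c.x
  vel : ∀ i, c.v i = -1 ∨ c.v i = 0 ∨ c.v i = 1
  spin : ∀ i, c.s i = -1 ∨ c.s i = 1

/-- The particle `i` is annihilated strictly before time `t` according to `R`. -/
def Dead (R : ι → ι → ℝ → Prop) (i : ι) (t : ℝ) : Prop := ∃ k u, u < t ∧ R i k u

/-- The possible outcomes of the meeting of `i` and `j` at time `t`. -/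
def Outcome (c : Config ι) (R : ι → ι → ℝ → Prop) (i j : ι) (t : ℝ) : Prop :=
  R i j t ∨ Dead R i t ∨ Dead R j t ∨
    (∃ k, R i k t ∧ c.SpinSaves j i k) ∨ (∃ k, R j k t ∧ c.SpinSaves i j k)

/-- `R` is the dynamics of the particles in the finite set `J`, described by its outcomes at the
meetings of two particles. -/
structure IsDyn (c : Config ι) (J : Finset ι) (R : ι → ι → ℝ → Prop) : Prop where
  mem : ∀ {i j t}, R i j t → i ∈ J
  symm : ∀ {i j t}, R i j t → R j i t
  meet : ∀ {i j t}, R i j t → c.Meet i j t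
  partner : ∀ {i j j' t t'}, R i j t → R i j' t' → j = j'
  resolve : ∀ {i j t}, i ∈ J → j ∈ J → c.Meet i j t → c.Outcome R i j t

theorem Meet.symm {i j : ι} {t : ℝ} (h : c.Meet i j t) : c.Meet j i t :=
  ⟨h.1.symm, h.2.1, h.2.2.symm⟩

theorem SpinSaves.symm {i j k : ι} (h : c.SpinSaves k i j) : c.SpinSaves k j i := Or.symm h

theorem Regular.vel_ne (hc : c.Regular) {i j : ι} {t : ℝ} (h : c.Meet i j t) :
    c.v i ≠ c.v j := by
  intro hv
  obtain ⟨hij, _, h⟩ := h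
  rw [hv] at h
  exact hij (hc.inj (by linarith))

theorem Regular.x_ne (hc : c.Regular) {i j : ι} (h : i ≠ j) : c.x i ≠ c.x j :=
  fun h' => h (hc.inj h')

theorem Regular.neg_one_le (hc : c.Regular) (i : ι) : (-1 : ℝ) ≤ c.v i := by
  rcases hc.vel i with h | h | h <;> simp [h]

theorem Regular.meet_time_unique (hc : c.Regular) {i j : ι} {t u : ℝ} (h : c.Meet i j t)
    (h' : c.Meet i j u) : t = u := by
  have hv : (c.v i : ℝ) - c.v j ≠ 0 := by
    have := hc.vel_ne h
    rw [sub_ne_zero]; exact_mod_cast this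
  have h1 := h.2.2
  have h2 := h'.2.2
  apply mul_left_cancel₀ hv
  linarith

theorem Meet.trans {i j k : ι} {t : ℝ} (h : c.Meet i j t) (h' : c.Meet i k t) (hjk : j ≠ k) :
    c.Meet j k t := ⟨hjk, h.2.1, by rw [← h.2.2, h'.2.2]⟩

/-- In a triple collision, the spin cannot save two particles. -/
theorem Regular.spinSaves_asymm (hc : c.Regular) {i j k : ι} {t : ℝ} (hij : c.Meet i j t)
    (hik : c.Meet i k t) (hjk : j ≠ k) (h : c.SpinSaves k i j) : ¬ c.SpinSaves j i k := by
  have h1 := hc.vel_ne hij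
  have h2 := hc.vel_ne hik
  have h3 := hc.vel_ne (hij.trans hik hjk)
  unfold SpinSaves at *
  rcases hc.spin i with h | h <;> rcases hc.spin j with h | h <;> rcases hc.spin k with h | h <;>
    omega

/-- In a triple collision, the spin saves one of the particles. -/
theorem Regular.exists_spinSaves (hc : c.Regular) {i j k : ι} {t : ℝ} (hij : c.Meet i j t)
    (hik : c.Meet i k t) (hjk : j ≠ k) :
    c.SpinSaves k i j ∨ c.SpinSaves j i k ∨ c.SpinSaves i j k := by
  have h1 := hc.vel_ne hij
  have h2 := hc.vel_ne hik
  have h3 := hc.vel_ne (hij.trans hik hjk)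
  unfold SpinSaves
  rcases hc.vel i with hi | hi | hi <;> rcases hc.vel j with hj | hj | hj <;>
    rcases hc.vel k with hk | hk | hk <;> simp_all <;>
    first
      | (rcases hc.spin i with h | h <;> simp_all)
      | (rcases hc.spin j with h | h <;> simp_all)
      | (rcases hc.spin k with h | h <;> simp_all)

/-- At most three particles meet at the same time and place. -/
theorem Regular.eq_of_meet (hc : c.Regular) {i j k l : ι} {t : ℝ} (hij : c.Meet i j t)
    (hik : c.Meet i k t) (hil : c.Meet i l t) (hjk : j ≠ k) (hjl : j ≠ l) : k = l := by
  by_contra hkl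
  have h1 := hc.vel_ne hij
  have h2 := hc.vel_ne hik
  have h3 := hc.vel_ne hil
  have h4 := hc.vel_ne (hij.trans hik hjk)
  have h5 := hc.vel_ne (hij.trans hil hjl)
  have h6 := hc.vel_ne (hik.trans hil hkl)
  rcases hc.vel i with h | h | h <;> rcases hc.vel j with h' | h' | h' <;>
    rcases hc.vel k with h'' | h'' | h'' <;> rcases hc.vel l with h3 | h3 | h3 <;> omega

theorem IsDyn.time_eq (hc : c.Regular) {J : Finset ι} {R : ι → ι → ℝ → Prop} (hR : c.IsDyn J R)
    {i j j' : ι} {t t' : ℝ} (h : R i j t) (h' : R i j' t') : t = t' := by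
  obtain rfl := hR.partner h h'
  exact hc.meet_time_unique (hR.meet h) (hR.meet h')

theorem IsDyn.not_dead (hc : c.Regular) {J : Finset ι} {R : ι → ι → ℝ → Prop} (hR : c.IsDyn J R)
    {i j : ι} {t : ℝ} (h : R i j t) : ¬ Dead R i t := by
  rintro ⟨k, u, hu, h'⟩
  exact hu.ne' (hR.time_eq hc h h')

/-! ### The collision rule, and finite speed of propagation. -/

/-- The rule `CollisionRule` restricted to the particles in `J`. -/
def RuleOn (c : Config ι) (J : Set ι) (R : ι → ι → ℝ → Prop) (i j : ι) (t : ℝ) : Prop :=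
  i ∈ J ∧ j ∈ J ∧ c.Meet i j t ∧
  (∀ k ∈ J, ∀ u : ℝ, k ≠ i → k ≠ j → u < t → (c.Meet k i u ∨ c.Meet k j u) →
    ∃ (k' : ι) (u' : ℝ), k' ≠ i ∧ k' ≠ j ∧ u' ≤ u ∧ R k k' u') ∧
  (∀ k ∈ J, c.Meet k i t → c.Meet k j t →
    c.SpinSaves k i j ∨ ∃ (k' : ι) (u' : ℝ), u' < t ∧ R k k' u')

/-- Knaster–Tarski: the rule is monotone, so the least relation closed under it is a fixed point.
Phrasing the fixed point with `RuleOn` on all particles allows `ruleOn_local` to compare it with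
finite systems. -/
theorem annihilate_iff (i j : ι) (t : ℝ) :
    c.Annihilate i j t ↔ c.RuleOn Set.univ c.Annihilate i j t := by
  have mono : ∀ R R' : ι → ι → ℝ → Prop, (∀ i j t, R i j t → R' i j t) → ∀ i j t,
      c.CollisionRule R i j t → c.CollisionRule R' i j t := by
    rintro R R' hR i j t ⟨h1, h2, h3⟩
    refine ⟨h1, fun k u hki hkj hu hm => ?_, fun k hki hkj => ?_⟩
    · obtain ⟨k', u', ha, hb, hu', hr⟩ := h2 k u hki hkj hu hm
      exact ⟨k', u', ha, hb, hu', hR _ _ _ hr⟩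
    · refine (h3 k hki hkj).imp_right ?_
      rintro ⟨k', u', hu', hr⟩
      exact ⟨k', u', hu', hR _ _ _ hr⟩
  have closed : ∀ i j t, c.CollisionRule c.Annihilate i j t → c.Annihilate i j t :=
    fun i j t h R hR => hR i j t (mono _ _ (fun i j t h => h R hR) i j t h)
  have key : c.Annihilate i j t ↔ c.CollisionRule c.Annihilate i j t :=
    ⟨fun h => h _ fun i j t h => mono _ _ closed i j t h, closed i j t⟩
  rw [key]
  simp [RuleOn, CollisionRule]

/-- Bridge between the two descriptions: outcomes are convenient for gluing systems, the rule is
what defines `Annihilate`. Uniqueness of partners gives the rule from the outcomes; conversely the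
rule excludes every outcome of the meeting other than mutual annihilation. -/
theorem IsDyn.ruleOn_iff (hc : c.Regular) {J : Finset ι} {R : ι → ι → ℝ → Prop}
    (hR : c.IsDyn J R) (i j : ι) (t : ℝ) : R i j t ↔ c.RuleOn J R i j t := by
  constructor
  · intro h
    have side : ∀ i j, R i j t → ∀ k ∈ (J : Set ι), ∀ u : ℝ, k ≠ i → k ≠ j → u < t →
        c.Meet k i u → ∃ k' u', k' ≠ i ∧ k' ≠ j ∧ u' ≤ u ∧ R k k' u' := by
      intro i j h k hk u hki hkj hu hm
      have alive : ∀ k' u', u' ≤ u → R k k' u' → k' ≠ i ∧ k' ≠ j := fun k' u' hu' hr =>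
        ⟨by rintro rfl; exact hkj (hR.partner (hR.symm hr) h),
          by rintro rfl; exact hki (hR.partner (hR.symm hr) (hR.symm h))⟩
      rcases hR.resolve hk (hR.mem h) hm with h1 | ⟨k', u', hu', h1⟩ | ⟨k', u', hu', h1⟩ |
        ⟨k', h1, -⟩ | ⟨k', h1, -⟩
      · exact ⟨_, _, (alive _ _ le_rfl h1).1, (alive _ _ le_rfl h1).2, le_rfl, h1⟩
      · exact ⟨_, _, (alive _ _ hu'.le h1).1, (alive _ _ hu'.le h1).2, hu'.le, h1⟩
      · exact absurd ⟨k', u', hu'.trans hu, h1⟩ (hR.not_dead hc h)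
      · exact ⟨_, _, (alive _ _ le_rfl h1).1, (alive _ _ le_rfl h1).2, le_rfl, h1⟩
      · exact absurd ⟨k', u, hu, h1⟩ (hR.not_dead hc h)
    refine ⟨hR.mem h, hR.mem (hR.symm h), hR.meet h, ?_, ?_⟩
    · rintro k hk u hki hkj hu (hm | hm)
      · exact side i j h k hk u hki hkj hu hm
      · obtain ⟨k', u', h1, h2, h3⟩ := side j i (hR.symm h) k hk u hkj hki hu hm
        exact ⟨k', u', h2, h1, h3⟩
    · intro k hk hki hkj
      rcases hR.resolve hk (hR.mem h) hki with h1 | h1 | h1 | ⟨k', h1, -⟩ | ⟨k', h1, hs⟩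
      · exact absurd (hR.partner (hR.symm h1) h) hkj.1
      · exact Or.inr h1
      · exact absurd h1 (hR.not_dead hc h)
      · have hi : k' ≠ i := by rintro rfl; exact hkj.1 (hR.partner (hR.symm h1) h)
        have hj : k' ≠ j := by rintro rfl; exact hki.1 (hR.partner (hR.symm h1) (hR.symm h))
        exact absurd (hc.eq_of_meet (hR.meet h1) hki hkj hi hj) (hR.meet h).1
      · obtain rfl := hR.partner h1 h
        exact Or.inl hs
  · rintro ⟨hi, hj, hm, h2, h3⟩
    -- If `k` had annihilated `i` at a time `u < t`, the rule would provide `k` with a partner other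
    -- than `i`.
    have nd : ∀ i j, j ∈ J → c.Meet i j t → (∀ k ∈ (J : Set ι), ∀ u : ℝ, k ≠ i → k ≠ j → u < t →
        c.Meet k i u → ∃ (k' : ι) (u' : ℝ), k' ≠ i ∧ k' ≠ j ∧ u' ≤ u ∧ R k k' u') →
        ¬ Dead R i t := by
      rintro i j hj hm h2 ⟨k, u, hu, h⟩
      have hkj : k ≠ j := by
        rintro rfl; exact hu.ne (hc.meet_time_unique (hR.meet h) hm)
      obtain ⟨k', u', h4, -, -, h5⟩ := h2 k (hR.mem (hR.symm h)) u (hR.meet h).1.symm hkj hu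
        (hR.meet h).symm
      exact h4 (hR.partner h5 (hR.symm h))
    -- If `i` annihilates with a third particle `k` at time `t` while `j` is saved, the rule says
    -- that `k` is saved too or already dead; both are impossible.
    have saved : ∀ i j, c.Meet i j t → (∀ k ∈ (J : Set ι), c.Meet k i t → c.Meet k j t →
        c.SpinSaves k i j ∨ ∃ (k' : ι) (u' : ℝ), u' < t ∧ R k k' u') → ∀ k, R i k t →
        c.SpinSaves j i k → R i j t := by
      intro i j hm h3 k h hs
      by_cases hkj : k = j
      · rwa [← hkj]
      have hik := hR.meet h
      rcases h3 k (hR.mem (hR.symm h)) hik.symm (hik.trans hm hkj) with h4 | h4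
      · exact absurd hs (hc.spinSaves_asymm hm hik (Ne.symm hkj) h4)
      · exact absurd h4 (hR.not_dead hc (hR.symm h))
    have n1 := nd i j hj hm fun k hk u a b d e => h2 k hk u a b d (Or.inl e)
    have n2 := nd j i hi hm.symm fun k hk u a b d e => by
      obtain ⟨k', u', h4, h5, h6⟩ := h2 k hk u b a d (Or.inr e)
      exact ⟨k', u', h5, h4, h6⟩
    rcases hR.resolve hi hj hm with h | h | h | ⟨k, h, hs⟩ | ⟨k, h, hs⟩
    · exact h
    · exact absurd h n1
    · exact absurd h n2
    · exact saved i j hm h3 k h hs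
    · exact hR.symm (saved j i hm.symm (fun k hk a b => (h3 k hk b a).imp_left SpinSaves.symm)
        k h hs)

/-- Two solutions of the collision rule agree on the collisions whose backward light cone only
contains particles that are common to both. -/
theorem Regular.ruleOn_local (hc : c.Regular) {J K : Set ι} {R R' : ι → ι → ℝ → Prop} {b : ℝ}
    (hR : ∀ i j t, R i j t ↔ c.RuleOn J R i j t) (hR' : ∀ i j t, R' i j t ↔ c.RuleOn K R' i j t)
    (hJK : ∀ i, c.x i ≤ b → (i ∈ J ↔ i ∈ K)) (hfin : {i ∈ J | c.x i ≤ b}.Finite)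
    {i j : ι} {t : ℝ} (hm : c.Meet i j t) (hb : c.x i + c.v i * t + t ≤ b) :
    R i j t ↔ R' i j t := by
  have pos : ∀ i t, 0 ≤ t → c.x i + c.v i * t + t ≤ b → c.x i ≤ b := by
    intro i t ht h
    nlinarith [hc.neg_one_le i]
  -- Only finitely many pairs are relevant, so the relevant meeting times form a finite set, on
  -- which `<` is well founded. This is what makes induction on real time possible.
  let S : Set ℝ := {t | ∃ i j, (i ∈ J ∧ c.x i ≤ b) ∧ (j ∈ J ∧ c.x j ≤ b) ∧ c.Meet i j t}
  have hS : S.Finite := by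
    refine (hfin.prod hfin |>.image fun q : ι × ι =>
      (c.x q.2 - c.x q.1) / ((c.v q.1 : ℝ) - c.v q.2)).subset ?_
    rintro t ⟨i, j, hi, hj, hm⟩
    refine ⟨(i, j), ⟨hi, hj⟩, ?_⟩
    have hv : (c.v i : ℝ) - c.v j ≠ 0 := by
      have := hc.vel_ne hm
      rw [sub_ne_zero]; exact_mod_cast this
    have := hm.2.2
    simp only
    rw [div_eq_iff hv]
    linarith
  have outside : ∀ t, t ∉ S → ∀ i j, c.Meet i j t → c.x i + c.v i * t + t ≤ b →
      (R i j t ↔ R' i j t) := by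
    intro t ht i j hm hb
    have hxi := pos i t hm.2.1 hb
    have hxj := pos j t hm.2.1 (hm.2.2 ▸ hb)
    rw [hR, hR']
    constructor
    · rintro ⟨hi, hj, -⟩
      exact absurd ⟨i, j, ⟨hi, hxi⟩, ⟨hj, hxj⟩, hm⟩ ht
    · rintro ⟨hi, hj, -⟩
      exact absurd ⟨i, j, ⟨(hJK i hxi).2 hi, hxi⟩, ⟨(hJK j hxj).2 hj, hxj⟩, hm⟩ ht
  have half : ∀ (J K : Set ι) (R R' : ι → ι → ℝ → Prop),
      (∀ i j t, R i j t ↔ c.RuleOn J R i j t) → (∀ i j t, R' i j t ↔ c.RuleOn K R' i j t) →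
      (∀ i, c.x i ≤ b → (i ∈ J ↔ i ∈ K)) → ∀ t, (∀ u < t, ∀ i j, c.Meet i j u →
        c.x i + c.v i * u + u ≤ b → (R i j u ↔ R' i j u)) →
      ∀ i j, c.Meet i j t → c.x i + c.v i * t + t ≤ b → R i j t → R' i j t := by
    intro J K R R' hR hR' hJK t ih i j hm hb h
    have hxi := pos i t hm.2.1 hb
    have hxj := pos j t hm.2.1 (hm.2.2 ▸ hb)
    obtain ⟨hi, hj, -, h2, h3⟩ := (hR i j t).1 h
    -- `x + v t + t` is the right end at time `0` of the backward light cone. It is nondecreasing in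
    -- `t` because `v ≥ -1`, so anything met earlier has its cone inside the same bound.
    have cone : ∀ i k u, c.x i + c.v i * t + t ≤ b → u ≤ t → c.Meet k i u →
        c.x k + c.v k * u + u ≤ b := by
      intro i k u hb hu hm
      rw [hm.2.2]
      nlinarith [hc.neg_one_le i]
    have step : ∀ k k' u u', u < t → u' ≤ u → c.x k + c.v k * u + u ≤ b → R k k' u' →
        R' k k' u' := by
      intro k k' u u' hu hu' hb hr
      refine (ih u' (hu'.trans_lt hu) k k' ((hR _ _ _).1 hr).2.2.1 ?_).1 hr
      nlinarith [hc.neg_one_le k]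
    refine (hR' i j t).2 ⟨(hJK i hxi).1 hi, (hJK j hxj).1 hj, hm, ?_, ?_⟩
    · intro k hk u hki hkj hu hmm
      have hbk : c.x k + c.v k * u + u ≤ b := by
        rcases hmm with hmm | hmm
        · exact cone i k u hb hu.le hmm
        · exact cone j k u (hm.2.2 ▸ hb) hu.le hmm
      have hu0 : 0 ≤ u := by rcases hmm with hmm | hmm <;> exact hmm.2.1
      obtain ⟨k', u', h4, h5, h6, h7⟩ :=
        h2 k ((hJK k (pos k u hu0 hbk)).2 hk) u hki hkj hu hmm
      exact ⟨k', u', h4, h5, h6, step k k' u u' hu h6 hbk h7⟩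
    · intro k hk hki hkj
      have hbk := cone i k t hb le_rfl hki
      refine (h3 k ((hJK k (pos k t hm.2.1 hbk)).2 hk) hki hkj).imp_right ?_
      rintro ⟨k', u', hu', hr⟩
      refine ⟨k', u', hu', (ih u' hu' k k' ((hR _ _ _).1 hr).2.2.1 ?_).1 hr⟩
      nlinarith [hc.neg_one_le k]
  suffices ∀ t ∈ S, ∀ i j, c.Meet i j t → c.x i + c.v i * t + t ≤ b → (R i j t ↔ R' i j t) by
    by_cases ht : t ∈ S
    · exact this t ht i j hm hb
    · exact outside t ht i j hm hb
  intro t ht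
  refine Set.WellFoundedOn.induction (r := (· < ·)) (P := fun t => ∀ i j, c.Meet i j t →
    c.x i + c.v i * t + t ≤ b → (R i j t ↔ R' i j t)) hS.wellFoundedOn ht ?_
  intro t ht ih i j hm hb
  have ih' : ∀ u < t, ∀ i j, c.Meet i j u → c.x i + c.v i * u + u ≤ b →
      (R i j u ↔ R' i j u) := by
    intro u hu
    by_cases huS : u ∈ S
    · exact ih u huS hu
    · exact outside u huS
  exact ⟨half J K R R' hR hR' hJK t ih' i j hm hb,
    half K J R' R hR' hR (fun i hi => (hJK i hi).symm) t
      (fun u hu i j h1 h2 => (ih' u hu i j h1 h2).symm) i j hm hb⟩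

/-! ### Existence and uniqueness of the dynamics of a finite system. -/

theorem Dead.mono {R R' : ι → ι → ℝ → Prop} (h : ∀ i j t, R i j t → R' i j t) {i : ι} {t : ℝ}
    (hd : Dead R i t) : Dead R' i t := by
  obtain ⟨k, u, hu, hr⟩ := hd
  exact ⟨k, u, hu, h _ _ _ hr⟩

theorem Outcome.mono {R R' : ι → ι → ℝ → Prop} (h : ∀ i j t, R i j t → R' i j t) {i j : ι} {t : ℝ}
    (ho : c.Outcome R i j t) : c.Outcome R' i j t := by
  rcases ho with ho | ho | ho | ⟨k, hk, hs⟩ | ⟨k, hk, hs⟩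
  · exact Or.inl (h _ _ _ ho)
  · exact Or.inr (Or.inl (ho.mono h))
  · exact Or.inr (Or.inr (Or.inl (ho.mono h)))
  · exact Or.inr (Or.inr (Or.inr (Or.inl ⟨k, h _ _ _ hk, hs⟩)))
  · exact Or.inr (Or.inr (Or.inr (Or.inr ⟨k, h _ _ _ hk, hs⟩)))

theorem Outcome.symm {R : ι → ι → ℝ → Prop} (hR : ∀ i j t, R i j t → R j i t) {i j : ι} {t : ℝ}
    (ho : c.Outcome R i j t) : c.Outcome R j i t := by
  rcases ho with ho | ho | ho | ho | ho
  · exact Or.inl (hR _ _ _ ho)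
  · exact Or.inr (Or.inr (Or.inl ho))
  · exact Or.inr (Or.inl ho)
  · exact Or.inr (Or.inr (Or.inr (Or.inr ho)))
  · exact Or.inr (Or.inr (Or.inr (Or.inl ho)))

/-- Take a pair with minimal meeting time; if a third particle is present there, the spin selects
which of the three pairs is annihilated. -/
theorem Regular.exists_first_collision (hc : c.Regular) (J : Finset ι)
    (h : ∃ i ∈ J, ∃ j ∈ J, ∃ t, c.Meet i j t) :
    ∃ i ∈ J, ∃ j ∈ J, ∃ t, c.Meet i j t ∧ (∀ k ∈ J, ∀ l ∈ J, ∀ u, c.Meet k l u → t ≤ u) ∧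
      ∀ k ∈ J, c.Meet i k t → k ≠ j → c.SpinSaves k i j := by
  classical
  let T : ι × ι → ℝ := fun q => (c.x q.2 - c.x q.1) / ((c.v q.1 : ℝ) - c.v q.2)
  have hT : ∀ {i j t}, c.Meet i j t → T (i, j) = t := by
    intro i j t hm
    have hv : (c.v i : ℝ) - c.v j ≠ 0 := by
      have := hc.vel_ne hm
      rw [sub_ne_zero]; exact_mod_cast this
    have := hm.2.2
    simp only [T]
    rw [div_eq_iff hv]
    linarith
  obtain ⟨i₀, hi₀, j₀, hj₀, t₀, hm₀⟩ := h
  obtain ⟨⟨i, j⟩, hij, hmin⟩ := Finset.exists_min_image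
    ((J ×ˢ J).filter fun q => ∃ t, c.Meet q.1 q.2 t) T ⟨(i₀, j₀), by simp [hi₀, hj₀]; exact ⟨_, hm₀⟩⟩
  simp only [Finset.mem_filter, Finset.mem_product] at hij hmin
  obtain ⟨⟨hi, hj⟩, t, hm⟩ := hij
  have hle : ∀ k ∈ J, ∀ l ∈ J, ∀ u, c.Meet k l u → t ≤ u := by
    intro k hk l hl u hu
    have := hmin (k, l) ⟨⟨hk, hl⟩, u, hu⟩
    rwa [hT hm, hT hu] at this
  by_cases hs : ∀ k ∈ J, c.Meet i k t → k ≠ j → c.SpinSaves k i j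
  · exact ⟨i, hi, j, hj, t, hm, hle, hs⟩
  push Not at hs
  obtain ⟨k, hk, hik, hkj, hs⟩ := hs
  rcases hc.exists_spinSaves hm hik hkj.symm with h | h | h
  · exact absurd h hs
  · refine ⟨i, hi, k, hk, t, hik, hle, fun l _ hil hlk => ?_⟩
    rwa [← hc.eq_of_meet hik hm hil hkj (Ne.symm hlk)]
  · refine ⟨j, hj, k, hk, t, hm.trans hik hkj.symm, hle, fun l _ hjl hlk => ?_⟩
    rwa [← hc.eq_of_meet (hm.trans hik hkj.symm) hm.symm hjl (Ne.symm hik.1) (Ne.symm hlk)]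

/-- Gluing tool: since `R` never annihilates `i` or `j`, adding this pair preserves uniqueness of
partners, and only meetings that involve `i`, `j` or a new particle remain to be resolved. -/
theorem IsDyn.insert_pair {J : Finset ι} [DecidableEq ι] {R : ι → ι → ℝ → Prop}
    (hR : c.IsDyn J R) {i j : ι} {t : ℝ} (hm : c.Meet i j t) {K : Finset ι} (hJK : J ⊆ K)
    (hiK : i ∈ K) (hjK : j ∈ K)
    (hi : ∀ k u, ¬ R i k u) (hj : ∀ k u, ¬ R j k u)
    (hres : ∀ {a b u}, a ∈ K → b ∈ K → (a = i ∨ a = j ∨ a ∉ J) → c.Meet a b u →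
      c.Outcome (fun a b u => R a b u ∨ u = t ∧ (a = i ∧ b = j ∨ a = j ∧ b = i)) a b u) :
    c.IsDyn K (fun a b u => R a b u ∨ u = t ∧ (a = i ∧ b = j ∨ a = j ∧ b = i)) where
  mem := by
    rintro a b u (h | ⟨-, ⟨rfl, rfl⟩ | ⟨rfl, rfl⟩⟩)
    exacts [hJK (hR.mem h), hiK, hjK]
  symm := by
    rintro a b u (h | ⟨rfl, ⟨rfl, rfl⟩ | ⟨rfl, rfl⟩⟩)
    · exact Or.inl (hR.symm h)
    · exact Or.inr ⟨rfl, Or.inr ⟨rfl, rfl⟩⟩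
    · exact Or.inr ⟨rfl, Or.inl ⟨rfl, rfl⟩⟩
  meet := by
    rintro a b u (h | ⟨rfl, ⟨rfl, rfl⟩ | ⟨rfl, rfl⟩⟩)
    exacts [hR.meet h, hm, hm.symm]
  partner := by
    have := hm.1
    rintro a b b' u u' (h | ⟨rfl, ⟨rfl, rfl⟩ | ⟨rfl, rfl⟩⟩)
      (h' | ⟨rfl, ⟨h1, h2⟩ | ⟨h1, h2⟩⟩)
    · exact hR.partner h h'
    · exact absurd (h1 ▸ h) (hi _ _)
    · exact absurd (h1 ▸ h) (hj _ _)
    · exact absurd h' (hi _ _)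
    · exact h2.symm
    · exact absurd h1 this
    · exact absurd h' (hj _ _)
    · exact absurd h1.symm this
    · exact h2.symm
  resolve := by
    intro a b u ha hb hab
    by_cases h : a = i ∨ a = j ∨ a ∉ J
    · exact hres ha hb h hab
    by_cases h' : b = i ∨ b = j ∨ b ∉ J
    · refine Outcome.symm ?_ (hres hb ha h' hab.symm)
      rintro a b u (h | ⟨rfl, ⟨rfl, rfl⟩ | ⟨rfl, rfl⟩⟩)
      · exact Or.inl (hR.symm h)
      · exact Or.inr ⟨rfl, Or.inr ⟨rfl, rfl⟩⟩
      · exact Or.inr ⟨rfl, Or.inl ⟨rfl, rfl⟩⟩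
    push Not at h h'
    exact Outcome.mono (fun _ _ _ => Or.inl) (hR.resolve h.2.2 h'.2.2 hab)

/-- Strong induction on the set: the pair of the first collision disappears before it can affect
anybody else, so the other particles evolve as if it were absent. -/
theorem Regular.exists_isDyn (hc : c.Regular) (J : Finset ι) : ∃ R, c.IsDyn J R := by
  classical
  induction J using Finset.strongInduction with
  | H J ih =>
  by_cases h : ∃ i ∈ J, ∃ j ∈ J, ∃ t, c.Meet i j t
  · obtain ⟨i, hi, j, hj, t, hm, hle, hs⟩ := hc.exists_first_collision J h
    obtain ⟨R, hR⟩ := ih ((J.erase i).erase j)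
      ((Finset.erase_subset _ _).trans_ssubset (Finset.erase_ssubset hi))
    have hi' : ∀ k u, ¬ R i k u := fun k u h => by simpa using hR.mem h
    have hj' : ∀ k u, ¬ R j k u := fun k u h => by simpa using hR.mem h
    refine ⟨_, hR.insert_pair hm ((Finset.erase_subset _ _).trans (Finset.erase_subset _ _))
      hi hj hi' hj' ?_⟩
    intro a b u ha hb hab hm'
    have hab' : a = i ∨ a = j := by
      rcases hab with h | h | h
      · exact Or.inl h
      · exact Or.inr h
      · simp only [Finset.mem_erase, not_and_or, not_not] at h
        tauto
    rcases (hle a ha b hb u hm').lt_or_eq with hlt | rfl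
    · right; left
      rcases hab' with rfl | rfl
      · exact ⟨j, t, hlt, Or.inr ⟨rfl, Or.inl ⟨rfl, rfl⟩⟩⟩
      · exact ⟨i, t, hlt, Or.inr ⟨rfl, Or.inr ⟨rfl, rfl⟩⟩⟩
    · rcases hab' with rfl | rfl
      · by_cases hbj : b = j
        · exact Or.inl (Or.inr ⟨rfl, Or.inl ⟨rfl, hbj⟩⟩)
        · exact Or.inr (Or.inr (Or.inr (Or.inl
            ⟨j, Or.inr ⟨rfl, Or.inl ⟨rfl, rfl⟩⟩, hs b hb hm' hbj⟩)))
      · by_cases hbi : b = i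
        · exact Or.inl (Or.inr ⟨rfl, Or.inr ⟨rfl, hbi⟩⟩)
        · exact Or.inr (Or.inr (Or.inr (Or.inl ⟨i, Or.inr ⟨rfl, Or.inr ⟨rfl, rfl⟩⟩,
            (hs b hb (hm.symm.trans hm' (Ne.symm hbi)) hm'.1.symm).symm⟩)))
  · refine ⟨fun _ _ _ => False, ⟨?_, ?_, ?_, ?_, ?_⟩⟩
    · intro _ _ _ h; exact h.elim
    · intro _ _ _ h; exact h
    · intro _ _ _ h; exact h.elim
    · intro _ _ _ _ _ h; exact h.elim
    · intro i j t hi hj hm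
      exact absurd ⟨i, hi, j, hj, t, hm⟩ h

/-- `c.ann J i j t`: the particles `i` and `j` annihilate each other at time `t` when only the
particles in `J` are present. -/
def ann (c : Config ι) (J : Finset ι) (i j : ι) (t : ℝ) : Prop := ∃ R, c.IsDyn J R ∧ R i j t

/-- The particle `i ∈ J` is never annihilated when only the particles in `J` are present. -/
def Surv (c : Config ι) (J : Finset ι) (i : ι) : Prop := i ∈ J ∧ ∀ k t, ¬ c.ann J i k t

theorem IsDyn.local (hc : c.Regular) {J K : Finset ι} {R R' : ι → ι → ℝ → Prop} {b : ℝ}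
    (hR : c.IsDyn J R) (hR' : c.IsDyn K R') (hJK : ∀ i, c.x i ≤ b → (i ∈ J ↔ i ∈ K))
    {i j : ι} {t : ℝ} (hm : c.Meet i j t) (hb : c.x i + c.v i * t + t ≤ b) :
    R i j t ↔ R' i j t :=
  hc.ruleOn_local (hR.ruleOn_iff hc) (hR'.ruleOn_iff hc) (by simpa using hJK)
    (J.finite_toSet.subset fun _ h => h.1) hm hb

theorem IsDyn.unique (hc : c.Regular) {J : Finset ι} {R R' : ι → ι → ℝ → Prop}
    (hR : c.IsDyn J R) (hR' : c.IsDyn J R') {i j : ι} {t : ℝ} : R i j t ↔ R' i j t := by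
  have key : ∀ R R' : ι → ι → ℝ → Prop, c.IsDyn J R → c.IsDyn J R' → R i j t → R' i j t :=
    fun R R' hR hR' h => (hR.local hc hR' (fun _ _ => Iff.rfl) (hR.meet h) le_rfl).1 h
  exact ⟨key R R' hR hR', key R' R hR' hR⟩

theorem IsDyn.ann_iff (hc : c.Regular) {J : Finset ι} {R : ι → ι → ℝ → Prop} (hR : c.IsDyn J R)
    {i j : ι} {t : ℝ} : c.ann J i j t ↔ R i j t :=
  ⟨fun ⟨_, h, h'⟩ => (h.unique hc hR).1 h', fun h => ⟨R, hR, h⟩⟩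

theorem Regular.isDyn_ann (hc : c.Regular) (J : Finset ι) : c.IsDyn J (c.ann J) := by
  obtain ⟨R, hR⟩ := hc.exists_isDyn J
  have : c.ann J = R := by
    ext i j t
    exact hR.ann_iff hc
  rwa [this]

/-- A particle that meets a survivor is annihilated no later than that time. -/
theorem Surv.exists_ann (hc : c.Regular) {J : Finset ι} {i j : ι} {t : ℝ} (hi : c.Surv J i)
    (hj : j ∈ J) (hm : c.Meet i j t) : ∃ k u, u ≤ t ∧ c.ann J j k u := by
  rcases (hc.isDyn_ann J).resolve hi.1 hj hm with h | ⟨k, u, -, h⟩ | ⟨k, u, hu, h⟩ | ⟨k, h, -⟩ |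
    ⟨k, h, -⟩
  · exact absurd h (hi.2 _ _)
  · exact absurd h (hi.2 _ _)
  · exact ⟨k, u, hu.le, h⟩
  · exact absurd h (hi.2 _ _)
  · exact ⟨k, t, le_rfl, h⟩

theorem not_surv {J : Finset ι} {i : ι} (hi : i ∈ J) (h : ¬ c.Surv J i) :
    ∃ k t, c.ann J i k t := by
  unfold Surv at h
  push Not at h
  exact h hi

/-- Two groups of particles that do not interact evolve separately. -/
theorem Regular.ann_union (hc : c.Regular) [DecidableEq ι] {J K : Finset ι} (hJK : Disjoint J K)
    (hres : ∀ i ∈ J, ∀ j ∈ K, ∀ t, c.Meet i j t →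
      c.Outcome (fun i j t => c.ann J i j t ∨ c.ann K i j t) i j t) {i j : ι} {t : ℝ} :
    c.ann (J ∪ K) i j t ↔ c.ann J i j t ∨ c.ann K i j t := by
  have hJ := hc.isDyn_ann J
  have hK := hc.isDyn_ann K
  refine IsDyn.ann_iff hc (R := fun i j t => c.ann J i j t ∨ c.ann K i j t)
    ⟨?_, ?_, ?_, ?_, ?_⟩
  · rintro i j t (h | h)
    exacts [Finset.mem_union_left _ (hJ.mem h), Finset.mem_union_right _ (hK.mem h)]
  · rintro i j t (h | h)
    exacts [Or.inl (hJ.symm h), Or.inr (hK.symm h)]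
  · rintro i j t (h | h)
    exacts [hJ.meet h, hK.meet h]
  · rintro i j j' t t' (h | h) (h' | h')
    · exact hJ.partner h h'
    · exact absurd (hK.mem h') (Finset.disjoint_left.1 hJK (hJ.mem h))
    · exact absurd (hK.mem h) (Finset.disjoint_left.1 hJK (hJ.mem h'))
    · exact hK.partner h h'
  · intro i j t hi hj hm
    rcases Finset.mem_union.1 hi with hi | hi <;> rcases Finset.mem_union.1 hj with hj | hj
    · exact Outcome.mono (fun _ _ _ => Or.inl) (hJ.resolve hi hj hm)
    · exact hres i hi j hj t hm
    · refine Outcome.symm ?_ (hres j hj i hi t hm.symm)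
      rintro i j t (h | h)
      exacts [Or.inl (hJ.symm h), Or.inr (hK.symm h)]
    · exact Outcome.mono (fun _ _ _ => Or.inr) (hK.resolve hi hj hm)

/-! ### Translation and reflection invariance. -/

/-- Dynamics are transported by an injective relabelling of the particles composed with a
translation and possibly a reflection. -/
theorem ann_transport {c' : Config κ} (hc : c.Regular) (hc' : c'.Regular) [DecidableEq κ]
    {J : Finset ι} {e : ι → κ} (he : Set.InjOn e J) {σ : ℤ} (hσ : σ = 1 ∨ σ = -1) {C : ℝ}
    (hx : ∀ i ∈ J, c'.x (e i) = σ * c.x i + C) (hv : ∀ i ∈ J, c'.v (e i) = σ * c.v i)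
    (hs : ∀ i ∈ J, c'.s (e i) = σ * c.s i) {i j : ι} (hi : i ∈ J) (hj : j ∈ J) {t : ℝ} :
    c'.ann (J.image e) (e i) (e j) t ↔ c.ann J i j t := by
  have hR := hc'.isDyn_ann (J.image e)
  have hmeet : ∀ i ∈ J, ∀ j ∈ J, ∀ t, c'.Meet (e i) (e j) t ↔ c.Meet i j t := by
    intro i hi j hj t
    unfold Meet
    rw [he.ne_iff hi hj, hx i hi, hx j hj, hv i hi, hv j hj]
    push_cast
    refine and_congr_right fun _ => and_congr_right fun _ => ?_
    rcases hσ with rfl | rfl <;> push_cast <;> constructor <;> intro h <;> linarith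
  have hspin : ∀ k ∈ J, ∀ i ∈ J, ∀ j ∈ J, c'.SpinSaves (e k) (e i) (e j) ↔ c.SpinSaves k i j := by
    intro k hk i hi j hj
    unfold SpinSaves
    rw [hv k hk, hv i hi, hv j hj, hs i hi, hs j hj]
    rcases hσ with rfl | rfl <;> simp
  have hlift : ∀ i k t, c'.ann (J.image e) (e i) k t → ∃ k' ∈ J, e k' = k := by
    intro i k t h
    simpa using hR.mem (hR.symm h)
  have key : c.IsDyn J (fun i j t => i ∈ J ∧ j ∈ J ∧ c'.ann (J.image e) (e i) (e j) t) := by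
    refine ⟨fun h => h.1, fun h => ⟨h.2.1, h.1, hR.symm h.2.2⟩, ?_, ?_, ?_⟩
    · rintro i j t ⟨hi, hj, h⟩
      exact (hmeet i hi j hj t).1 (hR.meet h)
    · rintro i j j' t t' ⟨hi, hj, h⟩ ⟨_, hj', h'⟩
      exact he hj hj' (hR.partner h h')
    · intro i j t hi hj hm
      have dead : ∀ i ∈ J, Dead (c'.ann (J.image e)) (e i) t →
          Dead (fun i j t => i ∈ J ∧ j ∈ J ∧ c'.ann (J.image e) (e i) (e j) t) i t := by
        rintro i hi ⟨k, u, hu, h⟩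
        obtain ⟨k, hk, rfl⟩ := hlift _ _ _ h
        exact ⟨k, u, hu, hi, hk, h⟩
      rcases hR.resolve (Finset.mem_image_of_mem e hi) (Finset.mem_image_of_mem e hj)
        ((hmeet i hi j hj t).2 hm) with h | h | h | ⟨k, h, h'⟩ | ⟨k, h, h'⟩
      · exact Or.inl ⟨hi, hj, h⟩
      · exact Or.inr (Or.inl (dead i hi h))
      · exact Or.inr (Or.inr (Or.inl (dead j hj h)))
      · obtain ⟨k, hk, rfl⟩ := hlift _ _ _ h
        exact Or.inr (Or.inr (Or.inr (Or.inl ⟨k, ⟨hi, hk, h⟩, (hspin j hj i hi k hk).1 h'⟩)))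
      · obtain ⟨k, hk, rfl⟩ := hlift _ _ _ h
        exact Or.inr (Or.inr (Or.inr (Or.inr ⟨k, ⟨hj, hk, h⟩, (hspin i hi j hj k hk).1 h'⟩)))
  rw [key.ann_iff hc]
  simp [hi, hj]

theorem surv_transport {c' : Config κ} (hc : c.Regular) (hc' : c'.Regular) [DecidableEq κ]
    {J : Finset ι} {e : ι → κ} (he : Set.InjOn e J) {σ : ℤ} (hσ : σ = 1 ∨ σ = -1) {C : ℝ}
    (hx : ∀ i ∈ J, c'.x (e i) = σ * c.x i + C) (hv : ∀ i ∈ J, c'.v (e i) = σ * c.v i)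
    (hs : ∀ i ∈ J, c'.s (e i) = σ * c.s i) {i : ι} (hi : i ∈ J) :
    c'.Surv (J.image e) (e i) ↔ c.Surv J i := by
  have hR := hc'.isDyn_ann (J.image e)
  have hR' := hc.isDyn_ann J
  refine ⟨fun h => ⟨hi, fun k t hk => ?_⟩, fun h => ⟨Finset.mem_image_of_mem e hi, fun k t hk => ?_⟩⟩
  · exact h.2 (e k) t ((ann_transport hc hc' he hσ hx hv hs hi (hR'.mem (hR'.symm hk))).2 hk)
  · obtain ⟨k, hk', rfl⟩ := Finset.mem_image.1 (hR.mem (hR.symm hk))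
    exact h.2 k t ((ann_transport hc hc' he hσ hx hv hs hi hk').1 hk)

/-- The reflected configuration. -/
def mirror (c : Config ι) : Config ι := ⟨fun i => -c.x i, fun i => -c.v i, fun i => -c.s i⟩

theorem Regular.mirror (hc : c.Regular) : c.mirror.Regular where
  inj := fun i j h => hc.inj (by simpa [Config.mirror] using h)
  vel := fun i => by have := hc.vel i; simp only [Config.mirror]; omega
  spin := fun i => by have := hc.spin i; simp only [Config.mirror]; omega

theorem Regular.mirror_ann (hc : c.Regular) {J : Finset ι} {i j : ι} {t : ℝ} :
    c.mirror.ann J i j t ↔ c.ann J i j t := by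
  classical
  have h0 := hc.isDyn_ann J
  have h1 := hc.mirror.isDyn_ann J
  have key : i ∈ J → j ∈ J → (c.mirror.ann J i j t ↔ c.ann J i j t) := by
    intro hi hj
    have := ann_transport (c' := c.mirror) hc hc.mirror (J := J) (e := id) (σ := -1) (C := 0)
      (Function.injective_id.injOn) (Or.inr rfl) (by simp [Config.mirror])
      (by simp [Config.mirror]) (by simp [Config.mirror]) hi hj (t := t)
    simpa using this
  exact ⟨fun h => (key (h1.mem h) (h1.mem (h1.symm h))).1 h,
    fun h => (key (h0.mem h) (h0.mem (h0.symm h))).2 h⟩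

theorem Regular.mirror_surv (hc : c.Regular) {J : Finset ι} {i : ι} :
    c.mirror.Surv J i ↔ c.Surv J i := by
  simp only [Surv, hc.mirror_ann]

/-! ### Extreme particles: what a left-mover sees, and the first particle to leave a block. -/

/-- Only the particles on its left matter for a particle of velocity `-1`. -/
theorem Regular.ann_left_mover (hc : c.Regular) {J K : Finset ι} {l : ι} (hv : c.v l = -1)
    (hJK : ∀ i, c.x i ≤ c.x l → (i ∈ J ↔ i ∈ K)) {j : ι} {t : ℝ} :
    c.ann J l j t ↔ c.ann K l j t := by
  have hJ := hc.isDyn_ann J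
  have hK := hc.isDyn_ann K
  -- For velocity `-1` the right end of the backward light cone stays at the starting point.
  have hb : c.x l + c.v l * t + t ≤ c.x l := by rw [hv]; push_cast; linarith
  exact ⟨fun h => (hJ.local hc hK hJK (hJ.meet h) hb).1 h,
    fun h => (hJ.local hc hK hJK (hK.meet h) hb).2 h⟩

theorem Regular.surv_left_mover (hc : c.Regular) {J K : Finset ι} {l : ι} (hv : c.v l = -1)
    (hJK : ∀ i, c.x i ≤ c.x l → (i ∈ J ↔ i ∈ K)) : c.Surv J l ↔ c.Surv K l := by
  simp only [Surv, hc.ann_left_mover hv hJK, hJK l le_rfl]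

theorem Regular.ann_right_mover (hc : c.Regular) {J K : Finset ι} {l : ι} (hv : c.v l = 1)
    (hJK : ∀ i, c.x l ≤ c.x i → (i ∈ J ↔ i ∈ K)) {j : ι} {t : ℝ} :
    c.ann J l j t ↔ c.ann K l j t := by
  rw [← hc.mirror_ann, ← hc.mirror_ann (J := K)]
  exact hc.mirror.ann_left_mover (by simp [Config.mirror, hv])
    fun i hi => hJK i (by simpa [Config.mirror] using hi)

/-- `l` is the rightmost particle of `J`, it has velocity `-1`, it crosses all of `J`, and no other
particle leaves `J` on the left. -/
structure IsFirst (c : Config ι) (J : Finset ι) (l : ι) : Prop where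
  vel : c.v l = -1
  surv : c.Surv J l
  le : ∀ i ∈ J, c.x i ≤ c.x l
  eq : ∀ i ∈ J, c.v i = -1 → c.Surv J i → i = l

/-- The mirror image of `IsFirst`. -/
structure IsFirstR (c : Config ι) (J : Finset ι) (l : ι) : Prop where
  vel : c.v l = 1
  surv : c.Surv J l
  le : ∀ i ∈ J, c.x l ≤ c.x i
  eq : ∀ i ∈ J, c.v i = 1 → c.Surv J i → i = l

theorem Regular.mirror_isFirst (hc : c.Regular) {J : Finset ι} {l : ι} :
    c.mirror.IsFirst J l ↔ c.IsFirstR J l := by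
  constructor
  · rintro ⟨h1, h2, h3, h4⟩
    refine ⟨by simpa [Config.mirror, neg_eq_iff_eq_neg] using h1, hc.mirror_surv.1 h2, fun i hi => by simpa [Config.mirror] using h3 i hi,
      fun i hi hv hs => h4 i hi (by simp [Config.mirror, hv]) (hc.mirror_surv.2 hs)⟩
  · rintro ⟨h1, h2, h3, h4⟩
    exact ⟨by simp [Config.mirror, h1], hc.mirror_surv.2 h2, fun i hi => by simpa [Config.mirror] using h3 i hi,
      fun i hi hv hs => h4 i hi (by simpa [Config.mirror, neg_eq_iff_eq_neg] using hv) (hc.mirror_surv.1 hs)⟩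

/-- Choose the leftmost surviving left-mover. Discarding the particles on its right does not change
the fate of any left-mover that remains. -/
theorem Regular.exists_isFirst (hc : c.Regular) {J : Finset ι}
    (h : ∃ l ∈ J, c.v l = -1 ∧ c.Surv J l) :
    ∃ l ∈ J, c.IsFirst (J.filter fun i => c.x i ≤ c.x l) l ∧
      ∀ i ∈ J, c.v i = -1 → c.Surv J i → c.x l ≤ c.x i := by
  classical
  obtain ⟨l₀, hl₀⟩ := h
  obtain ⟨l, hl, hmin⟩ := Finset.exists_min_image
    (J.filter fun l => c.v l = -1 ∧ c.Surv J l) c.x ⟨l₀, by simpa using hl₀⟩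
  simp only [Finset.mem_filter] at hl hmin
  refine ⟨l, hl.1, ⟨hl.2.1, ?_, ?_, ?_⟩, fun i hi hv hs => hmin i ⟨hi, hv, hs⟩⟩
  · exact (hc.surv_left_mover hl.2.1 fun i hi => by simp [hi]).1 hl.2.2
  · intro i hi
    exact (Finset.mem_filter.1 hi).2
  · intro i hi hv hs
    rw [Finset.mem_filter] at hi
    have : c.Surv J i := (hc.surv_left_mover hv fun k hk => by simp [hk.trans hi.2]).2 hs
    exact hc.inj (le_antisymm hi.2 (hmin i ⟨hi.1, hv, this⟩))

theorem Regular.exists_isFirstR (hc : c.Regular) {J : Finset ι}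
    (h : ∃ l ∈ J, c.v l = 1 ∧ c.Surv J l) :
    ∃ l ∈ J, c.IsFirstR (J.filter fun i => c.x l ≤ c.x i) l ∧
      ∀ i ∈ J, c.v i = 1 → c.Surv J i → c.x i ≤ c.x l := by
  obtain ⟨l, hl, h1, h2⟩ := hc.mirror.exists_isFirst (J := J) (by
    obtain ⟨l, hl, hv, hs⟩ := h
    exact ⟨l, hl, by simp [Config.mirror, hv], hc.mirror_surv.2 hs⟩)
  refine ⟨l, hl, ?_, fun i hi hv hs => ?_⟩
  · rw [hc.mirror_isFirst] at h1
    simpa [Config.mirror] using h1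
  · simpa [Config.mirror] using h2 i hi (by simp [Config.mirror, hv]) (hc.mirror_surv.2 hs)

/-! ### Criteria for two groups of particles not to interact. -/

/-- A particle of velocity `-1` annihilated by particles starting on the right of `y` is annihilated
before it reaches `y`. -/
theorem Regular.ann_time_lt (hc : c.Regular) {R : Finset ι} {y : ℝ} (hR : ∀ i ∈ R, y < c.x i)
    {l k : ι} {u : ℝ} (hv : c.v l = -1) (h : c.ann R l k u) : u < c.x l - y := by
  have hd := hc.isDyn_ann R
  have hm := hd.meet h
  have hk := hR k (hd.mem (hd.symm h))
  have hne := hc.vel_ne hm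
  have h1 := hm.2.2
  have h0 := hm.2.1
  rw [hv] at h1
  push_cast at h1
  rcases hc.vel k with hvk | hvk | hvk
  · omega
  · rw [hvk] at h1; push_cast at h1; linarith
  · rw [hvk] at h1; push_cast at h1; linarith

theorem Regular.ann_time_lt_right (hc : c.Regular) {R : Finset ι} {y : ℝ}
    (hR : ∀ i ∈ R, c.x i < y) {l k : ι} {u : ℝ} (hv : c.v l = 1) (h : c.ann R l k u) :
    u < y - c.x l := by
  have := hc.mirror.ann_time_lt (R := R) (y := -y) (by simpa [Config.mirror] using hR)
    (by simp [Config.mirror, hv]) (hc.mirror_ann.2 h)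
  simp only [Config.mirror] at this
  linarith

/-- If no particle of `R` crosses `y` to the left too early and every particle of `J` moving right
is annihilated when it reaches `y`, then `J` and `R` do not interact. -/
theorem Regular.ann_union_wall (hc : c.Regular) [DecidableEq ι] {J R : Finset ι} {y : ℝ}
    (hJ : ∀ i ∈ J, c.x i ≤ y) (hR : ∀ i ∈ R, y < c.x i)
    (hJ' : ∀ i ∈ J, c.v i = 1 → ∃ k u, u ≤ y - c.x i ∧ c.ann J i k u)
    (hR' : ∀ l ∈ R, c.v l = -1 → c.Surv R l → ∀ i ∈ J, ∀ t, c.Meet i l t →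
      c.Outcome (fun i j t => c.ann J i j t ∨ c.ann R i j t) i l t) {i j : ι} {t : ℝ} :
    c.ann (J ∪ R) i j t ↔ c.ann J i j t ∨ c.ann R i j t := by
  refine hc.ann_union (Finset.disjoint_left.2 fun i hi hi' => ?_) ?_
  · exact absurd (hR i hi') (not_lt.2 (hJ i hi))
  intro i hi l hl t hm
  have hxi := hJ i hi
  have hxl := hR l hl
  have hne := hc.vel_ne hm
  have h0 := hm.2.1
  have h1 := hm.2.2
  have right : c.v i = 1 → y - c.x i < t →
      c.Outcome (fun i j t => c.ann J i j t ∨ c.ann R i j t) i l t := by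
    intro hv hlt
    obtain ⟨k, u, hu, h⟩ := hJ' i hi hv
    exact Or.inr (Or.inl ⟨k, u, hu.trans_lt hlt, Or.inl h⟩)
  rcases hc.vel l with hvl | hvl | hvl
  · by_cases hs : c.Surv R l
    · exact hR' l hl hvl hs i hi t hm
    · obtain ⟨k, u, hk⟩ := not_surv hl hs
      have hu := hc.ann_time_lt hR hvl hk
      by_cases hlt : u < t
      · exact Or.inr (Or.inr (Or.inl ⟨k, u, hlt, Or.inr hk⟩))
      -- The meeting takes place no later than the death of `l`, hence to the right of `y`; only a
      -- right-mover can have come there from `J`, and it was due to die at `y`.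
      · rw [hvl] at h1
        push_cast at h1
        rcases hc.vel i with hvi | hvi | hvi
        · omega
        · rw [hvi] at h1; push_cast at h1; linarith
        · refine right hvi ?_
          rw [hvi] at h1; push_cast at h1; linarith
  · rw [hvl] at h1
    push_cast at h1
    rcases hc.vel i with hvi | hvi | hvi
    · rw [hvi] at h1; push_cast at h1; linarith
    · omega
    · refine right hvi ?_
      rw [hvi] at h1; push_cast at h1; linarith
  · rw [hvl] at h1
    push_cast at h1
    rcases hc.vel i with hvi | hvi | hvi
    · rw [hvi] at h1; push_cast at h1; linarith
    · rw [hvi] at h1; push_cast at h1; linarith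
    · omega

/-- A static particle on the left of `R` annihilates with the first particle leaving `R`. -/
theorem Regular.ann_insert_static (hc : c.Regular) [DecidableEq ι] {R : Finset ι} {k l : ι}
    (hk : c.v k = 0) (hR : ∀ i ∈ R, c.x k < c.x i) (hl : c.IsFirst R l) {a b : ι} {t : ℝ} :
    c.ann (insert k R) a b t ↔ c.ann R a b t ∨
      t = c.x l - c.x k ∧ (a = k ∧ b = l ∨ a = l ∧ b = k) := by
  have hd := hc.isDyn_ann R
  have hkR : k ∉ R := fun h => lt_irrefl _ (hR k h)
  have hxl := hR l hl.surv.1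
  have hm : c.Meet k l (c.x l - c.x k) := by
    refine ⟨?_, by linarith, by rw [hk, hl.vel]; push_cast; ring⟩
    rintro rfl
    exact hkR hl.surv.1
  refine (hd.insert_pair hm (Finset.subset_insert _ _) (Finset.mem_insert_self _ _)
    (Finset.mem_insert_of_mem hl.surv.1) (fun b u h => hkR (hd.mem h)) hl.surv.2 ?_).ann_iff hc
  have main : ∀ b ∈ R, ∀ u, c.Meet k b u → c.Outcome (fun a b u => c.ann R a b u ∨
      u = c.x l - c.x k ∧ (a = k ∧ b = l ∨ a = l ∧ b = k)) k b u := by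
    intro b hb u hm'
    have hxb := hR b hb
    have h1 := hm'.2.2
    have h0 := hm'.2.1
    rw [hk] at h1
    push_cast at h1
    have hvb : c.v b = -1 := by
      rcases hc.vel b with h | h | h
      · exact h
      · rw [h] at h1; push_cast at h1; linarith
      · rw [h] at h1; push_cast at h1; linarith
    by_cases hbl : b = l
    · subst hbl
      exact Or.inl (Or.inr ⟨hc.meet_time_unique hm' hm, Or.inl ⟨rfl, rfl⟩⟩)
    · obtain ⟨k', u', h'⟩ := not_surv hb fun hs => hbl (hl.eq b hb hvb hs)
      have hu := hc.ann_time_lt hR hvb h'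
      rw [hvb] at h1
      push_cast at h1
      exact Or.inr (Or.inr (Or.inl ⟨k', u', by linarith, Or.inl h'⟩))
  intro a b u ha hb hab hm'
  rw [Finset.mem_insert] at ha hb
  by_cases hak : a = k
  · subst hak
    rcases hb with rfl | hb
    · exact absurd rfl hm'.1
    · exact main b hb u hm'
  · have haR : a ∈ R := ha.resolve_left hak
    have hal : a = l := by tauto
    rcases hb with rfl | hb
    · refine Outcome.symm ?_ (main a haR u hm'.symm)
      rintro a b u (h | ⟨rfl, ⟨rfl, rfl⟩ | ⟨rfl, rfl⟩⟩)
      · exact Or.inl (hd.symm h)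
      · exact Or.inr ⟨rfl, Or.inr ⟨rfl, rfl⟩⟩
      · exact Or.inr ⟨rfl, Or.inl ⟨rfl, rfl⟩⟩
    · exact Outcome.mono (fun _ _ _ => Or.inl) (hd.resolve haR hb hm')

theorem Regular.ann_insert_static_right (hc : c.Regular) [DecidableEq ι] {L : Finset ι} {k i : ι}
    (hk : c.v k = 0) (hL : ∀ j ∈ L, c.x j < c.x k) (hi : c.IsFirstR L i) {a b : ι} {t : ℝ} :
    c.ann (insert k L) a b t ↔ c.ann L a b t ∨
      t = c.x k - c.x i ∧ (a = k ∧ b = i ∨ a = i ∧ b = k) := by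
  have := hc.mirror.ann_insert_static (R := L) (k := k) (l := i) (by simp [Config.mirror, hk])
    (by simpa [Config.mirror] using hL) (hc.mirror_isFirst.2 hi) (a := a) (b := b) (t := t)
  rw [hc.mirror_ann, hc.mirror_ann] at this
  rw [this]
  simp only [Config.mirror]
  ring_nf

/-- A static particle that nobody reaches from the left does not interact with the particles on its
left. -/
theorem Regular.ann_insert_static_of_not_surv (hc : c.Regular) [DecidableEq ι] {L : Finset ι}
    {k : ι} (hk : c.v k = 0) (hL : ∀ j ∈ L, c.x j < c.x k)
    (hL' : ∀ i ∈ L, c.v i = 1 → ¬ c.Surv L i) {a b : ι} {t : ℝ} :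
    c.ann (insert k L) a b t ↔ c.ann L a b t := by
  have hd := hc.isDyn_ann ({k} : Finset ι)
  have hempty : ∀ a b t, ¬ c.ann {k} a b t := by
    intro a b t h
    have h1 := hd.mem h
    have h2 := hd.mem (hd.symm h)
    rw [Finset.mem_singleton] at h1 h2
    exact (hd.meet h).1 (h1.trans h2.symm)
  have hkL : k ∉ L := fun h => lt_irrefl _ (hL k h)
  rw [Finset.insert_eq, Finset.union_comm, hc.ann_union (by simpa using hkL)]
  · simp [hempty]
  · intro i hi j hj t hm
    obtain rfl := Finset.mem_singleton.1 hj
    have hxi := hL i hi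
    have h1 := hm.2.2
    have h0 := hm.2.1
    rw [hk] at h1
    push_cast at h1
    have hvi : c.v i = 1 := by
      rcases hc.vel i with h | h | h
      · rw [h] at h1; push_cast at h1; linarith
      · rw [h] at h1; push_cast at h1; linarith
      · exact h
    obtain ⟨k', u, h⟩ := not_surv hi (hL' i hi hvi)
    have hu := hc.ann_time_lt_right hL hvi h
    rw [hvi] at h1
    push_cast at h1
    exact Or.inr (Or.inl ⟨k', u, by linarith, Or.inl h⟩)

/-- A static particle reached first from the left annihilates with the first particle reaching
it. -/
theorem Regular.ann_static_between (hc : c.Regular) [DecidableEq ι] {L R : Finset ι} {k i : ι}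
    (hk : c.v k = 0) (hL : ∀ j ∈ L, c.x j < c.x k) (hR : ∀ j ∈ R, c.x k < c.x j)
    (hi : c.IsFirstR L i)
    (hwin : ∀ l ∈ R, c.v l = -1 → c.Surv R l → c.x k - c.x i < c.x l - c.x k ∨
      c.x k - c.x i = c.x l - c.x k ∧ c.s k = -1) {a b : ι} {t : ℝ} :
    c.ann (insert k L ∪ R) a b t ↔ (c.ann L a b t ∨
      t = c.x k - c.x i ∧ (a = k ∧ b = i ∨ a = i ∧ b = k)) ∨ c.ann R a b t := by
  have hJ := @Regular.ann_insert_static_right _ _ hc _ _ _ _ hk hL hi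
  have hki : c.ann (insert k L) k i (c.x k - c.x i) := hJ.2 (Or.inr ⟨rfl, Or.inl ⟨rfl, rfl⟩⟩)
  have hik : c.ann (insert k L) i k (c.x k - c.x i) := hJ.2 (Or.inr ⟨rfl, Or.inr ⟨rfl, rfl⟩⟩)
  have hxi := hL i hi.surv.1
  rw [hc.ann_union_wall (y := c.x k), hJ]
  · intro j hj
    rcases Finset.mem_insert.1 hj with rfl | hj
    exacts [le_rfl, (hL j hj).le]
  · exact hR
  · intro j hj hv
    rcases Finset.mem_insert.1 hj with rfl | hj
    · omega
    by_cases hji : j = i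
    · subst hji
      exact ⟨k, _, le_rfl, hik⟩
    · obtain ⟨k', u, h⟩ := not_surv hj fun hs => hji (hi.eq j hj hv hs)
      exact ⟨k', u, (hc.ann_time_lt_right hL hv h).le, hJ.2 (Or.inl h)⟩
  · intro l hl hvl hs j hj t hm
    have hw := hwin l hl hvl hs
    have hxl := hR l hl
    have h0 := hm.2.1
    have h1 := hm.2.2
    have hne := hc.vel_ne hm
    rw [hvl] at h1
    push_cast at h1
    have saves : c.s k = -1 → c.SpinSaves l i k := fun h => Or.inr ⟨hk, by rw [h, hvl]⟩
    rcases Finset.mem_insert.1 hj with rfl | hj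
    · rw [hk] at h1
      push_cast at h1
      rcases hw with hw | ⟨hw, hsk⟩
      · exact Or.inr (Or.inl ⟨i, _, by linarith, Or.inl hki⟩)
      · obtain rfl : t = c.x j - c.x i := by linarith
        exact Or.inr (Or.inr (Or.inr (Or.inl ⟨i, Or.inl hki, (saves hsk).symm⟩)))
    have hxj := hL j hj
    have hij := hi.le j hj
    rcases hc.vel j with hvj | hvj | hvj
    · omega
    -- A static `j` of `L` is gone once `i` has crossed it, at time at most `x j - x i < x k - x i ≤
    -- x l - x k`, before `l` arrives.
    · have hne : j ≠ i := by rintro rfl; have := hi.vel; omega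
      obtain ⟨k', u, hu, h⟩ := hi.surv.exists_ann hc hj (t := c.x j - c.x i)
        ⟨hne.symm, by linarith, by rw [hi.vel, hvj]; push_cast; ring⟩
      rw [hvj] at h1
      push_cast at h1
      refine Or.inr (Or.inl ⟨k', u, ?_, Or.inl (hJ.2 (Or.inl h))⟩)
      rcases hw with hw | ⟨hw, -⟩ <;> linarith
    · rw [hvj] at h1
      push_cast at h1
      -- `i` and `l` would meet halfway. Either `i` has died on `k` before, or the three meet
      -- together and the spin `-1` of `k` saves `l`.
      by_cases hji : j = i
      · subst hji
        rcases hw with hw | ⟨hw, hsk⟩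
        · exact Or.inr (Or.inl ⟨k, _, by linarith, Or.inl hik⟩)
        · obtain rfl : t = c.x k - c.x j := by linarith
          exact Or.inr (Or.inr (Or.inr (Or.inl ⟨k, Or.inl hik, saves hsk⟩)))
      · obtain ⟨k', u, h⟩ := not_surv hj fun hs => hji (hi.eq j hj hvj hs)
        have hu := hc.ann_time_lt_right hL hvj h
        refine Or.inr (Or.inl ⟨k', u, ?_, Or.inl (hJ.2 (Or.inl h))⟩)
        rcases hw with hw | ⟨hw, -⟩ <;> linarith

/-- Mirror image of `ann_static_between`; reflection negates the spin, so the tie is now won with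
spin `1`. -/
theorem Regular.ann_static_between_right (hc : c.Regular) [DecidableEq ι] {L R : Finset ι}
    {k l : ι} (hk : c.v k = 0) (hL : ∀ j ∈ L, c.x j < c.x k) (hR : ∀ j ∈ R, c.x k < c.x j)
    (hl : c.IsFirst R l)
    (hwin : ∀ i ∈ L, c.v i = 1 → c.Surv L i → c.x l - c.x k < c.x k - c.x i ∨
      c.x l - c.x k = c.x k - c.x i ∧ c.s k = 1) {a b : ι} {t : ℝ} :
    c.ann (insert k R ∪ L) a b t ↔ (c.ann R a b t ∨
      t = c.x l - c.x k ∧ (a = k ∧ b = l ∨ a = l ∧ b = k)) ∨ c.ann L a b t := by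
  have hl' : c.mirror.IsFirstR R l := by
    refine ⟨by simp [Config.mirror, hl.vel], hc.mirror_surv.2 hl.surv, fun i hi => ?_,
      fun i hi hv hs => hl.eq i hi (by simp only [Config.mirror] at hv; omega) (hc.mirror_surv.1 hs)⟩
    simpa [Config.mirror] using hl.le i hi
  have := hc.mirror.ann_static_between (L := R) (R := L) (k := k) (i := l) (by simp [Config.mirror, hk])
    (by simpa [Config.mirror] using hR) (by simpa [Config.mirror] using hL) hl' (fun i hi hv hs => ?_)
    (a := a) (b := b) (t := t)
  · rw [hc.mirror_ann, hc.mirror_ann, hc.mirror_ann] at this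
    rw [this]
    simp only [Config.mirror]
    ring_nf
  · simp only [Config.mirror] at hv ⊢
    rcases hwin i hi (by omega) (hc.mirror_surv.1 hs) with h | ⟨h, h'⟩
    · left; linarith
    · right; exact ⟨by linarith, by omega⟩

/-- If every particle of `J` that does not move to the left is annihilated before a particle
starting on the right of `y` can reach it, then `J` does not interact with such particles. -/
theorem Regular.ann_union_of_dead (hc : c.Regular) [DecidableEq ι] {J K : Finset ι} {y : ℝ}
    (hJ : ∀ i ∈ J, c.x i ≤ y) (hK : ∀ i ∈ K, y < c.x i)
    (h0 : ∀ i ∈ J, c.v i = 0 → ∃ k u, u ≤ y - c.x i ∧ c.ann J i k u)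
    (h1 : ∀ i ∈ J, c.v i = 1 → ∃ k u, u ≤ (y - c.x i) / 2 ∧ c.ann J i k u)
    {i j : ι} {t : ℝ} : c.ann (J ∪ K) i j t ↔ c.ann J i j t ∨ c.ann K i j t := by
  refine hc.ann_union (Finset.disjoint_left.2 fun i hi hi' => ?_) ?_
  · exact absurd (hK i hi') (not_lt.2 (hJ i hi))
  intro i hi m hm t hmeet
  have hxi := hJ i hi
  have hxm := hK m hm
  have hne := hc.vel_ne hmeet
  have ht := hmeet.2.1
  have he := hmeet.2.2
  have dead : (∃ k u, u < t ∧ c.ann J i k u) →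
      c.Outcome (fun i j t => c.ann J i j t ∨ c.ann K i j t) i m t := by
    rintro ⟨k, u, hu, h⟩
    exact Or.inr (Or.inl ⟨k, u, hu, Or.inl h⟩)
  rcases hc.vel i with hvi | hvi | hvi <;> rcases hc.vel m with hvm | hvm | hvm <;>
    rw [hvi, hvm] at he hne <;> push_cast at he <;> first | omega | skip
  · linarith
  · linarith
  · obtain ⟨k, u, hu, h⟩ := h0 i hi hvi
    exact dead ⟨k, u, by linarith, h⟩
  · linarith
  · obtain ⟨k, u, hu, h⟩ := h1 i hi hvi
    exact dead ⟨k, u, by linarith, h⟩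
  · obtain ⟨k, u, hu, h⟩ := h1 i hi hvi
    exact dead ⟨k, u, by linarith, h⟩

/-- If `l` crosses all the particles `i` of `J` on its left, they are annihilated before. -/
theorem Surv.exists_ann_of_crosses (hc : c.Regular) {J : Finset ι} {i l : ι} (hv : c.v l = -1)
    (hs : c.Surv J l) (hi : i ∈ J) (hx : c.x i ≤ c.x l) :
    (c.v i = 0 → ∃ k u, u ≤ c.x l - c.x i ∧ c.ann J i k u) ∧
    (c.v i = 1 → ∃ k u, u ≤ (c.x l - c.x i) / 2 ∧ c.ann J i k u) := by
  constructor <;> intro hvi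
  · exact hs.exists_ann hc hi ⟨by rintro rfl; omega, by linarith, by
      rw [hv, hvi]; push_cast; ring⟩
  · exact hs.exists_ann hc hi ⟨by rintro rfl; omega, by linarith, by
      rw [hv, hvi]; push_cast; ring⟩

/-- If `l` crosses all of `J`, then `J` does not interact with the particles on the right of
`l`. -/
theorem Regular.ann_union_of_surv (hc : c.Regular) [DecidableEq ι] {J K : Finset ι} {l : ι}
    (hv : c.v l = -1) (hs : c.Surv J l) (hJ : ∀ i ∈ J, c.x i ≤ c.x l) (hK : ∀ i ∈ K, c.x l < c.x i)
    {i j : ι} {t : ℝ} : c.ann (J ∪ K) i j t ↔ c.ann J i j t ∨ c.ann K i j t :=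
  hc.ann_union_of_dead hJ hK (fun i hi => (hs.exists_ann_of_crosses hc hv hi (hJ i hi)).1)
    fun i hi => (hs.exists_ann_of_crosses hc hv hi (hJ i hi)).2

/-- If the leftmost and the rightmost particles of `J` annihilate each other, then `J` does not
interact with the particles on its right. -/
theorem Regular.ann_union_of_ann (hc : c.Regular) [DecidableEq ι] {J K : Finset ι} {a l : ι}
    {t₀ : ℝ} (ha : c.v a = 1) (hv : c.v l = -1) (hs : c.ann J a l t₀)
    (hJa : ∀ i ∈ J, c.x a ≤ c.x i) (hJ : ∀ i ∈ J, c.x i ≤ c.x l)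
    (hK : ∀ i ∈ K, c.x l < c.x i) {i j : ι} {t : ℝ} :
    c.ann (J ∪ K) i j t ↔ c.ann J i j t ∨ c.ann K i j t := by
  obtain ⟨haJ, hlJ, hal, h2, h3⟩ := ((hc.isDyn_ann J).ruleOn_iff hc a l t₀).1 hs
  have h4 := hal.2.2
  rw [ha, hv] at h4
  push_cast at h4
  refine hc.ann_union_of_dead hJ hK (fun i hi hvi => ?_) fun i hi hvi => ?_
  · have hxi := hJ i hi
    have hxa := hJa i hi
    have hia : i ≠ a := by rintro rfl; omega
    have hil : i ≠ l := by rintro rfl; omega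
    have hml : c.Meet i l (c.x l - c.x i) :=
      ⟨hil, by linarith, by rw [hv, hvi]; push_cast; ring⟩
    have hma : c.Meet i a (c.x i - c.x a) :=
      ⟨hia, by linarith, by rw [ha, hvi]; push_cast; ring⟩
    -- A static particle between `a` and `l` must be gone when the nearer of the two reaches it. At
    -- equal distances it would be a third party to their collision, and the spin never saves a
    -- static particle there.
    rcases lt_trichotomy (c.x l - c.x i) t₀ with hlt | heq | hlt
    · obtain ⟨k, u, -, -, hu, h⟩ := h2 i hi _ hia hil hlt (Or.inr hml)
      exact ⟨k, u, hu, h⟩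
    · have heq' : c.x i - c.x a = t₀ := by linarith
      rcases h3 i hi (heq' ▸ hma) (heq ▸ hml) with h | ⟨k, u, hu, h⟩
      · unfold SpinSaves at h
        omega
      · exact ⟨k, u, by linarith, h⟩
    · obtain ⟨k, u, -, -, hu, h⟩ := h2 i hi (c.x i - c.x a) hia hil (by linarith) (Or.inl hma)
      exact ⟨k, u, by linarith, h⟩
  · have hxi := hJ i hi
    have hil : i ≠ l := by rintro rfl; omega
    by_cases hia : i = a
    · subst hia
      exact ⟨l, t₀, by linarith, hs⟩
    · have hlt := lt_of_le_of_ne (hJa i hi) (hc.x_ne (Ne.symm hia))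
      obtain ⟨k, u, -, -, hu, h⟩ := h2 i hi ((c.x l - c.x i) / 2) hia hil
        (by linarith) (Or.inr ⟨hil, by linarith, by rw [hv, hvi]; push_cast; ring⟩)
      exact ⟨k, u, hu, h⟩

/-! ### Configurations on the half-line -/

variable {c : Config ℕ}

/-- Particle `b` crosses the block `[a, b]` to the left. -/
def Cross (c : Config ℕ) (a b : ℕ) : Prop := c.v b = -1 ∧ c.Surv (Finset.Icc a b) b

/-- Particle `b` is the first one to reach the left end of the block starting at `a`. -/
def First (c : Config ℕ) (a b : ℕ) : Prop := c.IsFirst (Finset.Icc a b) b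

/-- The mirror image of `First`. -/
def FirstR (c : Config ℕ) (a b : ℕ) : Prop := c.IsFirstR (Finset.Icc a b) a

/-- The moving particles `a` and `b` annihilate each other. -/
def Mutual (c : Config ℕ) (a b : ℕ) : Prop :=
  c.v a = 1 ∧ c.v b = -1 ∧ ∃ t, c.ann (Finset.Icc a b) a b t

/-- If `a` and `b` are the first particles to reach the static particle `k` from the left and from
the right, then `k` is annihilated by `a`. -/
def LeftWins (c : Config ℕ) (a k b : ℕ) : Prop :=
  c.x k - c.x a < c.x b - c.x k ∨ c.x k - c.x a = c.x b - c.x k ∧ c.s k = -1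

/-- Reduction of the infinite system to a finite block: the light cone of the left-mover `i`
contains only the particles `0, …, i`. -/
theorem crossesFromRight_iff (hc : c.Regular) (hx : StrictMono c.x) (h0 : 0 < c.x 0) (i : ℕ) :
    c.CrossesFromRight 0 i ↔ c.Cross 0 i := by
  have hpos : ∀ i, 0 < c.x i := fun i => h0.trans_le (hx.monotone (Nat.zero_le i))
  have hd := hc.isDyn_ann (Finset.Icc 0 i)
  unfold CrossesFromRight Cross
  refine and_congr_right fun hv => ?_
  have key : ∀ j t, c.Annihilate i j t ↔ c.ann (Finset.Icc 0 i) i j t := by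
    intro j t
    have hb : c.x i + c.v i * t + t ≤ c.x i := by rw [hv]; push_cast; linarith
    have hJK : ∀ k, c.x k ≤ c.x i →
        (k ∈ (Finset.Icc 0 i : Set ℕ) ↔ k ∈ (Set.univ : Set ℕ)) := by
      intro k hk
      simpa using hx.le_iff_le.1 hk
    have hl := fun hm : c.Meet i j t => hc.ruleOn_local (hd.ruleOn_iff hc) annihilate_iff
      (by simpa using hJK) ((Finset.finite_toSet _).subset fun _ h => h.1) hm hb
    exact ⟨fun h => (hl ((annihilate_iff _ _ _).1 h).2.2.1).2 h, fun h => (hl (hd.meet h)).1 h⟩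
  simp only [key, hpos, true_and, sub_zero]
  refine ⟨fun h => ⟨by simp, fun k t hk => h k t ?_ hk⟩, fun h k t _ => h.2 k t⟩
  -- All particles start at positive locations, so if `i` is annihilated at all, this happens before
  -- it reaches `0`.
  have := hc.ann_time_lt (R := Finset.Icc 0 i) (y := 0) (fun i _ => hpos i) hv hk
  linarith

variable {a b j k l n : ℕ}

theorem Cross.le (h : c.Cross a b) : a ≤ b := (Finset.mem_Icc.1 h.2.1).1

theorem First.cross (h : c.First a b) : c.Cross a b := ⟨h.vel, h.surv⟩

theorem First.le (h : c.First a b) : a ≤ b := h.cross.le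

theorem surv_Icc_left (hc : c.Regular) (hx : StrictMono c.x) (hv : c.v l = -1) (hln : l ≤ n) :
    c.Surv (Finset.Icc a n) l ↔ c.Surv (Finset.Icc a l) l :=
  hc.surv_left_mover hv fun i hi => by
    have := hx.le_iff_le.1 hi
    simp only [Finset.mem_Icc]
    omega

theorem ann_Icc_left (hc : c.Regular) (hx : StrictMono c.x) (hv : c.v l = -1) (hln : l ≤ n)
    {t : ℝ} : c.ann (Finset.Icc a n) l j t ↔ c.ann (Finset.Icc a l) l j t :=
  hc.ann_left_mover hv fun i hi => by
    have := hx.le_iff_le.1 hi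
    simp only [Finset.mem_Icc]
    omega

theorem ann_Icc_right (hc : c.Regular) (hx : StrictMono c.x) (hv : c.v l = 1) (hal : a ≤ l)
    {t : ℝ} : c.ann (Finset.Icc a n) l j t ↔ c.ann (Finset.Icc l n) l j t :=
  hc.ann_right_mover hv fun i hi => by
    have := hx.le_iff_le.1 hi
    simp only [Finset.mem_Icc]
    omega

theorem exists_first (hc : c.Regular) (hx : StrictMono c.x)
    (h : ∃ l ∈ Finset.Icc a n, c.v l = -1 ∧ c.Surv (Finset.Icc a n) l) :
    ∃ l ∈ Finset.Icc a n, c.First a l ∧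
      ∀ i ∈ Finset.Icc a n, c.v i = -1 → c.Surv (Finset.Icc a n) i → c.x l ≤ c.x i := by
  obtain ⟨l, hl, h1, h2⟩ := hc.exists_isFirst h
  refine ⟨l, hl, ?_, h2⟩
  have : (Finset.Icc a n).filter (fun i => c.x i ≤ c.x l) = Finset.Icc a l := by
    ext i
    simp only [Finset.mem_filter, Finset.mem_Icc, hx.le_iff_le] at hl ⊢
    omega
  rwa [this] at h1

theorem exists_firstR (hc : c.Regular) (hx : StrictMono c.x)
    (h : ∃ l ∈ Finset.Icc a n, c.v l = 1 ∧ c.Surv (Finset.Icc a n) l) :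
    ∃ l ∈ Finset.Icc a n, c.FirstR l n ∧
      ∀ i ∈ Finset.Icc a n, c.v i = 1 → c.Surv (Finset.Icc a n) i → c.x i ≤ c.x l := by
  obtain ⟨l, hl, h1, h2⟩ := hc.exists_isFirstR h
  refine ⟨l, hl, ?_, h2⟩
  have : (Finset.Icc a n).filter (fun i => c.x l ≤ c.x i) = Finset.Icc l n := by
    ext i
    simp only [Finset.mem_filter, Finset.mem_Icc, hx.le_iff_le] at hl ⊢
    omega
  rwa [this] at h1

theorem Cross.exists_first (hc : c.Regular) (hx : StrictMono c.x) (h : c.Cross a n) :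
    ∃ l ≤ n, c.First a l := by
  obtain ⟨l, hl, h1, -⟩ := Config.exists_first hc hx ⟨n, h.2.1, h⟩
  exact ⟨l, (Finset.mem_Icc.1 hl).2, h1⟩

/-- Adding particles on the right does not affect a left-mover, so the earlier of the two candidates
also survives in the longer block. -/
theorem First.unique (hc : c.Regular) (hx : StrictMono c.x) (h : c.First a b) (h' : c.First a n) :
    b = n := by
  have key : ∀ {b n}, c.First a b → c.First a n → b ≤ n → b = n := fun {b n} h h' hbn =>
    h'.eq b (Finset.mem_Icc.2 ⟨h.le, hbn⟩) h.vel ((surv_Icc_left hc hx h.vel hbn).2 h.surv)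
  rcases le_total b n with hbn | hbn
  · exact key h h' hbn
  · exact (key h' h hbn).symm

/-! ### Separation of consecutive blocks. -/

/-- The blocks `[a, k]` and `[k + 1, n]` do not interact. -/
def Sep (c : Config ℕ) (a k n : ℕ) : Prop := ∀ i j t, c.ann (Finset.Icc a n) i j t ↔
  c.ann (Finset.Icc a k) i j t ∨ c.ann (Finset.Icc (k + 1) n) i j t

theorem Icc_union (h : a ≤ k + 1) (h' : k ≤ n) :
    Finset.Icc a k ∪ Finset.Icc (k + 1) n = Finset.Icc a n := by
  ext i
  simp only [Finset.mem_union, Finset.mem_Icc]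
  omega

theorem Sep.surv_right (hc : c.Regular) (h : c.Sep a k n) (hj : j ∈ Finset.Icc (k + 1) n)
    (hak : a ≤ k + 1) : c.Surv (Finset.Icc a n) j ↔ c.Surv (Finset.Icc (k + 1) n) j := by
  have hd := hc.isDyn_ann (Finset.Icc a k)
  have hj' := Finset.mem_Icc.1 hj
  have hj'' : j ∈ Finset.Icc a n := Finset.mem_Icc.2 (by omega)
  have : ∀ i t, ¬ c.ann (Finset.Icc a k) j i t := by
    intro i t h
    have := Finset.mem_Icc.1 (hd.mem h)
    omega
  simp [Surv, h _ _ _, this, hj, hj'']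

/-- The left block emits nothing to the left (`hno`), so the first arrival comes from the right
block. -/
theorem Sep.first_iff (hc : c.Regular) (h : c.Sep a k n) (hkn : k < n) (hak : a ≤ k)
    (hno : ∀ i ∈ Finset.Icc a k, c.v i = -1 → ¬ c.Surv (Finset.Icc a k) i)
    (hx : StrictMono c.x) : c.First a n ↔ c.First (k + 1) n := by
  constructor
  · intro hf
    refine ⟨hf.vel, (h.surv_right hc (Finset.mem_Icc.2 (by omega)) (by omega)).1 hf.surv,
      fun i hi => hx.monotone (Finset.mem_Icc.1 hi).2, fun i hi hv hs => ?_⟩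
    have := Finset.mem_Icc.1 hi
    exact hf.eq i (Finset.mem_Icc.2 (by omega)) hv ((h.surv_right hc hi (by omega)).2 hs)
  · intro hf
    refine ⟨hf.vel, (h.surv_right hc (Finset.mem_Icc.2 (by omega)) (by omega)).2 hf.surv,
      fun i hi => hx.monotone (Finset.mem_Icc.1 hi).2, fun i hi hv hs => ?_⟩
    have := Finset.mem_Icc.1 hi
    by_cases hik : i ≤ k
    · have hi' : i ∈ Finset.Icc a k := Finset.mem_Icc.2 (by omega)
      refine absurd ⟨hi', fun j t hj => ?_⟩ (hno i hi' hv)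
      exact hs.2 j t ((h i j t).2 (Or.inl hj))
    · have hi' : i ∈ Finset.Icc (k + 1) n := Finset.mem_Icc.2 (by omega)
      exact hf.eq i hi' hv ((h.surv_right hc hi' (by omega)).1 hs)

theorem Cross.sep (hc : c.Regular) (hx : StrictMono c.x) (h : c.Cross a k) (hkn : k ≤ n) :
    c.Sep a k n := by
  intro i j t
  have := h.le
  rw [← Icc_union (a := a) (k := k) (n := n) (by omega) hkn,
    hc.ann_union_of_surv h.1 h.2 (fun i hi => hx.monotone (Finset.mem_Icc.1 hi).2)
      fun i hi => hx (Finset.mem_Icc.1 hi).1]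

/-- The particles crossing to the left form a renewal process. -/
theorem Cross.renewal (hc : c.Regular) (hx : StrictMono c.x) (h : c.Cross a n) :
    c.First a n ∨ ∃ k, k < n ∧ c.First a k ∧ c.Cross (k + 1) n := by
  obtain ⟨k, hk, hf⟩ := h.exists_first hc hx
  rcases hk.lt_or_eq with hlt | rfl
  · have := hf.le
    exact Or.inr ⟨k, hlt, hf, h.1,
      ((hf.cross.sep hc hx hk).surv_right hc (Finset.mem_Icc.2 (by omega)) (by omega)).1 h.2⟩
  · exact Or.inl hf

theorem first_of_left (hx : StrictMono c.x) (hc : c.Regular) (hv : c.v a = -1) :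
    c.First a n ↔ n = a := by
  have key : c.First a a := by
    have hd := hc.isDyn_ann (Finset.Icc a a)
    refine ⟨hv, ⟨by simp, fun k t h => ?_⟩, fun i hi => ?_, fun i hi _ _ => by simpa using hi⟩
    · have := hd.mem (hd.symm h)
      simp only [Finset.Icc_self, Finset.mem_singleton] at this
      exact (hd.meet h).1 this.symm
    · simp only [Finset.Icc_self, Finset.mem_singleton] at hi
      rw [hi]
  exact ⟨fun h => (key.unique hc hx h).symm, by rintro rfl; exact key⟩

/-! ### Recursion for the first arrival, according to the velocity of the initial particle. -/

theorem insert_Icc (h : a ≤ n) : insert a (Finset.Icc (a + 1) n) = Finset.Icc a n := by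
  ext i
  simp only [Finset.mem_insert, Finset.mem_Icc]
  omega

theorem ann_static_first (hc : c.Regular) (hx : StrictMono c.x) (hv : c.v a = 0)
    (hf : c.First (a + 1) k) {i j : ℕ} {t : ℝ} :
    c.ann (Finset.Icc a k) i j t ↔ c.ann (Finset.Icc (a + 1) k) i j t ∨
      t = c.x k - c.x a ∧ (i = a ∧ j = k ∨ i = k ∧ j = a) := by
  have := hf.le
  rw [← insert_Icc (a := a) (n := k) (by omega), hc.ann_insert_static hv _ hf]
  intro i hi
  have := (Finset.mem_Icc.1 hi).1
  exact hx (by omega)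

/-- The first arrival `k` clears `[a + 1, k]` and dies on `a`. Nothing is left in `[a, k]` to
obstruct later particles, and nothing leaves it to the left. -/
theorem first_succ_iff_of_static (hc : c.Regular) (hx : StrictMono c.x) (hv : c.v a = 0)
    (hf : c.First (a + 1) k) (hkn : k < n) : c.First a n ↔ c.First (k + 1) n := by
  have hle := hf.le
  have hann := @ann_static_first c a k hc hx hv hf
  have hmono : ∀ {i j t}, c.ann (Finset.Icc (a + 1) k) i j t → c.ann (Finset.Icc a k) i j t :=
    fun h => hann.2 (Or.inl h)
  have hsep : c.Sep a k n := by
    intro i j t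
    rw [← Icc_union (a := a) (k := k) (n := n) (by omega) hkn.le]
    have hmem : ∀ i ∈ Finset.Icc a k, i ≠ a → i ∈ Finset.Icc (a + 1) k := by
      intro i hi hne
      simp only [Finset.mem_Icc] at hi ⊢
      omega
    refine hc.ann_union_of_dead (y := c.x k) (fun i hi => hx.monotone (Finset.mem_Icc.1 hi).2)
      (fun i hi => hx (Finset.mem_Icc.1 hi).1) (fun i hi hvi => ?_) fun i hi hvi => ?_
    · by_cases hia : i = a
      · subst hia
        exact ⟨k, _, le_rfl, hann.2 (Or.inr ⟨rfl, Or.inl ⟨rfl, rfl⟩⟩)⟩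
      · obtain ⟨k', u, hu, h⟩ := (hf.surv.exists_ann_of_crosses hc hf.vel (hmem i hi hia)
          (IsFirst.le hf _ (hmem i hi hia))).1 hvi
        exact ⟨k', u, hu, hmono h⟩
    · have hia : i ≠ a := by rintro rfl; omega
      obtain ⟨k', u, hu, h⟩ := (hf.surv.exists_ann_of_crosses hc hf.vel (hmem i hi hia)
        (IsFirst.le hf _ (hmem i hi hia))).2 hvi
      exact ⟨k', u, hu, hmono h⟩
  refine hsep.first_iff hc hkn (by omega) (fun i hi hvi hs => ?_) hx
  have hi' : i ∈ Finset.Icc (a + 1) k := by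
    have : i ≠ a := by rintro rfl; omega
    simp only [Finset.mem_Icc] at hi ⊢
    omega
  obtain rfl := hf.eq i hi' hvi ⟨hi', fun j t h => hs.2 j t (hmono h)⟩
  exact hs.2 a _ (hann.2 (Or.inr ⟨rfl, Or.inr ⟨rfl, rfl⟩⟩))

/-- A static particle absorbs exactly one arrival, so a second one is required. Source of the term
`p q²`. -/
theorem first_of_static (hc : c.Regular) (hx : StrictMono c.x) (hv : c.v a = 0) :
    c.First a n ↔ ∃ k, c.First (a + 1) k ∧ c.First (k + 1) n := by
  constructor
  · intro hf
    have hle := hf.le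
    have han : a ≠ n := by rintro rfl; have := hf.vel; omega
    by_cases hex : ∃ l ∈ Finset.Icc (a + 1) n, c.v l = -1 ∧ c.Surv (Finset.Icc (a + 1) n) l
    · obtain ⟨k, hk, hk', -⟩ := exists_first hc hx hex
      have hkn := (Finset.mem_Icc.1 hk).2
      have hne : k ≠ n := by
        rintro rfl
        exact hf.surv.2 a _ ((ann_static_first hc hx hv hk').2 (Or.inr ⟨rfl, Or.inr ⟨rfl, rfl⟩⟩))
      exact ⟨k, hk', (first_succ_iff_of_static hc hx hv hk' (by omega)).1 hf⟩
    · exfalso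
      push Not at hex
      have hR : ∀ i ∈ Finset.Icc (a + 1) n, c.x a < c.x i := fun i hi =>
        hx (Finset.mem_Icc.1 hi).1
      have key : ∀ {i j t}, c.ann (Finset.Icc a n) i j t ↔ c.ann (Finset.Icc (a + 1) n) i j t := by
        intro i j t
        rw [← insert_Icc hle, ← hc.mirror_ann, ← hc.mirror_ann (J := Finset.Icc (a + 1) n)]
        refine hc.mirror.ann_insert_static_of_not_surv (by simp [Config.mirror, hv])
          (by simpa [Config.mirror] using hR) fun i hi hvi => ?_
        rw [hc.mirror_surv]
        exact hex i hi (by simpa [Config.mirror, neg_eq_iff_eq_neg] using hvi)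
      have hn : n ∈ Finset.Icc (a + 1) n := Finset.mem_Icc.2 (by omega)
      exact hex n hn hf.vel ⟨hn, fun k t h => hf.surv.2 k t (key.2 h)⟩
  · rintro ⟨k, hk, hk'⟩
    exact (first_succ_iff_of_static hc hx hv hk hk'.le).2 hk'

theorem Mutual.lt (hc : c.Regular) (h : c.Mutual a k) : a < k := by
  obtain ⟨h1, h2, t, h⟩ := h
  have hd := hc.isDyn_ann (Finset.Icc a k)
  have := (Finset.mem_Icc.1 (hd.mem h)).2
  have hne := (hd.meet h).1
  omega

/-- After the mutual annihilation of its end particles, the block `[a, k]` does not interact with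
what follows and releases nothing to the left. -/
theorem Mutual.first_iff (hc : c.Regular) (hx : StrictMono c.x) (h : c.Mutual a k) (hkn : k < n) :
    c.First a n ↔ c.First (k + 1) n := by
  have hlt := h.lt hc
  obtain ⟨h1, h2, t, h⟩ := h
  have hd := hc.isDyn_ann (Finset.Icc a k)
  have hsep : c.Sep a k n := by
    intro i j t
    rw [← Icc_union (a := a) (k := k) (n := n) (by omega) hkn.le]
    exact hc.ann_union_of_ann h1 h2 h (fun i hi => hx.monotone (Finset.mem_Icc.1 hi).1)
      (fun i hi => hx.monotone (Finset.mem_Icc.1 hi).2) fun i hi => hx (Finset.mem_Icc.1 hi).1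
  refine hsep.first_iff hc hkn hlt.le (fun i hi hv hs => ?_) hx
  have hik : i ≠ k := by rintro rfl; exact hs.2 _ _ (hd.symm h)
  have hxik : c.x i < c.x k := hx (lt_of_le_of_ne (Finset.mem_Icc.1 hi).2 hik)
  -- A left-mover `i < k` leaving the block would force `a` to die by time `(x i - x a) / 2`,
  -- earlier than its collision with `k` at `(x k - x a) / 2`.
  obtain ⟨k', u, hu, h'⟩ := (hs.exists_ann_of_crosses hc hv (hd.mem h)
    (hx.monotone (Finset.mem_Icc.1 hi).1)).2 h1
  have := hd.time_eq hc h h'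
  have h3 := (hd.meet h).2.2
  rw [h1, h2] at h3
  push_cast at h3
  linarith

theorem Icc_split (h : a ≤ k + 1) (h' : k < n) :
    insert (k + 1) (Finset.Icc a k) ∪ Finset.Icc (k + 2) n = Finset.Icc a n := by
  ext i
  simp only [Finset.mem_union, Finset.mem_insert, Finset.mem_Icc]
  omega

theorem Icc_split' (h : a ≤ k + 1) (h' : k < n) :
    insert (k + 1) (Finset.Icc (k + 2) n) ∪ Finset.Icc a k = Finset.Icc a n := by
  ext i
  simp only [Finset.mem_union, Finset.mem_insert, Finset.mem_Icc]
  omega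

theorem x_lt_of_mem_left (hx : StrictMono c.x) :
    ∀ i ∈ Finset.Icc a k, c.x i < c.x (k + 1) := fun i hi =>
  hx (by have := (Finset.mem_Icc.1 hi).2; omega)

theorem x_lt_of_mem_right (hx : StrictMono c.x) :
    ∀ i ∈ Finset.Icc (k + 2) n, c.x (k + 1) < c.x i := fun i hi =>
  hx (by have := (Finset.mem_Icc.1 hi).1; omega)

theorem FirstR.le' (h : c.FirstR a k) : a ≤ k := (Finset.mem_Icc.1 h.surv.1).2

/-- It suffices to compare `a` with the first arrival from the right: any other survivor of the
right block starts farther away. -/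
theorem ann_hit_left (hc : c.Regular) (hx : StrictMono c.x) (hv : c.v (k + 1) = 0)
    (hf : c.FirstR a k) (hkn : k < n)
    (hwin : ∀ l ≤ n, c.First (k + 2) l → c.LeftWins a (k + 1) l) {i j : ℕ} {t : ℝ} :
    c.ann (Finset.Icc a n) i j t ↔ (c.ann (Finset.Icc a k) i j t ∨
      t = c.x (k + 1) - c.x a ∧ (i = k + 1 ∧ j = a ∨ i = a ∧ j = k + 1)) ∨
      c.ann (Finset.Icc (k + 2) n) i j t := by
  have := hf.le'
  rw [← Icc_split (a := a) (k := k) (n := n) (by omega) hkn]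
  refine hc.ann_static_between hv (x_lt_of_mem_left hx) (x_lt_of_mem_right hx) hf ?_
  intro l hl hvl hs
  obtain ⟨l₀, hl₀, hf₀, hmin⟩ := exists_first hc hx ⟨l, hl, hvl, hs⟩
  rcases (hmin l hl hvl hs).lt_or_eq with hlt | heq
  · left
    rcases hwin l₀ (Finset.mem_Icc.1 hl₀).2 hf₀ with h | ⟨h, -⟩ <;> linarith
  · rw [← hc.inj heq]
    exact hwin l₀ (Finset.mem_Icc.1 hl₀).2 hf₀

theorem ann_hit_right (hc : c.Regular) (hx : StrictMono c.x) (hv : c.v (k + 1) = 0)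
    (hak : a ≤ k + 1) (hf : c.First (k + 2) l) (hln : l ≤ n)
    (hwin : ∀ i ∈ Finset.Icc a k, c.v i = 1 → c.Surv (Finset.Icc a k) i →
      ¬ c.LeftWins i (k + 1) l) :
    c.ann (Finset.Icc a n) (k + 1) l (c.x l - c.x (k + 1)) := by
  have hle := hf.le
  have hd := hc.isDyn_ann (Finset.Icc a n)
  refine hd.symm ((ann_Icc_left hc hx hf.vel hln).2 ?_)
  rw [← Icc_split' (a := a) (k := k) (n := l) (by omega) (by omega)]
  refine (hc.ann_static_between_right hv (x_lt_of_mem_left hx) (x_lt_of_mem_right hx) hf ?_).2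
    (Or.inl (Or.inr ⟨rfl, Or.inr ⟨rfl, rfl⟩⟩))
  intro i hi hvi hs
  have h := hwin i hi hvi hs
  unfold LeftWins at h
  push Not at h
  rcases h.1.lt_or_eq with h' | h'
  · exact Or.inl h'
  · exact Or.inr ⟨h', (hc.spin (k + 1)).resolve_left (h.2 h'.symm)⟩

/-- The static particle `k + 1` annihilates with `a` if and only if `a` is the first particle to
reach it from the left, before any particle coming from the right. -/
theorem ann_static_iff (hc : c.Regular) (hx : StrictMono c.x) 
    (hv : c.v (k + 1) = 0) (hak : a ≤ k) (hkn : k < n) :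
    (∃ t, c.ann (Finset.Icc a n) a (k + 1) t) ↔
      c.FirstR a k ∧ ∀ l ≤ n, c.First (k + 2) l → c.LeftWins a (k + 1) l := by
  have hd := hc.isDyn_ann (Finset.Icc a n)
  constructor
  · rintro ⟨t, h⟩
    -- If an arrival from the right beat all candidates from the left, it would be the partner of `k
    -- + 1`, whereas this partner is `a ≤ k`.
    have noright : ∀ l ≤ n, c.First (k + 2) l → ¬ ∀ i ∈ Finset.Icc a k, c.v i = 1 →
        c.Surv (Finset.Icc a k) i → ¬ c.LeftWins i (k + 1) l := by
      intro l hl hf hwin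
      have := hd.partner (hd.symm h) (ann_hit_right hc hx hv (by omega) hf hl hwin)
      have := hf.le
      omega
    have hex : ∃ i ∈ Finset.Icc a k, c.v i = 1 ∧ c.Surv (Finset.Icc a k) i := by
      by_contra hno
      push Not at hno
      have hno' : ∀ l ≤ n, ¬ c.First (k + 2) l := fun l hl hf =>
        noright l hl hf fun i hi hvi hs => absurd hs (hno i hi hvi)
      have hJ := @Regular.ann_insert_static_of_not_surv _ c hc _ _ _ hv
        (x_lt_of_mem_left (a := a) hx) hno
      -- With no arrival from either side, `k + 1` interacts with nobody.
      rw [← Icc_split (a := a) (k := k) (n := n) (by omega) hkn,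
        hc.ann_union_wall (y := c.x (k + 1))] at h
      · rcases h with h | h
        · rw [hJ] at h
          have hL := hc.isDyn_ann (Finset.Icc a k)
          have := Finset.mem_Icc.1 (hL.mem (hL.symm h))
          omega
        · have hR := hc.isDyn_ann (Finset.Icc (k + 2) n)
          have := Finset.mem_Icc.1 (hR.mem h)
          omega
      · intro i hi
        rcases Finset.mem_insert.1 hi with rfl | hi
        exacts [le_rfl, (x_lt_of_mem_left hx i hi).le]
      · exact x_lt_of_mem_right hx
      · intro i hi hvi
        rcases Finset.mem_insert.1 hi with rfl | hi
        · omega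
        obtain ⟨k', u, h⟩ := not_surv hi (hno i hi hvi)
        exact ⟨k', u, (hc.ann_time_lt_right (x_lt_of_mem_left hx) hvi h).le, hJ.2 h⟩
      · intro l hl hvl hs
        obtain ⟨l₀, hl₀, hf₀, -⟩ := exists_first hc hx ⟨l, hl, hvl, hs⟩
        exact absurd hf₀ (hno' l₀ (Finset.mem_Icc.1 hl₀).2)
    obtain ⟨i, hi, hfi, hmax⟩ := exists_firstR hc hx hex
    have hi' := Finset.mem_Icc.1 hi
    have hwin : ∀ l ≤ n, c.First (k + 2) l → c.LeftWins i (k + 1) l := by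
      intro l hl hf
      by_contra hlose
      refine noright l hl hf fun i' hi' hvi' hs' hw => hlose ?_
      rcases (hmax i' hi' hvi' hs').lt_or_eq with hlt | heq
      · left
        rcases hw with h | ⟨h, -⟩ <;> linarith
      · rwa [hc.inj heq] at hw
    have hik := (ann_hit_left hc hx hv hfi hkn hwin).2
      (Or.inl (Or.inr ⟨rfl, Or.inr ⟨rfl, rfl⟩⟩))
    -- The last surviving right-mover `i` of the left block annihilates with `k + 1`; by uniqueness
    -- of partners it is `a`.
    have := hd.partner (hd.symm h) (hd.symm ((ann_Icc_right hc hx hfi.vel hi'.1).2 hik))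
    subst this
    exact ⟨hfi, hwin⟩
  · rintro ⟨hf, hwin⟩
    exact ⟨_, (ann_hit_left hc hx hv hf hkn hwin).2 (Or.inl (Or.inr ⟨rfl, Or.inr ⟨rfl, rfl⟩⟩))⟩

/-- Crossing its block, `a` destroys every left-mover of it and then dies with `k + 1`; the way to
the left is then open for the first arrival from the right block. -/
theorem first_of_hit (hc : c.Regular) (hx : StrictMono c.x) (hv : c.v (k + 1) = 0)
    (hf : c.FirstR a k) (hf' : c.First (k + 2) n) (hwin : c.LeftWins a (k + 1) n) :
    c.First a n ∧ ∃ t, c.ann (Finset.Icc a n) a (k + 1) t := by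
  have hle := hf'.le
  have hle' := hf.le'
  have hL := hc.isDyn_ann (Finset.Icc a k)
  have hwin' : ∀ l ≤ n, c.First (k + 2) l → c.LeftWins a (k + 1) l := by
    intro l _ h
    rwa [h.unique hc hx hf']
  have hann := @ann_hit_left c a k n hc hx hv hf (by omega) hwin'
  refine ⟨⟨hf'.vel, ⟨Finset.mem_Icc.2 (by omega), fun j t h => ?_⟩,
    fun i hi => hx.monotone (Finset.mem_Icc.1 hi).2, fun i hi hvi hs => ?_⟩,
    _, hann.2 (Or.inl (Or.inr ⟨rfl, Or.inr ⟨rfl, rfl⟩⟩))⟩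
  · rcases hann.1 h with (h | ⟨-, ⟨h, -⟩ | ⟨h, -⟩⟩) | h
    · have := Finset.mem_Icc.1 (hL.mem h)
      omega
    · omega
    · omega
    · exact hf'.surv.2 _ _ h
  · have hi' := Finset.mem_Icc.1 hi
    rcases lt_trichotomy i (k + 1) with h | h | h
    · exfalso
      have hiL : i ∈ Finset.Icc a k := Finset.mem_Icc.2 (by omega)
      have hlt := hf.vel
      have hai : c.x a ≤ c.x i := hx.monotone hi'.1
      obtain ⟨k', u, -, h⟩ := hf.surv.exists_ann hc hiL (t := (c.x i - c.x a) / 2)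
        ⟨by rintro rfl; omega, by linarith, by rw [hvi, hlt]; push_cast; ring⟩
      exact hs.2 _ _ (hann.2 (Or.inl (Or.inl h)))
    · subst h; omega
    · have hiR : i ∈ Finset.Icc (k + 2) n := Finset.mem_Icc.2 (by omega)
      exact hf'.eq i hiR hvi ⟨hiR, fun j t h => hs.2 j t (hann.2 (Or.inr h))⟩

theorem first_of_mutual (hc : c.Regular) (hx : StrictMono c.x) (hm : c.Mutual a k)
    (hf : c.First (k + 1) n) : c.First a n ∧ ∃ t, c.ann (Finset.Icc a n) a k t := by
  have hle := hf.le
  refine ⟨(hm.first_iff hc hx hle).2 hf, ?_⟩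
  obtain ⟨h1, h2, t, h⟩ := hm
  exact ⟨t, (hc.isDyn_ann _).symm ((ann_Icc_left hc hx h2 (by omega)).2
    ((hc.isDyn_ann _).symm h))⟩

/-- For `n` to arrive, the right-mover `a` must die first; the two alternatives are the two possible
velocities of its partner. -/
theorem first_of_right (hc : c.Regular) (hx : StrictMono c.x) (hv : c.v a = 1) :
    c.First a n ↔ (∃ k, c.Mutual a (k + 1) ∧ c.First (k + 2) n) ∨
      ∃ k, c.FirstR a k ∧ c.v (k + 1) = 0 ∧ c.First (k + 2) n ∧ c.LeftWins a (k + 1) n := by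
  constructor
  · intro hf
    have hle := hf.le
    have hd := hc.isDyn_ann (Finset.Icc a n)
    obtain ⟨k, u, -, h⟩ := (hf.surv.exists_ann_of_crosses hc hf.vel
      (Finset.mem_Icc.2 ⟨le_rfl, hle⟩) (hx.monotone hle)).2 hv
    have hm := hd.meet h
    have hk := Finset.mem_Icc.1 (hd.mem (hd.symm h))
    have hkn : k ≠ n := by rintro rfl; exact hf.surv.2 _ _ (hd.symm h)
    have hka := hm.1
    obtain ⟨k, rfl⟩ : ∃ k', k = k' + 1 := ⟨k - 1, by omega⟩
    rcases hc.vel (k + 1) with hvk | hvk | hvk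
    · left
      have hmut : c.Mutual a (k + 1) := ⟨hv, hvk, u, (hc.isDyn_ann _).symm
        ((ann_Icc_left hc hx hvk (by omega)).1 (hd.symm h))⟩
      exact ⟨k, hmut, (hmut.first_iff hc hx (by omega)).1 hf⟩
    · right
      obtain ⟨h1, h2⟩ := (ann_static_iff (n := n) hc hx hvk (by omega) (by omega)).1 ⟨u, h⟩
      have hann := @ann_hit_left c a k n hc hx hvk h1 (by omega) h2
      have hn : n ∈ Finset.Icc (k + 2) n := Finset.mem_Icc.2 (by omega)
      -- `n` also survives in the block after the static particle. The first arrival `l` of that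
      -- block is then the first overall, hence `l = n`.
      obtain ⟨l, hl, hfl, -⟩ := exists_first hc hx ⟨n, hn, hf.vel,
        hn, fun j t h => hf.surv.2 j t (hann.2 (Or.inr h))⟩
      have hw := h2 l (Finset.mem_Icc.1 hl).2 hfl
      obtain rfl := (first_of_hit hc hx hvk h1 hfl hw).1.unique hc hx hf
      exact ⟨k, h1, hvk, hfl, hw⟩
    · exact absurd (hv.trans hvk.symm) (hc.vel_ne hm)
  · rintro (⟨k, h1, h2⟩ | ⟨k, h1, h2, h3, h4⟩)
    · exact (first_of_mutual hc hx h1 h2).1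
    · exact (first_of_hit hc hx h2 h1 h3 h4).1

/-! ### Measurability -/

/-- The time at which the virtual trajectories of `i` and `j` intersect. -/
noncomputable def time (c : Config ℕ) (i j : ℕ) : ℝ := (c.x j - c.x i) / ((c.v i : ℝ) - c.v j)

/-- The virtual trajectories of `i` and `j` intersect. -/
def Meets (c : Config ℕ) (i j : ℕ) : Prop := i ≠ j ∧ c.v i ≠ c.v j ∧ 0 ≤ c.time i j

theorem Regular.meet_iff {c : Config ℕ} (hc : c.Regular) {i j : ℕ} {t : ℝ} :
    c.Meet i j t ↔ c.Meets i j ∧ t = c.time i j := by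
  by_cases hv : c.v i = c.v j
  · exact ⟨fun h => absurd hv (hc.vel_ne h), fun h => absurd hv h.1.2.1⟩
  have hv' : (c.v i : ℝ) - c.v j ≠ 0 := by
    rw [sub_ne_zero]; exact_mod_cast hv
  have : c.x i + c.v i * t = c.x j + c.v j * t ↔ t = c.time i j := by
    unfold time
    rw [eq_div_iff hv']
    constructor <;> intro h <;> linarith
  unfold Meet Meets
  rw [this]
  constructor
  · rintro ⟨h1, h2, rfl⟩
    exact ⟨⟨h1, hv, h2⟩, rfl⟩
  · rintro ⟨⟨h1, -, h2⟩, rfl⟩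
    exact ⟨h1, h2, rfl⟩

/-- A version of `IsDyn` for a finite set of pairs of particles. -/
def IsDynPairs (c : Config ℕ) (J : Finset ℕ) (q : Finset (ℕ × ℕ)) : Prop :=
  (∀ i j, (i, j) ∈ q → i ∈ J ∧ (j, i) ∈ q ∧ c.Meets i j) ∧
  (∀ i j j', (i, j) ∈ q → (i, j') ∈ q → j = j') ∧
  ∀ i ∈ J, ∀ j ∈ J, c.Meets i j → (i, j) ∈ q ∨
    (∃ k, (i, k) ∈ q ∧ c.time i k < c.time i j) ∨ (∃ k, (j, k) ∈ q ∧ c.time j k < c.time i j) ∨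
    (∃ k, (i, k) ∈ q ∧ c.time i k = c.time i j ∧ c.SpinSaves j i k) ∨
    ∃ k, (j, k) ∈ q ∧ c.time j k = c.time i j ∧ c.SpinSaves i j k

theorem IsDynPairs.isDyn {c : Config ℕ} (hc : c.Regular) {J : Finset ℕ} {q : Finset (ℕ × ℕ)}
    (h : c.IsDynPairs J q) : c.IsDyn J (fun i j t => (i, j) ∈ q ∧ c.Meet i j t) := by
  obtain ⟨h1, h2, h3⟩ := h
  refine ⟨fun h => (h1 _ _ h.1).1, fun h => ⟨(h1 _ _ h.1).2.1, h.2.symm⟩, fun h => h.2,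
    fun h h' => h2 _ _ _ h.1 h'.1, fun {i j t} hi hj hm => ?_⟩
  have hm' := hc.meet_iff.1 hm
  obtain ⟨hm', rfl⟩ := hm'
  have meet : ∀ {i j}, (i, j) ∈ q → c.Meet i j (c.time i j) := fun h =>
    hc.meet_iff.2 ⟨(h1 _ _ h).2.2, rfl⟩
  rcases h3 i hi j hj hm' with h | ⟨k, hk, ht⟩ | ⟨k, hk, ht⟩ | ⟨k, hk, ht, hs⟩ | ⟨k, hk, ht, hs⟩
  · exact Or.inl ⟨h, hm⟩
  · exact Or.inr (Or.inl ⟨k, _, ht, hk, meet hk⟩)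
  · exact Or.inr (Or.inr (Or.inl ⟨k, _, ht, hk, meet hk⟩))
  · exact Or.inr (Or.inr (Or.inr (Or.inl ⟨k, ⟨hk, ht ▸ meet hk⟩, hs⟩)))
  · exact Or.inr (Or.inr (Or.inr (Or.inr ⟨k, ⟨hk, ht ▸ meet hk⟩, hs⟩)))

theorem Regular.exists_isDynPairs {c : Config ℕ} (hc : c.Regular) (J : Finset ℕ) :
    ∃ q, c.IsDynPairs J q := by
  classical
  have hd := hc.isDyn_ann J
  let q : Finset (ℕ × ℕ) := (J ×ˢ J).filter fun r => ∃ t, c.ann J r.1 r.2 t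
  have hq : ∀ i j, (i, j) ∈ q ↔ ∃ t, c.ann J i j t := by
    intro i j
    simp only [q, Finset.mem_filter, Finset.mem_product, and_iff_right_iff_imp]
    rintro ⟨t, h⟩
    exact ⟨hd.mem h, hd.mem (hd.symm h)⟩
  have hqt : ∀ {i j t}, c.ann J i j t → (i, j) ∈ q ∧ c.time i j = t := fun h =>
    ⟨(hq _ _).2 ⟨_, h⟩, (hc.meet_iff.1 (hd.meet h)).2.symm⟩
  refine ⟨q, ?_, ?_, ?_⟩
  · intro i j h
    obtain ⟨t, h⟩ := (hq i j).1 h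
    exact ⟨hd.mem h, (hq _ _).2 ⟨t, hd.symm h⟩, (hc.meet_iff.1 (hd.meet h)).1⟩
  · intro i j j' h h'
    obtain ⟨t, h⟩ := (hq i j).1 h
    obtain ⟨t', h'⟩ := (hq i j').1 h'
    exact hd.partner h h'
  · intro i hi j hj hm
    rcases hd.resolve hi hj (hc.meet_iff.2 ⟨hm, rfl⟩) with h | ⟨k, u, hu, h⟩ | ⟨k, u, hu, h⟩ |
      ⟨k, h, hs⟩ | ⟨k, h, hs⟩
    · exact Or.inl (hqt h).1
    · exact Or.inr (Or.inl ⟨k, (hqt h).1, (hqt h).2 ▸ hu⟩)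
    · exact Or.inr (Or.inr (Or.inl ⟨k, (hqt h).1, (hqt h).2 ▸ hu⟩))
    · exact Or.inr (Or.inr (Or.inr (Or.inl ⟨k, (hqt h).1, (hqt h).2, hs⟩)))
    · exact Or.inr (Or.inr (Or.inr (Or.inr ⟨k, (hqt h).1, (hqt h).2, hs⟩)))

/-- Replaces the quantifiers over real times and relations by a countable union over finite sets of
pairs, each described by comparisons of meeting times. Measurability follows. -/
theorem Regular.exists_ann_iff {c : Config ℕ} (hc : c.Regular) {J : Finset ℕ} {i j : ℕ} :
    (∃ t, c.ann J i j t) ↔ ∃ q, c.IsDynPairs J q ∧ (i, j) ∈ q := by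
  constructor
  · rintro ⟨t, h⟩
    obtain ⟨q, hq⟩ := hc.exists_isDynPairs J
    exact ⟨q, hq, (((hq.isDyn hc).ann_iff hc).1 h).1⟩
  · rintro ⟨q, hq, h⟩
    exact ⟨c.time i j, ((hq.isDyn hc).ann_iff hc).2 ⟨h, hc.meet_iff.2 ⟨(hq.1 i j h).2.2, rfl⟩⟩⟩

section Measurable

variable {Ω : Type*} [MeasurableSpace Ω] {C : Ω → Config ℕ}

/-- A random regular configuration. -/
structure IsRandom (C : Ω → Config ℕ) : Prop where
  regular : ∀ ω, (C ω).Regular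
  strictMono : ∀ ω, StrictMono (C ω).x
  measurable_x : ∀ i, Measurable fun ω => (C ω).x i
  measurable_v : ∀ i, Measurable fun ω => (C ω).v i
  measurable_s : ∀ i, Measurable fun ω => (C ω).s i

theorem IsRandom.measurable_spinSaves (hC : IsRandom C) (k i j : ℕ) :
    Measurable fun ω => (C ω).SpinSaves k i j := by
  have h1 := hC.measurable_v
  have h2 := hC.measurable_s
  unfold SpinSaves
  refine .or (.and ?_ ?_) (.and ?_ ?_)
  · exact measurableSet_setOfPred.1 (measurableSet_eq_fun (h1 i) measurable_const)
  · exact measurableSet_setOfPred.1 (measurableSet_eq_fun (h2 i) (h1 k))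
  · exact measurableSet_setOfPred.1 (measurableSet_eq_fun (h1 j) measurable_const)
  · exact measurableSet_setOfPred.1 (measurableSet_eq_fun (h2 j) (h1 k))

theorem IsRandom.measurable_time (hC : IsRandom C) (i j : ℕ) : Measurable fun ω => (C ω).time i j := by
  have h1 := hC.measurable_v
  have h2 := hC.measurable_x
  have h3 : ∀ i, Measurable fun ω => ((C ω).v i : ℝ) := fun i =>
    (measurable_of_countable (fun z : ℤ => (z : ℝ))).comp (h1 i)
  exact ((h2 j).sub (h2 i)).div ((h3 i).sub (h3 j))

theorem IsRandom.measurable_meets (hC : IsRandom C) (i j : ℕ) : Measurable fun ω => (C ω).Meets i j := by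
  refine .and measurable_const (.and (.not ?_) ?_)
  · exact measurableSet_setOfPred.1 (measurableSet_eq_fun (hC.measurable_v i) (hC.measurable_v j))
  · exact measurableSet_setOfPred.1 (measurableSet_le measurable_const (hC.measurable_time i j))

theorem IsRandom.measurable_isDynPairs (hC : IsRandom C) (J : Finset ℕ) (q : Finset (ℕ × ℕ)) :
    Measurable fun ω => (C ω).IsDynPairs J q := by
  have ht := hC.measurable_time
  have hm := hC.measurable_meets
  have hs := hC.measurable_spinSaves
  have hlt : ∀ i j k l, Measurable fun ω => (C ω).time i j < (C ω).time k l := fun i j k l =>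
    measurableSet_setOfPred.1 (measurableSet_lt (ht i j) (ht k l))
  have heq : ∀ i j k l, Measurable fun ω => (C ω).time i j = (C ω).time k l := fun i j k l =>
    measurableSet_setOfPred.1 (measurableSet_eq_fun (ht i j) (ht k l))
  refine .and (.forall fun i => .forall fun j => .imp measurable_const
    (.and measurable_const (.and measurable_const (hm i j)))) (.and measurable_const ?_)
  refine .forall fun i => .imp measurable_const (.forall fun j => .imp measurable_const
    (.imp (hm i j) (.or measurable_const (.or (.exists fun k => .and measurable_const ?_)
    (.or (.exists fun k => .and measurable_const ?_) (.or (.exists fun k => .and measurable_const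
    (.and ?_ ?_)) (.exists fun k => .and measurable_const (.and ?_ ?_))))))))
  exacts [hlt _ _ _ _, hlt _ _ _ _, heq _ _ _ _, hs _ _ _, heq _ _ _ _, hs _ _ _]

theorem IsRandom.measurable_ann (hC : IsRandom C) (J : Finset ℕ) (i j : ℕ) :
    Measurable fun ω => ∃ t, (C ω).ann J i j t := by
  have : (fun ω => ∃ t, (C ω).ann J i j t) =
      fun ω => ∃ q, (C ω).IsDynPairs J q ∧ (i, j) ∈ q := by
    ext ω
    exact (hC.regular ω).exists_ann_iff
  rw [this]
  exact .exists fun q => .and (hC.measurable_isDynPairs J q) measurable_const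

theorem IsRandom.measurable_surv (hC : IsRandom C) (J : Finset ℕ) (i : ℕ) :
    Measurable fun ω => (C ω).Surv J i := by
  have : (fun ω => (C ω).Surv J i) = fun ω => i ∈ J ∧ ∀ k, ¬ ∃ t, (C ω).ann J i k t := by
    ext ω
    simp [Surv]
  rw [this]
  exact .and measurable_const (.forall fun k => .not (hC.measurable_ann J i k))

theorem IsRandom.measurable_vel_eq (hC : IsRandom C) (i : ℕ) (z : ℤ) : Measurable fun ω => (C ω).v i = z :=
  measurableSet_setOfPred.1 (measurableSet_eq_fun (hC.measurable_v i) measurable_const)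

theorem IsRandom.measurable_cross (hC : IsRandom C) (a b : ℕ) : Measurable fun ω => (C ω).Cross a b :=
  .and (hC.measurable_vel_eq _ _) (hC.measurable_surv _ _)

theorem IsRandom.measurable_first (hC : IsRandom C) (a b : ℕ) : Measurable fun ω => (C ω).First a b := by
  have : (fun ω => (C ω).First a b) = fun ω => (C ω).v b = -1 ∧ (C ω).Surv (Finset.Icc a b) b ∧
      ∀ i, i ∈ Finset.Icc a b → (C ω).v i = -1 → (C ω).Surv (Finset.Icc a b) i → i = b := by
    ext ω
    exact ⟨fun h => ⟨h.vel, h.surv, h.eq⟩, fun h => ⟨h.1, h.2.1, fun i hi =>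
      (hC.strictMono ω).monotone (Finset.mem_Icc.1 hi).2, h.2.2⟩⟩
  rw [this]
  exact .and (hC.measurable_vel_eq _ _) (.and (hC.measurable_surv _ _) (.forall fun i =>
    .imp measurable_const (.imp (hC.measurable_vel_eq _ _) (.imp (hC.measurable_surv _ _)
    measurable_const))))

theorem IsRandom.measurable_firstR (hC : IsRandom C) (a b : ℕ) : Measurable fun ω => (C ω).FirstR a b := by
  have : (fun ω => (C ω).FirstR a b) = fun ω => (C ω).v a = 1 ∧ (C ω).Surv (Finset.Icc a b) a ∧
      ∀ i, i ∈ Finset.Icc a b → (C ω).v i = 1 → (C ω).Surv (Finset.Icc a b) i → i = a := by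
    ext ω
    exact ⟨fun h => ⟨h.vel, h.surv, h.eq⟩, fun h => ⟨h.1, h.2.1, fun i hi =>
      (hC.strictMono ω).monotone (Finset.mem_Icc.1 hi).1, h.2.2⟩⟩
  rw [this]
  exact .and (hC.measurable_vel_eq _ _) (.and (hC.measurable_surv _ _) (.forall fun i =>
    .imp measurable_const (.imp (hC.measurable_vel_eq _ _) (.imp (hC.measurable_surv _ _)
    measurable_const))))

theorem IsRandom.measurable_mutual (hC : IsRandom C) (a b : ℕ) : Measurable fun ω => (C ω).Mutual a b :=
  .and (hC.measurable_vel_eq _ _) (.and (hC.measurable_vel_eq _ _) (hC.measurable_ann _ _ _))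

theorem IsRandom.measurable_leftWins (hC : IsRandom C) (a k b : ℕ) : Measurable fun ω => (C ω).LeftWins a k b := by
  have hx := hC.measurable_x
  refine .or ?_ (.and ?_ ?_)
  · exact measurableSet_setOfPred.1 (measurableSet_lt ((hx k).sub (hx a)) ((hx b).sub (hx k)))
  · exact measurableSet_setOfPred.1 (measurableSet_eq_fun ((hx k).sub (hx a)) ((hx b).sub (hx k)))
  · exact measurableSet_setOfPred.1 (measurableSet_eq_fun (hC.measurable_s k) measurable_const)

end Measurable

/-! ### Transport between blocks -/

section Transport

variable {c c' : Config ℕ}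

/-- The particles `i + n` of `c'`, for `i` in `[a, b]`, form a translate of the particles `i` of
`c`. -/
def Translate (c c' : Config ℕ) (n a b : ℕ) : Prop :=
  ∃ C : ℝ, ∀ i ∈ Finset.Icc a b,
    c'.x (i + n) = c.x i + C ∧ c'.v (i + n) = c.v i ∧ c'.s (i + n) = c.s i

/-- The particles of `c'` in `[0, N]` form the mirror image of those of `c`. -/
def Reflect (c c' : Config ℕ) (N : ℕ) : Prop :=
  ∃ C : ℝ, ∀ i ≤ N, c'.x (N - i) = -c.x i + C ∧ c'.v (N - i) = -c.v i ∧ c'.s (N - i) = -c.s i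

variable {n a b N : ℕ}

theorem image_add_Icc : (Finset.Icc a b).image (· + n) = Finset.Icc (a + n) (b + n) := by
  simp

theorem Translate.surv_iff (h : c.Translate c' n a b) (hc : c.Regular) (hc' : c'.Regular) {i : ℕ}
    (hi : i ∈ Finset.Icc a b) :
    c'.Surv (Finset.Icc (a + n) (b + n)) (i + n) ↔ c.Surv (Finset.Icc a b) i := by
  obtain ⟨C, h⟩ := h
  rw [← image_add_Icc]
  exact surv_transport hc hc' (e := (· + n)) (add_left_injective n).injOn (σ := 1) (C := C)
    (Or.inl rfl) (by simpa using fun i h1 h2 => (h i (Finset.mem_Icc.2 ⟨h1, h2⟩)).1)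
    (by simpa using fun i h1 h2 => (h i (Finset.mem_Icc.2 ⟨h1, h2⟩)).2.1)
    (by simpa using fun i h1 h2 => (h i (Finset.mem_Icc.2 ⟨h1, h2⟩)).2.2) hi

theorem Translate.ann_iff (h : c.Translate c' n a b) (hc : c.Regular) (hc' : c'.Regular) {i j : ℕ}
    (hi : i ∈ Finset.Icc a b) (hj : j ∈ Finset.Icc a b) {t : ℝ} :
    c'.ann (Finset.Icc (a + n) (b + n)) (i + n) (j + n) t ↔ c.ann (Finset.Icc a b) i j t := by
  obtain ⟨C, h⟩ := h
  rw [← image_add_Icc]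
  exact ann_transport hc hc' (e := (· + n)) (add_left_injective n).injOn (σ := 1) (C := C)
    (Or.inl rfl) (by simpa using fun i h1 h2 => (h i (Finset.mem_Icc.2 ⟨h1, h2⟩)).1)
    (by simpa using fun i h1 h2 => (h i (Finset.mem_Icc.2 ⟨h1, h2⟩)).2.1)
    (by simpa using fun i h1 h2 => (h i (Finset.mem_Icc.2 ⟨h1, h2⟩)).2.2) hi hj

theorem Translate.vel (h : c.Translate c' n a b) {i : ℕ} (hi : i ∈ Finset.Icc a b) :
    c'.v (i + n) = c.v i := by
  obtain ⟨C, h⟩ := h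
  exact (h i hi).2.1

theorem forall_mem_Icc_add {p : ℕ → Prop} :
    (∀ i ∈ Finset.Icc (a + n) (b + n), p i) ↔ ∀ i ∈ Finset.Icc a b, p (i + n) := by
  rw [← image_add_Icc, Finset.forall_mem_image]

theorem first_iff (hx : StrictMono c.x) : c.First a b ↔ c.v b = -1 ∧
    c.Surv (Finset.Icc a b) b ∧
    ∀ i ∈ Finset.Icc a b, c.v i = -1 → c.Surv (Finset.Icc a b) i → i = b :=
  ⟨fun h => ⟨h.vel, h.surv, h.eq⟩,
    fun h => ⟨h.1, h.2.1, fun _ hi => hx.monotone (Finset.mem_Icc.1 hi).2, h.2.2⟩⟩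

theorem firstR_iff (hx : StrictMono c.x) : c.FirstR a b ↔ c.v a = 1 ∧
    c.Surv (Finset.Icc a b) a ∧
    ∀ i ∈ Finset.Icc a b, c.v i = 1 → c.Surv (Finset.Icc a b) i → i = a :=
  ⟨fun h => ⟨h.vel, h.surv, h.eq⟩,
    fun h => ⟨h.1, h.2.1, fun _ hi => hx.monotone (Finset.mem_Icc.1 hi).1, h.2.2⟩⟩

theorem Translate.cross_iff (h : c.Translate c' n a b) (hc : c.Regular) (hc' : c'.Regular)
    (hab : a ≤ b) : c'.Cross (a + n) (b + n) ↔ c.Cross a b := by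
  have hb : b ∈ Finset.Icc a b := Finset.mem_Icc.2 ⟨hab, le_rfl⟩
  unfold Cross
  rw [h.surv_iff hc hc' hb, h.vel hb]

theorem Translate.first_iff (h : c.Translate c' n a b) (hc : c.Regular) (hc' : c'.Regular)
    (hx : StrictMono c.x) (hx' : StrictMono c'.x) (hab : a ≤ b) :
    c'.First (a + n) (b + n) ↔ c.First a b := by
  have hb : b ∈ Finset.Icc a b := Finset.mem_Icc.2 ⟨hab, le_rfl⟩
  rw [Config.first_iff hx, Config.first_iff hx', forall_mem_Icc_add, h.surv_iff hc hc' hb,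
    h.vel hb]
  refine and_congr_right fun _ => and_congr_right fun _ => forall₂_congr fun i hi => ?_
  rw [h.surv_iff hc hc' hi, h.vel hi, add_left_inj]

theorem Translate.firstR_iff (h : c.Translate c' n a b) (hc : c.Regular) (hc' : c'.Regular)
    (hx : StrictMono c.x) (hx' : StrictMono c'.x) (hab : a ≤ b) :
    c'.FirstR (a + n) (b + n) ↔ c.FirstR a b := by
  have hb : a ∈ Finset.Icc a b := Finset.mem_Icc.2 ⟨le_rfl, hab⟩
  rw [Config.firstR_iff hx, Config.firstR_iff hx', forall_mem_Icc_add, h.surv_iff hc hc' hb,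
    h.vel hb]
  refine and_congr_right fun _ => and_congr_right fun _ => forall₂_congr fun i hi => ?_
  rw [h.surv_iff hc hc' hi, h.vel hi, add_left_inj]

theorem Translate.mutual_iff (h : c.Translate c' n a b) (hc : c.Regular) (hc' : c'.Regular)
    (hab : a ≤ b) : c'.Mutual (a + n) (b + n) ↔ c.Mutual a b := by
  have hb : b ∈ Finset.Icc a b := Finset.mem_Icc.2 ⟨hab, le_rfl⟩
  have ha : a ∈ Finset.Icc a b := Finset.mem_Icc.2 ⟨le_rfl, hab⟩
  unfold Mutual
  simp only [h.ann_iff hc hc' ha hb, h.vel hb, h.vel ha]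

theorem image_sub_Icc (hab : a ≤ b) (hb : b ≤ N) :
    (Finset.Icc a b).image (N - ·) = Finset.Icc (N - b) (N - a) := by
  ext i
  simp only [Finset.mem_image, Finset.mem_Icc]
  constructor
  · rintro ⟨j, hj, rfl⟩
    omega
  · intro hi
    exact ⟨N - i, by omega, by omega⟩

theorem injOn_sub (hb : b ≤ N) : Set.InjOn (N - ·) (Finset.Icc a b : Set ℕ) := by
  intro i hi j hj hij
  simp only [Finset.coe_Icc, Set.mem_Icc] at hi hj
  simp only at hij
  omega

theorem Reflect.surv_iff (h : c.Reflect c' N) (hc : c.Regular) (hc' : c'.Regular) (hb : b ≤ N)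
    {i : ℕ} (hi : i ∈ Finset.Icc a b) :
    c'.Surv (Finset.Icc (N - b) (N - a)) (N - i) ↔ c.Surv (Finset.Icc a b) i := by
  obtain ⟨C, h⟩ := h
  have hi' := Finset.mem_Icc.1 hi
  have h' : ∀ i ∈ Finset.Icc a b, _ := fun i hi => h i ((Finset.mem_Icc.1 hi).2.trans hb)
  rw [← image_sub_Icc (by omega) hb]
  exact surv_transport hc hc' (e := (N - ·)) (injOn_sub hb) (σ := -1) (C := C)
    (Or.inr rfl) (fun i hi => by rw [(h' i hi).1]; push_cast; ring)
    (fun i hi => by rw [(h' i hi).2.1]; ring) (fun i hi => by rw [(h' i hi).2.2]; ring) hi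

theorem Reflect.first_iff (h : c.Reflect c' N) (hc : c.Regular) (hc' : c'.Regular)
    (hx : StrictMono c.x) (hx' : StrictMono c'.x) (hab : a ≤ b) (hb : b ≤ N) :
    c'.First (N - b) (N - a) ↔ c.FirstR a b := by
  have ha : a ∈ Finset.Icc a b := Finset.mem_Icc.2 ⟨le_rfl, hab⟩
  rw [Config.firstR_iff hx, Config.first_iff hx', h.surv_iff hc hc' hb ha,
    ← image_sub_Icc hab hb, Finset.forall_mem_image, image_sub_Icc hab hb]
  have hv : ∀ i ≤ N, (c'.v (N - i) = -1 ↔ c.v i = 1) := by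
    obtain ⟨C, h⟩ := h
    intro i hi
    rw [(h i hi).2.1]
    omega
  rw [hv a (hab.trans hb)]
  refine and_congr_right fun _ => and_congr_right fun _ => forall₂_congr fun i hi => ?_
  have hi' := Finset.mem_Icc.1 hi
  rw [h.surv_iff hc hc' hb hi, hv i (by omega)]
  refine imp_congr_right fun _ => imp_congr_right fun _ => ?_
  omega

theorem Reflect.firstR_iff (h : c.Reflect c' N) (hc : c.Regular) (hc' : c'.Regular)
    (hx : StrictMono c.x) (hx' : StrictMono c'.x) (hab : a ≤ b) (hb : b ≤ N) :
    c'.FirstR (N - b) (N - a) ↔ c.First a b := by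
  have ha : b ∈ Finset.Icc a b := Finset.mem_Icc.2 ⟨hab, le_rfl⟩
  rw [Config.first_iff hx, Config.firstR_iff hx', h.surv_iff hc hc' hb ha,
    ← image_sub_Icc hab hb, Finset.forall_mem_image, image_sub_Icc hab hb]
  have hv : ∀ i ≤ N, (c'.v (N - i) = 1 ↔ c.v i = -1) := by
    obtain ⟨C, h⟩ := h
    intro i hi
    rw [(h i hi).2.1]
    omega
  rw [hv b hb]
  refine and_congr_right fun _ => and_congr_right fun _ => forall₂_congr fun i hi => ?_
  have hi' := Finset.mem_Icc.1 hi
  rw [h.surv_iff hc hc' hb hi, hv i (by omega)]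
  refine imp_congr_right fun _ => imp_congr_right fun _ => ?_
  omega

/-- Reflection exchanges the distances and reverses the spin that decides ties, so the winning side
is exchanged even for equal distances. -/
theorem Reflect.leftWins_iff (h : c.Reflect c' N) (hc : c.Regular) {k : ℕ} (ha : a ≤ N)
    (hk : k ≤ N) (hb : b ≤ N) : c'.LeftWins (N - b) (N - k) (N - a) ↔ ¬ c.LeftWins a k b := by
  obtain ⟨C, h⟩ := h
  unfold LeftWins
  rw [(h a ha).1, (h b hb).1, (h k hk).1, (h k hk).2.2]
  push Not
  rcases hc.spin k with hs | hs
  · rw [hs]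
    constructor
    · rintro (h | ⟨-, h⟩)
      · exact ⟨by linarith, fun h' => by linarith⟩
      · omega
    · rintro ⟨h1, h2⟩
      rcases h1.lt_or_eq with h | h
      · exact Or.inl (by linarith)
      · exact absurd rfl (h2 h.symm)
  · rw [hs]
    constructor
    · rintro (h | ⟨h, -⟩)
      · exact ⟨by linarith, fun h' => by norm_num⟩
      · exact ⟨by linarith, fun h' => by norm_num⟩
    · rintro ⟨h1, -⟩
      rcases h1.lt_or_eq with h | h
      · exact Or.inl (by linarith)
      · exact Or.inr ⟨by linarith, rfl⟩

end Transport

end Config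
end BallisticAnnihilation

namespace BallisticAnnihilation

open scoped ENNReal

/-! ### The canonical space -/

/-- The discrete σ-algebra. -/
instance signTypeMeasurableSpace : MeasurableSpace SignType := ⊤

instance signTypeDiscrete : DiscreteMeasurableSpace SignType := ⟨fun _ => trivial⟩

/-- A sequence of spins, a sequence of positive gaps and a sequence of velocities. -/
abbrev World : Type := (ℕ → Bool) × (ℕ → {r : ℝ // 0 < r}) × (ℕ → SignType)

/-- The integer coded by a boolean spin. -/
def spinVal (b : Bool) : ℤ := if b then 1 else -1

/-- The configuration coded by a point of the canonical space. -/
noncomputable def World.config (w : World) : Config ℕ where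
  x n := ∑ i ∈ Finset.range (n + 1), (w.2.1 i : ℝ)
  v n := (w.2.2 n : ℤ)
  s n := spinVal (w.1 n)

theorem spinVal_mem (b : Bool) : spinVal b = -1 ∨ spinVal b = 1 := by
  cases b <;> simp [spinVal]

theorem spinVal_not (b : Bool) : spinVal (!b) = -spinVal b := by
  cases b <;> simp [spinVal]

theorem World.strictMono (w : World) : StrictMono w.config.x := by
  refine strictMono_nat_of_lt_succ fun n => ?_
  simp only [World.config]
  rw [Finset.sum_range_succ _ (n + 1)]
  linarith [(w.2.1 (n + 1)).2]

theorem World.x_zero_pos (w : World) : 0 < w.config.x 0 := by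
  simpa [World.config] using (w.2.1 0).2

theorem World.regular (w : World) : w.config.Regular where
  inj := w.strictMono.injective
  vel i := by
    simp only [World.config]
    cases w.2.2 i <;> simp
  spin i := spinVal_mem _

theorem World.isRandom : Config.IsRandom World.config where
  regular := World.regular
  strictMono := World.strictMono
  measurable_x i := by
    simp only [World.config]
    fun_prop
  measurable_v i := (measurable_of_countable (fun z : SignType => (z : ℤ))).comp (by fun_prop)
  measurable_s i := (measurable_of_countable spinVal).comp (by fun_prop)

/-- Forget the first `n` particles. -/
def World.shift (n : ℕ) (w : World) : World :=
  (fun i => w.1 (i + n), fun i => w.2.1 (i + n), fun i => w.2.2 (i + n))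

/-- Concatenation of sequences. -/
def glue {X : Type*} (n : ℕ) (q : (ℕ → X) × (ℕ → X)) (i : ℕ) : X :=
  if i < n then q.1 i else q.2 (i - n)

/-- The first `n` particles of a configuration followed by another configuration. -/
def World.glue (n : ℕ) (q : World × World) : World :=
  (BallisticAnnihilation.glue n (q.1.1, q.2.1), BallisticAnnihilation.glue n (q.1.2.1, q.2.2.1),
    BallisticAnnihilation.glue n (q.1.2.2, q.2.2.2))

/-- Reflection of the first `N + 1` particles. -/
def World.reflect (N : ℕ) (w : World) : World :=
  (fun i => !(w.1 (if i ≤ N then N - i else i)),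
    -- Gap `i` lies between the particles `i - 1` and `i`, hence the shift to `N + 1 - i`; gap `0`,
    -- which precedes the first particle, stays in place.
    fun i => w.2.1 (if 1 ≤ i ∧ i ≤ N then N + 1 - i else i),
    fun i => -(w.2.2 (if i ≤ N then N - i else i)))

theorem World.shift_glue (n : ℕ) (q : World × World) : (World.glue n q).shift n = q.2 := by
  simp [World.glue, World.shift, BallisticAnnihilation.glue]

theorem World.translate_shift (w : World) (n a b : ℕ) :
    (w.shift n).config.Translate w.config n a b := by
  refine ⟨∑ i ∈ Finset.range n, (w.2.1 i : ℝ), fun i _ => ⟨?_, rfl, rfl⟩⟩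
  simp only [World.config, World.shift]
  rw [show i + n + 1 = n + (i + 1) by ring, Finset.sum_range_add, add_comm]
  simp [add_comm]

theorem World.translate_of_eq {w w' : World} {n : ℕ} (h : ∀ i < n, w.1 i = w'.1 i ∧
    w.2.1 i = w'.2.1 i ∧ w.2.2 i = w'.2.2 i) (a b : ℕ) (hb : b < n) :
    w.config.Translate w'.config 0 a b := by
  refine ⟨0, fun i hi => ?_⟩
  have hi := (Finset.mem_Icc.1 hi).2
  simp only [World.config, add_zero]
  refine ⟨Finset.sum_congr rfl fun j hj => ?_, ?_, ?_⟩
  · rw [(h j (by have := Finset.mem_range.1 hj; omega)).2.1]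
  · rw [(h i (by omega)).2.2]
  · rw [(h i (by omega)).1]

theorem World.reflect_reflect (w : World) (N : ℕ) : w.config.Reflect (w.reflect N).config N := by
  -- The constant is dictated by the case `i = 0`; each further particle shifts both sides by the
  -- same gap.
  refine ⟨(w.reflect N).config.x N + w.config.x 0, fun i hi => ?_⟩
  refine ⟨?_, ?_, ?_⟩
  · induction i with
    | zero => simp
    | succ i ih =>
      have ih := ih (by omega)
      have h1 : w.config.x (i + 1) = w.config.x i + w.2.1 (i + 1) := by
        simp only [World.config]
        rw [Finset.sum_range_succ]
      have h2 : (w.reflect N).config.x (N - i) =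
          (w.reflect N).config.x (N - (i + 1)) + w.2.1 (i + 1) := by
        have : N - i = N - (i + 1) + 1 := by omega
        rw [this]
        simp only [World.config]
        rw [Finset.sum_range_succ]
        simp only [World.reflect]
        rw [if_pos (by omega), show N + 1 - (N - (i + 1) + 1) = i + 1 by omega]
      linarith
  · simp only [World.config, World.reflect]
    rw [if_pos (by omega), show N - (N - i) = i by omega]
    cases w.2.2 i <;> simp
  · simp only [World.config, World.reflect]
    rw [if_pos (by omega), show N - (N - i) = i by omega, spinVal_not]

/-! ### The product law: invariance and independence. -/

/-- The law of the particles: independent sequences of i.i.d. spins, gaps and velocities. -/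
noncomputable def worldMeasure (β : Measure Bool) (γ : Measure {r : ℝ // 0 < r})
    (ρ : Measure SignType) : Measure World :=
  (Measure.infinitePi fun _ => β).prod
    ((Measure.infinitePi fun _ => γ).prod (Measure.infinitePi fun _ => ρ))

theorem measurePreserving_reindex {X : Type*} [MeasurableSpace X] {μ : Measure X}
    [IsProbabilityMeasure μ] {φ : X → X} (hφ : MeasurePreserving φ μ μ) {σ : ℕ → ℕ}
    (hσ : Function.Injective σ) :
    MeasurePreserving (fun (w : ℕ → X) i => φ (w (σ i))) (Measure.infinitePi fun _ => μ)
      (Measure.infinitePi fun _ => μ) := by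
  have hm := hφ.measurable
  refine ⟨by fun_prop, ?_⟩
  have : (fun (w : ℕ → X) i => φ (w (σ i))) = (fun (w : ℕ → X) i => φ (w i)) ∘ fun w i => w (σ i) :=
    rfl
  rw [this, ← Measure.map_map (by fun_prop) (by fun_prop),
    Measure.map_infinitePi_infinitePi_of_inj hσ, Measure.infinitePi_map_pi _ fun _ => hm, hφ.map_eq]

theorem measurable_glue {X : Type*} [MeasurableSpace X] (n : ℕ) :
    Measurable (glue n : (ℕ → X) × (ℕ → X) → ℕ → X) := by
  refine measurable_pi_lambda _ fun i => ?_
  unfold glue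
  split_ifs <;> fun_prop

theorem measurePreserving_glue {X : Type*} [MeasurableSpace X] {μ : Measure X}
    [IsProbabilityMeasure μ] (n : ℕ) :
    MeasurePreserving (glue n : (ℕ → X) × (ℕ → X) → ℕ → X)
      ((Measure.infinitePi fun _ => μ).prod (Measure.infinitePi fun _ => μ))
      (Measure.infinitePi fun _ => μ) := by
  refine ⟨measurable_glue n, Measure.eq_infinitePi _ fun s t ht => ?_⟩
  rw [Measure.map_apply (measurable_glue n) (.pi s.countable_toSet fun _ _ => ht _)]
  -- A cylinder splits into its coordinates below `n` and those from `n` on, renumbered from `0`.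
  have : glue n ⁻¹' (Set.pi s t) = (Set.pi (s.filter (· < n) : Finset ℕ) t) ×ˢ
      (Set.pi ((s.filter (¬ · < n)).image (· - n) : Finset ℕ) fun i => t (i + n)) := by
    ext q
    simp only [Set.mem_preimage, Set.mem_pi, Finset.mem_coe, Set.mem_prod, Finset.mem_filter,
      Finset.forall_mem_image, glue]
    constructor
    · intro h
      refine ⟨fun i hi => by simpa [hi.2] using h i hi.1, fun i hi => ?_⟩
      have := h i hi.1
      rw [if_neg hi.2] at this
      rwa [Nat.sub_add_cancel (not_lt.1 hi.2)]
    · rintro ⟨h1, h2⟩ i hi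
      split_ifs with hin
      · exact h1 i ⟨hi, hin⟩
      · have := h2 ⟨hi, hin⟩
        rwa [Nat.sub_add_cancel (not_lt.1 hin)] at this
  rw [this, Measure.prod_prod, Measure.infinitePi_pi _ fun i _ => ht i,
    Measure.infinitePi_pi _ fun i _ => ht _, Finset.prod_image,
    ← Finset.prod_filter_mul_prod_filter_not s (· < n)]
  · congr 1
    refine Finset.prod_congr rfl fun i hi => ?_
    rw [Nat.sub_add_cancel (not_lt.1 (Finset.mem_filter.1 hi).2)]
  · intro i hi j hj hij
    simp only [Finset.coe_filter, Set.mem_ofPred_eq] at hi hj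
    simp only at hij
    omega

theorem measurePreserving_prodProdProdComm {A B C D : Type*} [MeasurableSpace A]
    [MeasurableSpace B] [MeasurableSpace C] [MeasurableSpace D] (a : Measure A) (b : Measure B)
    (c : Measure C) (d : Measure D) [SFinite a] [SFinite b] [SFinite c] [SFinite d] :
    MeasurePreserving (fun q : (A × B) × (C × D) => ((q.1.1, q.2.1), (q.1.2, q.2.2)))
      ((a.prod b).prod (c.prod d)) ((a.prod c).prod (b.prod d)) := by
  have h1 := measurePreserving_prodAssoc a b (c.prod d)
  have h2 := (MeasurePreserving.id a).prod
    ((measurePreserving_prodAssoc b c d).symm MeasurableEquiv.prodAssoc)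
  have h3 := (MeasurePreserving.id a).prod
    ((Measure.measurePreserving_swap (μ := b) (ν := c)).prod (MeasurePreserving.id d))
  have h4 := (MeasurePreserving.id a).prod (measurePreserving_prodAssoc c b d)
  have h5 := (measurePreserving_prodAssoc a c (b.prod d)).symm MeasurableEquiv.prodAssoc
  exact h5.comp (h4.comp (h3.comp (h2.comp h1)))

theorem measurePreserving_prodGlue {A B : Type*} [MeasurableSpace A]
    [MeasurableSpace B] {a : Measure A} {b : Measure B} [SFinite a] [SFinite b]
    {φ : A × A → A} {ψ : B × B → B} (hφ : MeasurePreserving φ (a.prod a) a)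
    (hψ : MeasurePreserving ψ (b.prod b) b) :
    MeasurePreserving (fun q : (A × B) × (A × B) => (φ (q.1.1, q.2.1), ψ (q.1.2, q.2.2)))
      ((a.prod b).prod (a.prod b)) (a.prod b) :=
  (hφ.prod hψ).comp (measurePreserving_prodProdProdComm a b a b)

section Law

variable {β : Measure Bool} {γ : Measure {r : ℝ // 0 < r}} {ρ : Measure SignType}
  [IsProbabilityMeasure β] [IsProbabilityMeasure γ] [IsProbabilityMeasure ρ]

instance : IsProbabilityMeasure (worldMeasure β γ ρ) := by
  unfold worldMeasure
  infer_instance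

theorem measurePreserving_shift (n : ℕ) :
    MeasurePreserving (World.shift n) (worldMeasure β γ ρ) (worldMeasure β γ ρ) := by
  have hσ : Function.Injective (· + n) := add_left_injective n
  exact (measurePreserving_reindex (.id β) hσ).prod
    ((measurePreserving_reindex (.id γ) hσ).prod (measurePreserving_reindex (.id ρ) hσ))

theorem World.measurePreserving_glue (n : ℕ) : MeasurePreserving (World.glue n)
    ((worldMeasure β γ ρ).prod (worldMeasure β γ ρ)) (worldMeasure β γ ρ) :=
  measurePreserving_prodGlue (BallisticAnnihilation.measurePreserving_glue n)
    (measurePreserving_prodGlue (BallisticAnnihilation.measurePreserving_glue n)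
      (BallisticAnnihilation.measurePreserving_glue n))

theorem measurePreserving_reflect (hβ : MeasurePreserving not β β)
    (hρ : MeasurePreserving (fun z => -z) ρ ρ) (N : ℕ) :
    MeasurePreserving (World.reflect N) (worldMeasure β γ ρ) (worldMeasure β γ ρ) := by
  have h1 : Function.Injective fun i => if i ≤ N then N - i else i := by
    intro i j hij
    simp only at hij
    split_ifs at hij <;> omega
  have h2 : Function.Injective fun i => if 1 ≤ i ∧ i ≤ N then N + 1 - i else i := by
    intro i j hij
    simp only at hij
    split_ifs at hij <;> omega
  exact (measurePreserving_reindex hβ h1).prod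
    ((measurePreserving_reindex (.id γ) h2).prod (measurePreserving_reindex hρ h1))

/-- The event `E` only depends on the first `n` particles. -/
def DependsOnFirst (n : ℕ) (E : Set World) : Prop :=
  ∀ w w' : World, (∀ i < n, w.1 i = w'.1 i ∧ w.2.1 i = w'.2.1 i ∧ w.2.2 i = w'.2.2 i) →
    (w ∈ E ↔ w' ∈ E)

/-- Renewal property: pulled back along `World.glue`, which preserves the measure, the intersection
becomes the rectangle `E ×ˢ E'`. -/
theorem measure_inter_shift {n : ℕ} {E E' : Set World} (hE : MeasurableSet E)
    (hE' : MeasurableSet E') (hn : DependsOnFirst n E) :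
    worldMeasure β γ ρ (E ∩ World.shift n ⁻¹' E') =
      worldMeasure β γ ρ E * worldMeasure β γ ρ E' := by
  have hs := (measurePreserving_shift (β := β) (γ := γ) (ρ := ρ) n).measurable
  rw [← (World.measurePreserving_glue n).measure_preimage (hE.inter (hs hE')).nullMeasurableSet,
    ← Measure.prod_prod]
  congr 1
  ext q
  have : World.glue n q ∈ E ↔ q.1 ∈ E := by
    refine hn _ _ fun i hi => ?_
    simp [World.glue, BallisticAnnihilation.glue, hi]
  simp only [Set.mem_preimage, Set.mem_inter_iff, Set.mem_prod, World.shift_glue, this]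

theorem measure_vel_eq (z : ℤ) :
    worldMeasure β γ ρ {w | w.config.v 0 = z} = ρ {a | (a : ℤ) = z} := by
  have h1 : MeasurePreserving (fun w : World => w.2.2 0) (worldMeasure β γ ρ) ρ := by
    have := measurePreserving_eval_infinitePi (fun _ : ℕ => ρ) 0
    exact this.comp (measurePreserving_snd.comp measurePreserving_snd)
  rw [← h1.measure_preimage (DiscreteMeasurableSpace.forall_measurableSet _).nullMeasurableSet]
  rfl

end Law

open Filter Topology

/-! ### Events on the canonical space -/

/-- The particle `n` is the first one to reach the origin. -/
def firstEv (n : ℕ) : Set World := {w | w.config.First 0 n}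

/-- The mirror image of `firstEv`. -/
def firstREv (n : ℕ) : Set World := {w | w.config.FirstR 0 n}

/-- The particle `n` crosses the origin. -/
def crossEv (n : ℕ) : Set World := {w | w.config.Cross 0 n}

/-- The particle `0` crosses the block `[0, n]` to the right. -/
def crossREv (n : ℕ) : Set World :=
  {w | w.config.v 0 = 1 ∧ w.config.Surv (Finset.Icc 0 n) 0}

/-- The moving particles `0` and `n + 1` annihilate each other. -/
def mutualEv (n : ℕ) : Set World := {w | w.config.Mutual 0 (n + 1)}

/-- The first particle has velocity `z`. -/
def velEv (z : ℤ) : Set World := {w | w.config.v 0 = z}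

/-- The static particle `k + 1` is reached by `0` from the left and by `l + (k + 2)` from the
right when considered separately. -/
def bothEv (k l : ℕ) : Set World :=
  firstREv k ∩ World.shift (k + 1) ⁻¹' (velEv 0 ∩ World.shift 1 ⁻¹' firstEv l)

/-- In the situation of `bothEv`, the particle on the left wins. -/
def leftEv (k l : ℕ) : Set World :=
  bothEv k l ∩ {w | w.config.LeftWins 0 (k + 1) (l + (k + 2))}

/-- In the situation of `bothEv`, the particle on the right wins. -/
def rightEv (k l : ℕ) : Set World :=
  bothEv k l \ {w | w.config.LeftWins 0 (k + 1) (l + (k + 2))}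

/-- The origin is reached by a particle. -/
def reachEv : Set World := ⋃ n, firstEv n

theorem measurableSet_firstEv (n : ℕ) : MeasurableSet (firstEv n) :=
  measurableSet_setOfPred.2 (World.isRandom.measurable_first 0 n)

theorem measurableSet_firstREv (n : ℕ) : MeasurableSet (firstREv n) :=
  measurableSet_setOfPred.2 (World.isRandom.measurable_firstR 0 n)

theorem measurableSet_crossEv (n : ℕ) : MeasurableSet (crossEv n) :=
  measurableSet_setOfPred.2 (World.isRandom.measurable_cross 0 n)

theorem measurableSet_crossREv (n : ℕ) : MeasurableSet (crossREv n) :=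
  measurableSet_setOfPred.2 (.and (World.isRandom.measurable_vel_eq _ _)
    (World.isRandom.measurable_surv _ _))

theorem measurableSet_mutualEv (n : ℕ) : MeasurableSet (mutualEv n) :=
  measurableSet_setOfPred.2 (World.isRandom.measurable_mutual 0 _)

theorem measurableSet_velEv (z : ℤ) : MeasurableSet (velEv z) :=
  measurableSet_setOfPred.2 (World.isRandom.measurable_vel_eq 0 z)

theorem measurable_shift (n : ℕ) : Measurable (World.shift n) := by
  unfold World.shift
  fun_prop

theorem measurableSet_bothEv (k l : ℕ) : MeasurableSet (bothEv k l) :=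
  (measurableSet_firstREv k).inter (measurable_shift _ ((measurableSet_velEv 0).inter
    (measurable_shift _ (measurableSet_firstEv l))))

theorem measurableSet_leftWins (a k b : ℕ) : MeasurableSet {w : World | w.config.LeftWins a k b} :=
  measurableSet_setOfPred.2 (World.isRandom.measurable_leftWins a k b)

theorem measurableSet_leftEv (k l : ℕ) : MeasurableSet (leftEv k l) :=
  (measurableSet_bothEv k l).inter (measurableSet_leftWins _ _ _)

theorem measurableSet_rightEv (k l : ℕ) : MeasurableSet (rightEv k l) :=
  (measurableSet_bothEv k l).diff (measurableSet_leftWins _ _ _)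

theorem shift_mem_firstEv {w : World} {n k : ℕ} :
    w.shift n ∈ firstEv k ↔ w.config.First n (k + n) := by
  have := (w.translate_shift n 0 k).first_iff (w.shift n).regular w.regular (w.shift n).strictMono
    w.strictMono (Nat.zero_le k)
  rw [zero_add] at this
  exact this.symm

theorem shift_mem_crossEv {w : World} {n k : ℕ} :
    w.shift n ∈ crossEv k ↔ w.config.Cross n (k + n) := by
  have := (w.translate_shift n 0 k).cross_iff (w.shift n).regular w.regular (Nat.zero_le k)
  rw [zero_add] at this
  exact this.symm

theorem shift_mem_velEv {w : World} {n : ℕ} {z : ℤ} : w.shift n ∈ velEv z ↔ w.config.v n = z := by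
  simp [velEv, World.config, World.shift]

theorem World.shift_shift (w : World) (a b : ℕ) : (w.shift a).shift b = w.shift (b + a) := by
  simp [World.shift, add_assoc]

theorem mem_bothEv {w : World} {k l : ℕ} : w ∈ bothEv k l ↔ w.config.FirstR 0 k ∧
    w.config.v (k + 1) = 0 ∧ w.config.First (k + 2) (l + (k + 2)) := by
  simp only [bothEv, Set.mem_inter_iff, Set.mem_preimage, shift_mem_velEv, World.shift_shift,
    shift_mem_firstEv, show 1 + (k + 1) = k + 2 by ring]
  rfl

theorem dependsOnFirst_firstEv (k : ℕ) : DependsOnFirst (k + 1) (firstEv k) := by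
  intro w w' h
  exact ((World.translate_of_eq h 0 k (by omega)).first_iff w.regular w'.regular w.strictMono
    w'.strictMono (Nat.zero_le k)).symm

theorem dependsOnFirst_firstREv (k : ℕ) : DependsOnFirst (k + 1) (firstREv k) := by
  intro w w' h
  exact ((World.translate_of_eq h 0 k (by omega)).firstR_iff w.regular w'.regular w.strictMono
    w'.strictMono (Nat.zero_le k)).symm

theorem dependsOnFirst_mutualEv (k : ℕ) : DependsOnFirst (k + 2) (mutualEv k) := by
  intro w w' h
  exact ((World.translate_of_eq h 0 (k + 1) (by omega)).mutual_iff w.regular w'.regular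
    (Nat.zero_le _)).symm

theorem dependsOnFirst_velEv (z : ℤ) : DependsOnFirst 1 (velEv z) := by
  intro w w' h
  simp [velEv, World.config, (h 0 zero_lt_one).2.2]

/-! ### Probability identities and the equation for `q`. -/

section Identities

variable {β : Measure Bool} {γ : Measure {r : ℝ // 0 < r}} {ρ : Measure SignType}

theorem measure_left_add_right (k l : ℕ) :
    worldMeasure β γ ρ (leftEv k l) + worldMeasure β γ ρ (rightEv k l) =
      worldMeasure β γ ρ (bothEv k l) :=
  measure_inter_add_sdiff _ (measurableSet_leftWins _ _ _)

theorem measure_reachEv_eq_tsum :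
    worldMeasure β γ ρ reachEv = ∑' n, worldMeasure β γ ρ (firstEv n) := by
  refine measure_iUnion (fun i j hij => Set.disjoint_left.2 fun w hi hj => hij ?_)
    measurableSet_firstEv
  exact Config.First.unique w.regular w.strictMono hi hj

theorem reachEv_eq : reachEv = (velEv (-1) ∪ ⋃ r : ℕ × ℕ, velEv 0 ∩ World.shift 1 ⁻¹'
      (firstEv r.1 ∩ World.shift (r.1 + 1) ⁻¹' firstEv r.2)) ∪
    ((⋃ r : ℕ × ℕ, mutualEv r.1 ∩ World.shift (r.1 + 2) ⁻¹' firstEv r.2) ∪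
      ⋃ r : ℕ × ℕ, leftEv r.1 r.2) := by
  ext w
  have hc := w.regular
  have hx := w.strictMono
  simp only [reachEv, Set.mem_iUnion, Set.mem_union, Set.mem_inter_iff, Set.mem_preimage,
    shift_mem_firstEv, World.shift_shift, leftEv, mem_bothEv, Prod.exists]
  have hsub : ∀ {k n}, w.config.First k n → ∃ l, l + k = n := fun h =>
    ⟨_, Nat.sub_add_cancel h.le⟩
  constructor
  · rintro ⟨n, hn⟩
    rcases hc.vel 0 with hv | hv | hv
    · exact Or.inl (Or.inl hv)
    · obtain ⟨k, h1, h2⟩ := (Config.first_of_static hc hx hv).1 hn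
      obtain ⟨k', rfl⟩ := hsub h1
      obtain ⟨l, rfl⟩ := hsub h2
      exact Or.inl (Or.inr ⟨k', l, hv, h1, h2⟩)
    · rcases (Config.first_of_right hc hx hv).1 hn with ⟨k, h1, h2⟩ | ⟨k, h1, h2, h3, h4⟩
      · obtain ⟨l, rfl⟩ := hsub h2
        exact Or.inr (Or.inl ⟨k, l, h1, h2⟩)
      · obtain ⟨l, rfl⟩ := hsub h3
        exact Or.inr (Or.inr ⟨k, l, ⟨h1, h2, h3⟩, h4⟩)
  · rintro ((hv | ⟨k, l, hv, h1, h2⟩) | (⟨k, l, h1, h2⟩ | ⟨k, l, ⟨h1, h2, h3⟩, h4⟩))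
    · exact ⟨0, (Config.first_of_left hx hc hv).2 rfl⟩
    · exact ⟨_, (Config.first_of_static hc hx hv).2 ⟨_, h1, h2⟩⟩
    · exact ⟨_, (Config.first_of_right hc hx h1.1).2 (Or.inl ⟨k, h1, h2⟩)⟩
    · exact ⟨_, (Config.first_of_right hc hx h1.vel).2 (Or.inr ⟨k, h1, h2, h3, h4⟩)⟩

theorem mutual_left_partner {w : World} {k l : ℕ}
    (h : w ∈ mutualEv k ∩ World.shift (k + 2) ⁻¹' firstEv l) :
    w.config.First 0 (l + (k + 2)) ∧
      ∃ t, w.config.ann (Finset.Icc 0 (l + (k + 2))) 0 (k + 1) t :=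
  Config.first_of_mutual w.regular w.strictMono h.1 (shift_mem_firstEv.1 h.2)

theorem leftEv_partner {w : World} {k l : ℕ} (h : w ∈ leftEv k l) :
    w.config.First 0 (l + (k + 2)) ∧
      ∃ t, w.config.ann (Finset.Icc 0 (l + (k + 2))) 0 (k + 1) t := by
  obtain ⟨h1, h2, h3⟩ := mem_bothEv.1 h.1
  exact Config.first_of_hit w.regular w.strictMono h2 h1 h3 h.2

/-- Yields disjointness in the decomposition of `reachEv`: the first arrival fixes `l + k`, and the
partner of `0` fixes `k`. -/
theorem eq_of_partner {w : World} {k l k' l' : ℕ}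
    (h : w.config.First 0 (l + (k + 2)) ∧
      ∃ t, w.config.ann (Finset.Icc 0 (l + (k + 2))) 0 (k + 1) t)
    (h' : w.config.First 0 (l' + (k' + 2)) ∧
      ∃ t, w.config.ann (Finset.Icc 0 (l' + (k' + 2))) 0 (k' + 1) t) : k = k' ∧ l = l' := by
  obtain ⟨h1, t, h2⟩ := h
  obtain ⟨h3, t', h4⟩ := h'
  have := h1.unique w.regular w.strictMono h3
  rw [this] at h2
  have := (w.regular.isDyn_ann _).partner h2 h4
  omega

/-- `0` annihilates with the static particle `k + 1` among the particles `0, …, n`. -/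
def hitEv (n k : ℕ) : Set World := {w | w.config.v 0 = 1 ∧ w.config.v (k + 1) = 0 ∧
  ∃ t, w.config.ann (Finset.Icc 0 n) 0 (k + 1) t}

theorem measurableSet_hitEv (n k : ℕ) : MeasurableSet (hitEv n k) :=
  measurableSet_setOfPred.2 (.and (World.isRandom.measurable_vel_eq _ _)
    (.and (World.isRandom.measurable_vel_eq _ _) (World.isRandom.measurable_ann _ _ _)))

/-- If `0` is first to reach the static `k + 1` from the left, it fails to annihilate it exactly
when a particle `l + (k + 2) ≤ n` wins from the right, that is, `l < n - 1 - k`. -/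
theorem measure_hitEv {n k : ℕ} (hk : k < n) :
    worldMeasure β γ ρ (hitEv n k) + ∑ l ∈ Finset.range (n - 1 - k),
      worldMeasure β γ ρ (rightEv k l) =
      worldMeasure β γ ρ (firstREv k ∩ World.shift (k + 1) ⁻¹' velEv 0) := by
  have hiff : ∀ w : World, w ∈ hitEv n k ↔ w.config.v (k + 1) = 0 ∧ w.config.FirstR 0 k ∧
      ∀ l ≤ n, w.config.First (k + 2) l → w.config.LeftWins 0 (k + 1) l := by
    intro w
    constructor
    · rintro ⟨-, h2, h3⟩
      exact ⟨h2, (Config.ann_static_iff w.regular w.strictMono h2 (Nat.zero_le k) hk).1 h3⟩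
    · rintro ⟨h2, h3⟩
      exact ⟨h3.1.vel, h2,
        (Config.ann_static_iff w.regular w.strictMono h2 (Nat.zero_le k) hk).2 h3⟩
  have hr := fun l => measurableSet_rightEv k l
  rw [← measure_biUnion_finset ?_ fun l _ => hr l,
    ← measure_union ?_ (Finset.measurableSet_biUnion _ fun l _ => hr l)]
  · congr 1
    ext w
    simp only [Set.mem_union, hiff, Set.mem_iUnion, rightEv, Set.mem_sdiff, mem_bothEv,
      Set.mem_inter_iff, Set.mem_preimage, shift_mem_velEv, Finset.mem_range, Set.mem_ofPred_eq,
      exists_prop]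
    constructor
    · rintro (⟨h1, h2, -⟩ | ⟨l, -, ⟨h2, h1, -⟩, -⟩)
      exacts [⟨h2, h1⟩, ⟨h2, h1⟩]
    · rintro ⟨h2, h1⟩
      change w.config.FirstR 0 k at h2
      by_cases h : ∀ l ≤ n, w.config.First (k + 2) l → w.config.LeftWins 0 (k + 1) l
      · exact Or.inl ⟨h1, h2, h⟩
      · push Not at h
        obtain ⟨l, hl, hf, hw⟩ := h
        obtain ⟨l, rfl⟩ : ∃ l', l = l' + (k + 2) := ⟨_, (Nat.sub_add_cancel hf.le).symm⟩
        exact Or.inr ⟨l, by omega, ⟨h2, h1, hf⟩, hw⟩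
  · refine Set.disjoint_left.2 fun w hw hw' => ?_
    simp only [Set.mem_iUnion, Finset.mem_range, exists_prop] at hw'
    obtain ⟨l, hl, hw', hw''⟩ := hw'
    exact hw'' (((hiff w).1 hw).2.2 _ (by omega) (mem_bothEv.1 hw').2.2)
  · intro l _ l' _ hne
    refine Set.disjoint_left.2 fun w hw hw' => hne ?_
    have := (mem_bothEv.1 hw.1).2.2.unique w.regular w.strictMono (mem_bothEv.1 hw'.1).2.2
    omega

/-- The possible fates of a right-moving `0` in `[0, n]`. The mutual event does not depend on `n`,
because particles beyond the left-mover `k + 1` cannot affect it. -/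
theorem measure_velEv_one (n : ℕ) : worldMeasure β γ ρ (velEv 1) =
    worldMeasure β γ ρ (crossREv n) + ∑ k ∈ Finset.range n,
      (worldMeasure β γ ρ (mutualEv k) + worldMeasure β γ ρ (hitEv n k)) := by
  have hm := measurableSet_mutualEv
  have hh := measurableSet_hitEv n
  have hmut : ∀ w : World, ∀ k < n, w ∈ mutualEv k → w.config.v (k + 1) = -1 ∧
      ∃ t, w.config.ann (Finset.Icc 0 n) 0 (k + 1) t := by
    rintro w k hk ⟨h1, h2, t, h⟩
    have hd := w.regular.isDyn_ann
    exact ⟨h2, t, (hd _).symm ((Config.ann_Icc_left w.regular w.strictMono h2 (by omega)).2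
      ((hd _).symm h))⟩
  have hpart : ∀ w : World, ∀ k < n, w ∈ mutualEv k ∪ hitEv n k →
      ∃ t, w.config.ann (Finset.Icc 0 n) 0 (k + 1) t := by
    rintro w k hk (h | h)
    exacts [(hmut w k hk h).2, h.2.2]
  have hsum : ∀ k ∈ Finset.range n, worldMeasure β γ ρ (mutualEv k) +
      worldMeasure β γ ρ (hitEv n k) = worldMeasure β γ ρ (mutualEv k ∪ hitEv n k) := by
    intro k hk
    refine (measure_union (Set.disjoint_left.2 fun w hw hw' => ?_) (hh k)).symm
    have h1 := (hmut w k (Finset.mem_range.1 hk) hw).1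
    have h2 : w.config.v (k + 1) = 0 := hw'.2.1
    omega
  rw [Finset.sum_congr rfl hsum, ← measure_biUnion_finset ?_ fun k _ => (hm k).union (hh k),
    ← measure_union ?_ (Finset.measurableSet_biUnion _ fun k _ => (hm k).union (hh k))]
  · congr 1
    ext w
    have hd := w.regular.isDyn_ann (Finset.Icc 0 n)
    simp only [Set.mem_union, Set.mem_iUnion, Finset.mem_range, exists_prop]
    constructor
    · intro hv
      change w.config.v 0 = 1 at hv
      by_cases hs : w.config.Surv (Finset.Icc 0 n) 0
      · exact Or.inl ⟨hv, hs⟩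
      · obtain ⟨k, t, h⟩ := Config.not_surv (by simp) hs
        have hmeet := hd.meet h
        have hk := Finset.mem_Icc.1 (hd.mem (hd.symm h))
        have hk0 := hmeet.1
        obtain ⟨k, rfl⟩ : ∃ k', k = k' + 1 := ⟨k - 1, by omega⟩
        refine Or.inr ⟨k, by omega, ?_⟩
        rcases w.regular.vel (k + 1) with hvk | hvk | hvk
        · exact Or.inl ⟨hv, hvk, t, (w.regular.isDyn_ann _).symm
            ((Config.ann_Icc_left w.regular w.strictMono hvk hk.2).1 (hd.symm h))⟩
        · exact Or.inr ⟨hv, hvk, t, h⟩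
        · exact absurd (hv.trans hvk.symm) (w.regular.vel_ne hmeet)
    · rintro (h | ⟨k, -, h | h⟩)
      exacts [h.1, h.1, h.1]
  · refine Set.disjoint_left.2 fun w hw hw' => ?_
    simp only [Set.mem_iUnion, Finset.mem_range, exists_prop] at hw'
    obtain ⟨k, hk, hw'⟩ := hw'
    obtain ⟨t, h⟩ := hpart w k hk hw'
    exact hw.2.2 _ _ h
  · intro k hk k' hk' hne
    refine Set.disjoint_left.2 fun w hw hw' => hne ?_
    obtain ⟨t, h⟩ := hpart w k (Finset.mem_range.1 hk) hw
    obtain ⟨t', h'⟩ := hpart w k' (Finset.mem_range.1 hk') hw'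
    have := (w.regular.isDyn_ann _).partner h h'
    omega

variable [IsProbabilityMeasure β] [IsProbabilityMeasure γ] [IsProbabilityMeasure ρ]

theorem measure_velEv_first_first (k l : ℕ) : worldMeasure β γ ρ
    (velEv 0 ∩ World.shift 1 ⁻¹' (firstEv k ∩ World.shift (k + 1) ⁻¹' firstEv l)) =
    worldMeasure β γ ρ (velEv 0) *
      (worldMeasure β γ ρ (firstEv k) * worldMeasure β γ ρ (firstEv l)) := by
  have h1 := measurableSet_firstEv
  rw [measure_inter_shift (measurableSet_velEv 0) ((h1 k).inter (measurable_shift _ (h1 l)))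
    (dependsOnFirst_velEv 0), measure_inter_shift (h1 k) (h1 l) (dependsOnFirst_firstEv k)]

theorem measure_mutualEv_first (k l : ℕ) :
    worldMeasure β γ ρ (mutualEv k ∩ World.shift (k + 2) ⁻¹' firstEv l) =
      worldMeasure β γ ρ (mutualEv k) * worldMeasure β γ ρ (firstEv l) :=
  measure_inter_shift (measurableSet_mutualEv k) (measurableSet_firstEv l)
    (dependsOnFirst_mutualEv k)

theorem measure_firstREv (hβ : MeasurePreserving not β β)
    (hρ : MeasurePreserving (fun z => -z) ρ ρ) (k : ℕ) :
    worldMeasure β γ ρ (firstREv k) = worldMeasure β γ ρ (firstEv k) := by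
  rw [← (measurePreserving_reflect (γ := γ) hβ hρ k).measure_preimage
    (measurableSet_firstREv k).nullMeasurableSet]
  congr 1
  ext w
  have := (w.reflect_reflect k).firstR_iff w.regular (w.reflect k).regular w.strictMono
    (w.reflect k).strictMono (Nat.zero_le k) le_rfl
  rw [Nat.sub_self, Nat.sub_zero] at this
  exact this

theorem measure_crossREv (hβ : MeasurePreserving not β β)
    (hρ : MeasurePreserving (fun z => -z) ρ ρ) (n : ℕ) :
    worldMeasure β γ ρ (crossREv n) = worldMeasure β γ ρ (crossEv n) := by
  rw [← (measurePreserving_reflect (γ := γ) hβ hρ n).measure_preimage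
    (measurableSet_crossREv n).nullMeasurableSet]
  congr 1
  ext w
  have h := w.reflect_reflect n
  have h1 := h.surv_iff (a := 0) w.regular (w.reflect n).regular (le_refl n) (i := n) (by simp)
  rw [Nat.sub_self, Nat.sub_zero] at h1
  obtain ⟨C, h⟩ := h
  have h2 := (h n le_rfl).2.1
  rw [Nat.sub_self] at h2
  simp only [Set.mem_preimage, crossREv, crossEv, Set.mem_ofPred_eq, Config.Cross, h1, h2]
  refine and_congr_left fun _ => ?_
  omega

theorem measure_firstREv_static (hβ : MeasurePreserving not β β)
    (hρ : MeasurePreserving (fun z => -z) ρ ρ) (k : ℕ) :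
    worldMeasure β γ ρ (firstREv k ∩ World.shift (k + 1) ⁻¹' velEv 0) =
      worldMeasure β γ ρ (firstEv k) * worldMeasure β γ ρ (velEv 0) := by
  rw [measure_inter_shift (measurableSet_firstREv k) (measurableSet_velEv 0)
    (dependsOnFirst_firstREv k), measure_firstREv hβ hρ]

theorem measure_bothEv (hβ : MeasurePreserving not β β)
    (hρ : MeasurePreserving (fun z => -z) ρ ρ) (k l : ℕ) :
    worldMeasure β γ ρ (bothEv k l) = worldMeasure β γ ρ (velEv 0) *
      (worldMeasure β γ ρ (firstEv k) * worldMeasure β γ ρ (firstEv l)) := by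
  have h1 := measurableSet_firstEv
  rw [bothEv, measure_inter_shift (measurableSet_firstREv k)
    ((measurableSet_velEv 0).inter (measurable_shift _ (h1 l))) (dependsOnFirst_firstREv k),
    measure_inter_shift (measurableSet_velEv 0) (h1 l) (dependsOnFirst_velEv 0),
    measure_firstREv hβ hρ]
  ring

/-- Reflecting `[0, k + l + 2]` exchanges the blocks on both sides of the static particle, which
moves from `k + 1` to `l + 1`, and exchanges the winners. -/
theorem measure_rightEv (hβ : MeasurePreserving not β β)
    (hρ : MeasurePreserving (fun z => -z) ρ ρ) (k l : ℕ) :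
    worldMeasure β γ ρ (rightEv k l) = worldMeasure β γ ρ (leftEv l k) := by
  rw [← (measurePreserving_reflect (γ := γ) hβ hρ (k + l + 2)).measure_preimage
    (measurableSet_leftEv l k).nullMeasurableSet]
  congr 1
  ext w
  have h := w.reflect_reflect (k + l + 2)
  have h1 := h.firstR_iff (a := k + 2) (b := k + l + 2) w.regular (World.regular _)
    w.strictMono (World.strictMono _) (by omega) le_rfl
  have h2 := h.first_iff (a := 0) (b := k) w.regular (World.regular _)
    w.strictMono (World.strictMono _) (by omega) (by omega)
  have h3 := h.leftWins_iff (a := 0) (k := k + 1) (b := k + l + 2) w.regular (by omega) (by omega)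
    le_rfl
  obtain ⟨C, h⟩ := h
  have h4 := (h (k + 1) (by omega)).2.1
  rw [Nat.sub_self, show k + l + 2 - (k + 2) = l by omega] at h1
  rw [Nat.sub_zero, show k + l + 2 - k = l + 2 by omega] at h2
  rw [Nat.sub_zero, Nat.sub_self, show k + l + 2 - (k + 1) = l + 1 by omega] at h3
  rw [show k + l + 2 - (k + 1) = l + 1 by omega] at h4
  simp only [rightEv, leftEv, Set.mem_preimage, Set.mem_inter_iff, Set.mem_sdiff, mem_bothEv,
    Set.mem_ofPred_eq, show k + (l + 2) = k + l + 2 by ring, show l + (k + 2) = k + l + 2 by ring,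
    h1, h2, h3, h4, neg_eq_zero]
  tauto

theorem measure_reachEv : worldMeasure β γ ρ reachEv = worldMeasure β γ ρ (velEv (-1)) +
    worldMeasure β γ ρ (velEv 0) *
      ((∑' n, worldMeasure β γ ρ (firstEv n)) * ∑' n, worldMeasure β γ ρ (firstEv n)) +
    ((∑' n, worldMeasure β γ ρ (mutualEv n)) * (∑' n, worldMeasure β γ ρ (firstEv n)) +
      ∑' r : ℕ × ℕ, worldMeasure β γ ρ (leftEv r.1 r.2)) := by
  have h1 := measurableSet_firstEv
  have hm : ∀ r : ℕ × ℕ, MeasurableSet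
      (mutualEv r.1 ∩ World.shift (r.1 + 2) ⁻¹' firstEv r.2) := fun r =>
    (measurableSet_mutualEv _).inter (measurable_shift _ (h1 _))
  have hs : ∀ r : ℕ × ℕ, MeasurableSet (velEv 0 ∩ World.shift 1 ⁻¹'
      (firstEv r.1 ∩ World.shift (r.1 + 1) ⁻¹' firstEv r.2)) := fun r =>
    (measurableSet_velEv 0).inter (measurable_shift _ ((h1 _).inter (measurable_shift _ (h1 _))))
  have hl : ∀ r : ℕ × ℕ, MeasurableSet (leftEv r.1 r.2) := fun r => measurableSet_leftEv _ _
  have tsum_mul : ∀ f g : ℕ → ℝ≥0∞, ∑' r : ℕ × ℕ, f r.1 * g r.2 = (∑' n, f n) * ∑' n, g n := by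
    intro f g
    rw [ENNReal.tsum_prod (f := fun a b => f a * g b)]
    simp [ENNReal.tsum_mul_left, ENNReal.tsum_mul_right]
  rw [reachEv_eq, measure_union ?_ ((MeasurableSet.iUnion hm).union (.iUnion hl)),
    measure_union ?_ (.iUnion hs), measure_union ?_ (.iUnion hl), measure_iUnion ?_ hs,
    measure_iUnion ?_ hm, measure_iUnion ?_ hl]
  · simp only [measure_velEv_first_first, measure_mutualEv_first, ENNReal.tsum_mul_left]
    rw [tsum_mul (fun n => worldMeasure β γ ρ (firstEv n)) fun n => worldMeasure β γ ρ (firstEv n),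
      tsum_mul (fun n => worldMeasure β γ ρ (mutualEv n)) fun n => worldMeasure β γ ρ (firstEv n)]
  · rintro ⟨k, l⟩ ⟨k', l'⟩ hne
    refine Set.disjoint_left.2 fun w hw hw' => hne ?_
    obtain ⟨h, h'⟩ := eq_of_partner (leftEv_partner hw) (leftEv_partner hw')
    exact Prod.ext h h'
  · rintro ⟨k, l⟩ ⟨k', l'⟩ hne
    refine Set.disjoint_left.2 fun w hw hw' => hne ?_
    obtain ⟨h, h'⟩ := eq_of_partner (mutual_left_partner hw) (mutual_left_partner hw')
    exact Prod.ext h h'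
  · rintro ⟨k, l⟩ ⟨k', l'⟩ hne
    refine Set.disjoint_left.2 fun w hw hw' => hne ?_
    obtain ⟨-, h2, h3⟩ := hw
    obtain ⟨-, h2', h3'⟩ := hw'
    have h2 := shift_mem_firstEv.1 h2
    have h2' := shift_mem_firstEv.1 h2'
    simp only [Set.mem_preimage, World.shift_shift, shift_mem_firstEv] at h3 h3'
    obtain rfl : k = k' := by
      have := h2.unique w.regular w.strictMono h2'
      simpa using this
    have := h3.unique w.regular w.strictMono h3'
    rw [show l = l' by omega]
  · refine Set.disjoint_left.2 fun w hw hw' => ?_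
    obtain ⟨⟨k, l⟩, hw⟩ := Set.mem_iUnion.1 hw
    obtain ⟨⟨k', l'⟩, hw'⟩ := Set.mem_iUnion.1 hw'
    obtain ⟨rfl, -⟩ := eq_of_partner (mutual_left_partner hw) (leftEv_partner hw')
    have h3 : w.config.v (k + 1) = -1 := hw.1.2.1
    have h4 : w.config.v (k + 1) = 0 := (mem_bothEv.1 hw'.1).2.1
    omega
  · refine Set.disjoint_left.2 fun w hw hw' => ?_
    obtain ⟨⟨k, l⟩, hw'⟩ := Set.mem_iUnion.1 hw'
    have h3 : w.config.v 0 = -1 := hw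
    have h4 : w.config.v 0 = 0 := hw'.1
    omega
  · refine Set.disjoint_left.2 fun w hw hw' => ?_
    have h3 : w.config.v 0 ≠ 1 := by
      rcases hw with hw | hw
      · have : w.config.v 0 = -1 := hw
        omega
      · obtain ⟨⟨k, l⟩, hw⟩ := Set.mem_iUnion.1 hw
        have : w.config.v 0 = 0 := hw.1
        omega
    rcases hw' with hw' | hw'
    · obtain ⟨⟨k, l⟩, hw'⟩ := Set.mem_iUnion.1 hw'
      exact h3 hw'.1.1
    · obtain ⟨⟨k, l⟩, hw'⟩ := Set.mem_iUnion.1 hw'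
      exact h3 (mem_bothEv.1 hw'.1).1.vel

theorem measure_velEv_one_add (hβ : MeasurePreserving not β β)
    (hρ : MeasurePreserving (fun z => -z) ρ ρ) (n : ℕ) :
    worldMeasure β γ ρ (velEv 1) + ∑ k ∈ Finset.range n, ∑ l ∈ Finset.range (n - 1 - k),
      worldMeasure β γ ρ (rightEv k l) =
    worldMeasure β γ ρ (crossEv n) + ∑ k ∈ Finset.range n, worldMeasure β γ ρ (mutualEv k) +
      (∑ k ∈ Finset.range n, worldMeasure β γ ρ (firstEv k)) * worldMeasure β γ ρ (velEv 0) := by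
  rw [measure_velEv_one n, measure_crossREv hβ hρ, Finset.sum_add_distrib, add_assoc, add_assoc,
    add_assoc, ← Finset.sum_add_distrib, Finset.sum_mul]
  congr 2
  refine Finset.sum_congr rfl fun k hk => ?_
  rw [measure_hitEv (Finset.mem_range.1 hk), measure_firstREv_static hβ hρ]

theorem measure_crossEv_le (n : ℕ) : worldMeasure β γ ρ (crossEv n) ≤
    worldMeasure β γ ρ (firstEv n) + ∑ k ∈ Finset.range n,
      worldMeasure β γ ρ (firstEv k) * worldMeasure β γ ρ (crossEv (n - 1 - k)) := by
  have hsub : crossEv n ⊆ firstEv n ∪ ⋃ k ∈ Finset.range n,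
      firstEv k ∩ World.shift (k + 1) ⁻¹' crossEv (n - 1 - k) := by
    intro w hw
    rcases Config.Cross.renewal w.regular w.strictMono hw with h | ⟨k, hk, h, h'⟩
    · exact Or.inl h
    · refine Or.inr (Set.mem_biUnion (Finset.mem_coe.2 (Finset.mem_range.2 hk)) ⟨h, ?_⟩)
      rw [Set.mem_preimage, shift_mem_crossEv, show n - 1 - k + (k + 1) = n by omega]
      exact h'
  refine (measure_mono hsub).trans ((measure_union_le _ _).trans ?_)
  gcongr
  refine (measure_biUnion_finset_le _ _).trans (Finset.sum_le_sum fun k _ => ?_)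
  rw [measure_inter_shift (measurableSet_firstEv k) (measurableSet_crossEv _)
    (dependsOnFirst_firstEv k)]

/-- By the renewal inequality the partial sums `U` of the crossing probabilities satisfy `U ≤ q + q
U`. Hence `U ≤ q / (1 - q)`: the series converges and its terms tend to `0`. -/
theorem tendsto_measure_crossEv (h : worldMeasure β γ ρ reachEv < 1) :
    Tendsto (fun n => worldMeasure β γ ρ (crossEv n)) atTop (𝓝 0) := by
  set f := fun n => worldMeasure β γ ρ (firstEv n) with hf
  set u := fun n => worldMeasure β γ ρ (crossEv n) with hu
  set q := worldMeasure β γ ρ reachEv with hq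
  have hfq : ∀ n, ∑ k ∈ Finset.range n, f k ≤ q := by
    intro n
    rw [hq, measure_reachEv_eq_tsum]
    exact ENNReal.sum_le_tsum _
  have hbound : ∀ N, ∑ n ∈ Finset.range N, u n ≤ q + q * ∑ n ∈ Finset.range N, u n := by
    intro N
    calc ∑ n ∈ Finset.range N, u n
        ≤ ∑ n ∈ Finset.range N, (f n + ∑ k ∈ Finset.range n, f k * u (n - 1 - k)) :=
          Finset.sum_le_sum fun n _ => measure_crossEv_le n
      _ = ∑ n ∈ Finset.range N, f n +
          ∑ n ∈ Finset.range N, ∑ k ∈ Finset.range n, f k * u (n - 1 - k) :=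
          Finset.sum_add_distrib
      _ = ∑ n ∈ Finset.range N, f n +
          ∑ k ∈ Finset.range N, ∑ n ∈ Finset.Ico (k + 1) N, f k * u (n - 1 - k) := by
          congr 1
          refine Finset.sum_comm' fun n k => ?_
          simp only [Finset.mem_range, Finset.mem_Ico]
          omega
      _ ≤ q + ∑ k ∈ Finset.range N, f k * ∑ n ∈ Finset.range N, u n := by
          gcongr with k hk
          · exact hfq N
          · rw [← Finset.mul_sum, Finset.sum_Ico_eq_sum_range]
            gcongr
            have : ∀ l, u (k + 1 + l - 1 - k) = u l := fun l => by
              rw [show k + 1 + l - 1 - k = l by omega]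
            simp only [this]
            exact Finset.sum_le_sum_of_subset (Finset.range_subset_range.2 (by omega))
      _ ≤ q + q * ∑ n ∈ Finset.range N, u n := by
          rw [← Finset.sum_mul]
          gcongr
          exact hfq N
  have hle : ∀ N, ∑ n ∈ Finset.range N, u n ≤ q / (1 - q) := by
    intro N
    have hfin : ∑ n ∈ Finset.range N, u n ≠ ∞ :=
      (ENNReal.sum_lt_top.2 fun n _ => measure_lt_top _ _).ne
    -- Solving for the partial sum in `ℝ≥0∞` is legitimate because it is finite and `q < 1`.
    rw [ENNReal.le_div_iff_mul_le (Or.inl (tsub_pos_of_lt h).ne')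
      (Or.inl (ENNReal.sub_ne_top ENNReal.one_ne_top)), ENNReal.mul_sub fun _ _ => hfin, mul_one,
      tsub_le_iff_right, mul_comm _ q]
    exact hbound N
  refine ENNReal.tendsto_atTop_zero_of_tsum_ne_top (ne_top_of_le_ne_top ?_
    (ENNReal.tsum_le_of_sum_range_le hle))
  exact (ENNReal.div_lt_top (h.trans ENNReal.one_lt_top).ne (tsub_pos_of_lt h).ne').ne

/-- The triangles `k + l + 2 ≤ n` increase to all of `ℕ × ℕ`. -/
theorem tendsto_sum_triangle (a : ℕ → ℕ → ℝ≥0∞) :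
    Tendsto (fun n => ∑ k ∈ Finset.range n, ∑ l ∈ Finset.range (n - 1 - k), a k l) atTop
      (𝓝 (∑' r : ℕ × ℕ, a r.1 r.2)) := by
  let S : ℕ → Finset (ℕ × ℕ) := fun n =>
    (Finset.range n ×ˢ Finset.range n).filter fun r => r.1 + r.2 + 2 ≤ n
  have hS : ∀ n, ∑ k ∈ Finset.range n, ∑ l ∈ Finset.range (n - 1 - k), a k l =
      ∑ r ∈ S n, a r.1 r.2 := by
    intro n
    rw [Finset.sum_filter, Finset.sum_product]
    refine Finset.sum_congr rfl fun k hk => ?_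
    rw [← Finset.sum_filter]
    refine Finset.sum_congr ?_ fun _ _ => rfl
    ext l
    simp only [Finset.mem_range, Finset.mem_filter] at hk ⊢
    omega
  simp only [hS]
  refine ENNReal.summable.hasSum.comp (tendsto_atTop_finset_of_monotone ?_ ?_)
  · intro n m hnm r
    simp only [S, Finset.mem_filter, Finset.mem_product, Finset.mem_range]
    omega
  · rintro ⟨k, l⟩
    refine ⟨k + l + 2, ?_⟩
    simp only [S, Finset.mem_filter, Finset.mem_product, Finset.mem_range]
    omega

theorem measure_velEv_one_add_tsum (hβ : MeasurePreserving not β β)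
    (hρ : MeasurePreserving (fun z => -z) ρ ρ) (h : worldMeasure β γ ρ reachEv < 1) :
    worldMeasure β γ ρ (velEv 1) + ∑' r : ℕ × ℕ, worldMeasure β γ ρ (rightEv r.1 r.2) =
      ∑' n, worldMeasure β γ ρ (mutualEv n) +
        worldMeasure β γ ρ reachEv * worldMeasure β γ ρ (velEv 0) := by
  have h1 : Tendsto _ _ _ := (tendsto_const_nhds (x := worldMeasure β γ ρ (velEv 1))).add
    (tendsto_sum_triangle fun k l => worldMeasure β γ ρ (rightEv k l))
  have h2 := ((tendsto_measure_crossEv h).add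
    (ENNReal.tendsto_nat_tsum fun n => worldMeasure β γ ρ (mutualEv n))).add
    (ENNReal.Tendsto.mul_const (b := worldMeasure β γ ρ (velEv 0))
      (ENNReal.tendsto_nat_tsum fun n => worldMeasure β γ ρ (firstEv n))
      (Or.inr (measure_ne_top _ _)))
  have heq : ∀ n, _ := fun n => measure_velEv_one_add (γ := γ) hβ hρ n
  rw [funext heq] at h1
  rw [tendsto_nhds_unique h1 h2, zero_add, measure_reachEv_eq_tsum]

/-- The equation satisfied by the probability that the origin is reached. -/
theorem reach_equation (hβ : MeasurePreserving not β β)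
    (hρ : MeasurePreserving (fun z => -z) ρ ρ) {p q : ℝ}
    (h0 : ρ.real {a | (a : ℤ) = 0} = p) (h1 : ρ.real {a | (a : ℤ) = 1} = (1 - p) / 2)
    (h2 : ρ.real {a | (a : ℤ) = -1} = (1 - p) / 2) (hq : (worldMeasure β γ ρ).real reachEv = q) :
    (1 - q) * (1 - p * (1 + q) ^ 2) = 0 := by
  by_cases hlt : worldMeasure β γ ρ reachEv < 1
  swap
  · have : worldMeasure β γ ρ reachEv = 1 := le_antisymm prob_le_one (not_lt.1 hlt)
    rw [← hq, Measure.real, this]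
    simp
  have e1 := measure_reachEv (β := β) (γ := γ) (ρ := ρ)
  have e3 := measure_velEv_one_add_tsum (γ := γ) hβ hρ hlt
  have hsymm : ∑' r : ℕ × ℕ, worldMeasure β γ ρ (rightEv r.1 r.2) =
      ∑' r : ℕ × ℕ, worldMeasure β γ ρ (leftEv r.1 r.2) := by
    simp only [measure_rightEv hβ hρ]
    exact (Equiv.prodComm ℕ ℕ).tsum_eq fun r : ℕ × ℕ => worldMeasure β γ ρ (leftEv r.1 r.2)
  -- Left and right victories are equally likely and together make up the event that both sides
  -- reach the static particle.
  have e2 : 2 * ∑' r : ℕ × ℕ, worldMeasure β γ ρ (leftEv r.1 r.2) =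
      worldMeasure β γ ρ (velEv 0) * (worldMeasure β γ ρ reachEv * worldMeasure β γ ρ reachEv) := by
    rw [two_mul]
    nth_rewrite 2 [← hsymm]
    rw [← ENNReal.tsum_add]
    simp only [measure_left_add_right, measure_bothEv hβ hρ, ENNReal.tsum_mul_left]
    rw [ENNReal.tsum_prod (f := fun a b => worldMeasure β γ ρ (firstEv a) *
      worldMeasure β γ ρ (firstEv b))]
    simp only [ENNReal.tsum_mul_left, ENNReal.tsum_mul_right, ← measure_reachEv_eq_tsum]
  rw [hsymm] at e3
  rw [← measure_reachEv_eq_tsum] at e1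
  have v0 : (worldMeasure β γ ρ (velEv 0)).toReal = p := by rw [velEv, measure_vel_eq]; exact h0
  have v1 : (worldMeasure β γ ρ (velEv 1)).toReal = (1 - p) / 2 := by
    rw [velEv, measure_vel_eq]; exact h1
  have v2 : (worldMeasure β γ ρ (velEv (-1))).toReal = (1 - p) / 2 := by
    rw [velEv, measure_vel_eq]; exact h2
  have fq : worldMeasure β γ ρ reachEv ≠ ∞ := measure_ne_top _ _
  have f0 : worldMeasure β γ ρ (velEv 0) ≠ ∞ := measure_ne_top _ _
  have f1 : worldMeasure β γ ρ (velEv 1) ≠ ∞ := measure_ne_top _ _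
  have f2 : worldMeasure β γ ρ (velEv (-1)) ≠ ∞ := measure_ne_top _ _
  rw [Measure.real] at hq
  generalize worldMeasure β γ ρ reachEv = Q at *
  generalize worldMeasure β γ ρ (velEv 0) = A at *
  generalize worldMeasure β γ ρ (velEv 1) = B at *
  generalize worldMeasure β γ ρ (velEv (-1)) = D at *
  generalize ∑' r : ℕ × ℕ, worldMeasure β γ ρ (leftEv r.1 r.2) = Z at *
  generalize ∑' n, worldMeasure β γ ρ (mutualEv n) = M at *
  have fZ : Z ≠ ∞ := by
    rintro rfl
    refine absurd e2 (ne_of_gt ?_)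
    rw [ENNReal.mul_top (by norm_num)]
    exact ENNReal.mul_lt_top f0.lt_top (ENNReal.mul_lt_top fq.lt_top fq.lt_top)
  have fM : M ≠ ∞ := by
    rintro rfl
    rw [top_add] at e3
    exact ENNReal.add_ne_top.2 ⟨f1, fZ⟩ e3
  lift Q to NNReal using fq
  lift A to NNReal using f0
  lift B to NNReal using f1
  lift D to NNReal using f2
  lift Z to NNReal using fZ
  lift M to NNReal using fM
  simp only [ENNReal.coe_toReal] at *
  norm_cast at e1 e2 e3
  have r1 := congrArg NNReal.toReal e1
  have r2 := congrArg NNReal.toReal e2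
  have r3 := congrArg NNReal.toReal e3
  push_cast at r1 r2 r3
  rw [hq, v0, v2] at r1
  rw [hq, v0] at r2 r3
  rw [v1] at r3
  -- All terms are finite, so the relations hold in `ℝ`, and `M` and `Z` can be eliminated from the
  -- arrival decomposition.
  have hM : (M : ℝ) = (1 - p) / 2 + Z - q * p := by linarith
  have hZ : (Z : ℝ) = p * (q * q) / 2 := by linarith
  rw [hM, hZ] at r1
  linear_combination -2 * r1

end Identities

/-! ### Transfer to an arbitrary probability space -/

/-- The positive number `r`, or `1` if `r` is not positive. -/
noncomputable def toGap (r : ℝ) : {r : ℝ // 0 < r} :=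
  ⟨if 0 < r then r else 1, by split_ifs with h; exacts [h, one_pos]⟩

/-- The velocity `z` as a sign. -/
def toVel (z : ℤ) : SignType := if z = 1 then 1 else if z = -1 then -1 else 0

/-- The spin `z` as a boolean. -/
def toSpin (z : ℤ) : Bool := decide (z = 1)

theorem measurable_toGap : Measurable toGap :=
  (Measurable.ite measurableSet_Ioi measurable_id measurable_const).subtype_mk

theorem measurable_toVel : Measurable toVel := measurable_of_countable _

theorem measurable_toSpin : Measurable toSpin := measurable_of_countable _

/-- The gap preceding the particle `n`, for a sequence of locations. -/
def gap (y : ℕ → ℝ) (n : ℕ) : ℝ := if n = 0 then y 0 else y n - y (n - 1)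

theorem measurable_gap (n : ℕ) : Measurable fun y : ℕ → ℝ => gap y n := by
  unfold gap
  split_ifs <;> fun_prop

theorem sum_gap (y : ℕ → ℝ) (n : ℕ) : ∑ i ∈ Finset.range (n + 1), gap y i = y n := by
  induction n with
  | zero => simp [gap]
  | succ n ih => rw [Finset.sum_range_succ, ih]; simp [gap]

/-- The point of the canonical space that codes a configuration. -/
noncomputable def toWorld (y : ℕ → ℝ) (v s : ℕ → ℤ) : World :=
  (fun n => toSpin (s n), fun n => toGap (gap y n), fun n => toVel (v n))

theorem config_toWorld {y : ℕ → ℝ} {v s : ℕ → ℤ} (hy : ∀ n, 0 < gap y n)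
    (hv : ∀ n, v n = -1 ∨ v n = 0 ∨ v n = 1) (hs : ∀ n, s n = -1 ∨ s n = 1) :
    (toWorld y v s).config = { x := y, v := v, s := s } := by
  have h1 : ∀ n, ((toGap (gap y n) : {r : ℝ // 0 < r}) : ℝ) = gap y n := fun n => by
    simp [toGap, hy n]
  have h2 : ∀ n, ((toVel (v n) : SignType) : ℤ) = v n := fun n => by
    rcases hv n with h | h | h <;> simp [toVel, h]
  have h3 : ∀ n, spinVal (toSpin (s n)) = s n := fun n => by
    rcases hs n with h | h <;> simp [toSpin, spinVal, h]
  simp only [World.config, toWorld, h1, h2, h3, sum_gap]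

variable {Ω : Type*} [MeasurableSpace Ω] {μ : Measure Ω} {m : Measure ℝ}
  {p : ℝ} {x : ℕ → Ω → ℝ} {v s : ℕ → Ω → ℤ}

theorem IsBallisticModel.law_gap' (h : IsBallisticModel μ m p x v s) (n : ℕ) :
    μ.map (fun ω => gap (fun n => x n ω) n) = m := by
  cases n with
  | zero => simpa [gap] using h.law_first
  | succ n => simpa [gap] using h.law_gap n

theorem measurable_gap_comp (hx : ∀ n, Measurable (x n)) (n : ℕ) :
    Measurable fun ω => gap (fun n => x n ω) n :=
  (measurable_gap n).comp (measurable_pi_lambda _ hx)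

theorem IsBallisticModel.ae_gap_pos (h : IsBallisticModel μ m p x v s) (hm : ∀ᵐ d ∂m, 0 < d) :
    ∀ᵐ ω ∂μ, ∀ n, 0 < gap (fun n => x n ω) n := by
  refine ae_all_iff.2 fun n => ?_
  rw [← h.law_gap' n] at hm
  exact ae_of_ae_map (measurable_gap_comp h.measurable_x n).aemeasurable hm

theorem map_eq_infinitePi {X Y : Type*} [MeasurableSpace X] [MeasurableSpace Y] {f : ℕ → Ω → X}
    {φ : X → Y} {ν : Measure Y} [IsProbabilityMeasure ν] (hf : ∀ n, Measurable (f n))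
    (hφ : Measurable φ) (hind : iIndepFun f μ) (hν : ∀ n, μ.map (fun ω => φ (f n ω)) = ν) :
    μ.map (fun ω n => φ (f n ω)) = Measure.infinitePi fun _ => ν := by
  have := (hind.comp (fun _ => φ) fun _ => hφ).map_fun_eq_infinitePi_map fun n => hφ.comp (hf n)
  simp only [Function.comp_def] at this
  rw [this]
  congr 1
  ext1 n
  exact hν n

variable [IsProbabilityMeasure μ]

/-- The three prescribed probabilities add up to `1`. -/
theorem IsBallisticModel.ae_vel (h : IsBallisticModel μ m p x v s) :
    ∀ᵐ ω ∂μ, ∀ n, v n ω = -1 ∨ v n ω = 0 ∨ v n ω = 1 := by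
  refine ae_all_iff.2 fun n => ?_
  have hmeas : ∀ z, MeasurableSet {ω | v n ω = z} := fun z =>
    measurableSet_eq_fun (h.measurable_v n) measurable_const
  have hS : MeasurableSet ({ω | v n ω = -1} ∪ ({ω | v n ω = 0} ∪ {ω | v n ω = 1})) :=
    (hmeas _).union ((hmeas _).union (hmeas _))
  have : μ.real ({ω | v n ω = -1} ∪ ({ω | v n ω = 0} ∪ {ω | v n ω = 1})) = 1 := by
    rw [measureReal_union ?_ ((hmeas _).union (hmeas _)), measureReal_union ?_ (hmeas _),
      h.prob_left, h.prob_static, h.prob_right]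
    · ring
    · exact Set.disjoint_left.2 fun ω h1 h2 => by
        simp only [Set.mem_ofPred_eq] at h1 h2
        omega
    · exact Set.disjoint_left.2 fun ω h1 h2 => by
        simp only [Set.mem_ofPred_eq, Set.mem_union] at h1 h2
        omega
  rw [Measure.real, ENNReal.toReal_eq_one_iff] at this
  exact (mem_ae_iff_prob_eq_one hS).2 this

theorem IsBallisticModel.ae_spin (h : IsBallisticModel μ m p x v s) :
    ∀ᵐ ω ∂μ, ∀ n, s n ω = -1 ∨ s n ω = 1 := by
  refine ae_all_iff.2 fun n => ?_
  have hmeas : ∀ z, MeasurableSet {ω | s n ω = z} := fun z =>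
    measurableSet_eq_fun (h.measurable_s n) measurable_const
  have : μ.real ({ω | s n ω = -1} ∪ {ω | s n ω = 1}) = 1 := by
    rw [measureReal_union ?_ (hmeas _), h.prob_spin_neg, h.prob_spin_pos]
    · norm_num
    · exact Set.disjoint_left.2 fun ω h1 h2 => by
        simp only [Set.mem_ofPred_eq] at h1 h2
        omega
  rw [Measure.real, ENNReal.toReal_eq_one_iff] at this
  exact (mem_ae_iff_prob_eq_one ((hmeas _).union (hmeas _))).2 this

theorem IsBallisticModel.real_toVel (h : IsBallisticModel μ m p x v s) (n : ℕ) (a : SignType) :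
    (μ.map fun ω => toVel (v n ω)).real {a} = if a = 0 then p else (1 - p) / 2 := by
  have hmeas : Measurable fun ω => toVel (v n ω) := measurable_toVel.comp (h.measurable_v n)
  rw [map_measureReal_apply hmeas (by simp)]
  have : (fun ω => toVel (v n ω)) ⁻¹' {a} =ᵐ[μ] {ω | v n ω = (a : ℤ)} := by
    filter_upwards [h.ae_vel] with ω hω
    refine propext ?_
    change toVel (v n ω) = a ↔ v n ω = a
    rcases hω n with h | h | h <;> rw [h] <;> cases a <;> decide
  rw [measureReal_congr this]
  cases a
  · simpa using h.prob_static n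
  · simpa using h.prob_left n
  · simpa using h.prob_right n

theorem IsBallisticModel.real_toSpin (h : IsBallisticModel μ m p x v s) (n : ℕ) (a : Bool) :
    (μ.map fun ω => toSpin (s n ω)).real {a} = 1 / 2 := by
  have hmeas : Measurable fun ω => toSpin (s n ω) := measurable_toSpin.comp (h.measurable_s n)
  rw [map_measureReal_apply hmeas (by simp)]
  have : (fun ω => toSpin (s n ω)) ⁻¹' {a} =ᵐ[μ] {ω | s n ω = spinVal a} := by
    filter_upwards [h.ae_spin] with ω hω
    refine propext ?_
    change toSpin (s n ω) = a ↔ s n ω = spinVal a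
    rcases hω n with h | h <;> rw [h] <;> cases a <;> decide
  rw [measureReal_congr this]
  cases a
  · exact h.prob_spin_neg n
  · exact h.prob_spin_pos n

theorem measure_eq_of_real_singleton {X : Type*} [MeasurableSpace X] [Countable X]
    [MeasurableSingletonClass X] {μ ν : Measure X} [IsFiniteMeasure μ] [IsFiniteMeasure ν]
    (h : ∀ a, μ.real {a} = ν.real {a}) : μ = ν := by
  refine Measure.ext_of_singleton fun a => ?_
  exact (ENNReal.toReal_eq_toReal_iff' (measure_ne_top _ _) (measure_ne_top _ _)).1 (h a)

/-- Each of the three sequences is i.i.d., and their mutual independence makes the joint law the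
product; gaps are functions of the locations, so they inherit independence from velocities and
spins. -/
theorem IsBallisticModel.measurePreserving_toWorld (h : IsBallisticModel μ m p x v s)
    [IsProbabilityMeasure m] :
    MeasurePreserving (fun ω => toWorld (fun n => x n ω) (fun n => v n ω) fun n => s n ω) μ
      (worldMeasure (μ.map fun ω => toSpin (s 0 ω)) (m.map toGap)
        (μ.map fun ω => toVel (v 0 ω))) := by
  have mS := fun n => measurable_toSpin.comp (h.measurable_s n)
  have mV := fun n => measurable_toVel.comp (h.measurable_v n)
  have mG := fun n => measurable_toGap.comp (measurable_gap_comp h.measurable_x n)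
  have pS : ∀ n, IsProbabilityMeasure (μ.map fun ω => toSpin (s n ω)) := fun n =>
    Measure.isProbabilityMeasure_map (mS n).aemeasurable
  have pV : ∀ n, IsProbabilityMeasure (μ.map fun ω => toVel (v n ω)) := fun n =>
    Measure.isProbabilityMeasure_map (mV n).aemeasurable
  have pG : IsProbabilityMeasure (m.map toGap) :=
    Measure.isProbabilityMeasure_map measurable_toGap.aemeasurable
  have lS := map_eq_infinitePi (ν := μ.map fun ω => toSpin (s 0 ω)) h.measurable_s
    measurable_toSpin h.indep_s fun n => measure_eq_of_real_singleton fun a => by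
      rw [h.real_toSpin, h.real_toSpin]
  have lV := map_eq_infinitePi (ν := μ.map fun ω => toVel (v 0 ω)) h.measurable_v
    measurable_toVel h.indep_v fun n => measure_eq_of_real_singleton fun a => by
      rw [h.real_toVel, h.real_toVel]
  have lG := map_eq_infinitePi (ν := m.map toGap) (measurable_gap_comp h.measurable_x)
    measurable_toGap h.indep_gaps fun n => by
      rw [← h.law_gap' n, Measure.map_map measurable_toGap (measurable_gap_comp h.measurable_x n)]
      rfl
  have mG' : Measurable fun (y : ℕ → ℝ) n => toGap (gap y n) :=
    measurable_pi_lambda _ fun n => measurable_toGap.comp (measurable_gap n)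
  have mV' : Measurable fun (y : ℕ → ℤ) n => toVel (y n) :=
    measurable_pi_lambda _ fun n => measurable_toVel.comp (measurable_pi_apply n)
  have mS' : Measurable fun (y : ℕ → ℤ) n => toSpin (y n) :=
    measurable_pi_lambda _ fun n => measurable_toSpin.comp (measurable_pi_apply n)
  have i1 := h.indep_v_x.symm.comp mG' mV'
  have i2 := h.indep_s_xv.comp mS' ((mG'.comp measurable_fst).prodMk (mV'.comp measurable_snd))
  have aS : Measurable fun ω n => toSpin (s n ω) := measurable_pi_lambda _ mS
  have aV : Measurable fun ω n => toVel (v n ω) := measurable_pi_lambda _ mV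
  have aG : Measurable fun ω n => toGap (gap (fun n => x n ω) n) := measurable_pi_lambda _ mG
  refine ⟨aS.prodMk (aG.prodMk aV), ?_⟩
  have j1 := (indepFun_iff_map_prod_eq_prod_map_map aG.aemeasurable aV.aemeasurable).1 i1
  have j2 := (indepFun_iff_map_prod_eq_prod_map_map aS.aemeasurable
    (aG.prodMk aV).aemeasurable).1 i2
  unfold worldMeasure
  rw [← lS, ← lG, ← lV, ← j1, ← j2]
  rfl

/-- Almost surely the coding reproduces the configuration exactly, and some particle crosses `0` if
and only if there is a first one. -/
theorem IsBallisticModel.originReached_ae_eq (h : IsBallisticModel μ m p x v s)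
    (hm : ∀ᵐ d ∂m, 0 < d) : originReached x v s =ᵐ[μ]
      (fun ω => toWorld (fun n => x n ω) (fun n => v n ω) fun n => s n ω) ⁻¹' reachEv := by
  filter_upwards [h.ae_gap_pos hm, h.ae_vel, h.ae_spin] with ω h1 h2 h3
  refine propext ?_
  have hcfg := config_toWorld h1 h2 h3
  set w := toWorld (fun n => x n ω) (fun n => v n ω) fun n => s n ω with hw
  change (∃ i, Config.CrossesFromRight _ 0 i) ↔ w ∈ reachEv
  rw [← hcfg]
  simp only [Config.crossesFromRight_iff w.regular w.strictMono w.x_zero_pos, reachEv,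
    Set.mem_iUnion]
  constructor
  · rintro ⟨i, hi⟩
    obtain ⟨l, -, hl⟩ := hi.exists_first w.regular w.strictMono
    exact ⟨l, hl⟩
  · rintro ⟨i, hi⟩
    exact ⟨i, Config.First.cross hi⟩

theorem IsBallisticModel.nullMeasurableSet_originReached [IsProbabilityMeasure m]
    (h : IsBallisticModel μ m p x v s) (hm : ∀ᵐ d ∂m, 0 < d) :
    NullMeasurableSet (originReached x v s) μ :=
  ((h.measurePreserving_toWorld.measurable
    (MeasurableSet.iUnion measurableSet_firstEv)).nullMeasurableSet).congr
    (h.originReached_ae_eq hm).symm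

theorem IsBallisticModel.hitProb_equation [IsProbabilityMeasure m]
    (h : IsBallisticModel μ m p x v s) (hm : ∀ᵐ d ∂m, 0 < d) :
    (1 - hitProb μ x v s) * (1 - p * (1 + hitProb μ x v s) ^ 2) = 0 := by
  have pS : IsProbabilityMeasure (μ.map fun ω => toSpin (s 0 ω)) :=
    Measure.isProbabilityMeasure_map (measurable_toSpin.comp (h.measurable_s 0)).aemeasurable
  have pV : IsProbabilityMeasure (μ.map fun ω => toVel (v 0 ω)) :=
    Measure.isProbabilityMeasure_map (measurable_toVel.comp (h.measurable_v 0)).aemeasurable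
  have pG : IsProbabilityMeasure (m.map toGap) :=
    Measure.isProbabilityMeasure_map measurable_toGap.aemeasurable
  have hβ : MeasurePreserving not (μ.map fun ω => toSpin (s 0 ω))
      (μ.map fun ω => toSpin (s 0 ω)) := by
    refine ⟨measurable_of_countable _, ?_⟩
    have := Measure.isProbabilityMeasure_map (μ := μ.map fun ω => toSpin (s 0 ω)) (f := not)
      (measurable_of_countable _).aemeasurable
    refine measure_eq_of_real_singleton fun a => ?_
    rw [map_measureReal_apply (measurable_of_countable _) (by simp),
      show not ⁻¹' {a} = {!a} by ext b; cases a <;> cases b <;> simp, h.real_toSpin, h.real_toSpin]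
  have hρ : MeasurePreserving (fun z => -z) (μ.map fun ω => toVel (v 0 ω))
      (μ.map fun ω => toVel (v 0 ω)) := by
    refine ⟨measurable_of_countable _, ?_⟩
    have := Measure.isProbabilityMeasure_map (μ := μ.map fun ω => toVel (v 0 ω))
      (f := fun z => -z) (measurable_of_countable _).aemeasurable
    refine measure_eq_of_real_singleton fun a => ?_
    rw [map_measureReal_apply (measurable_of_countable _) (by simp),
      show (fun z => -z) ⁻¹' {a} = {-a} by ext b; cases a <;> cases b <;> simp,
      h.real_toVel, h.real_toVel]
    cases a <;> simp
  have single : ∀ a : SignType, {b : SignType | (b : ℤ) = (a : ℤ)} = {a} := by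
    intro a
    ext b
    cases a <;> cases b <;> simp
  refine reach_equation (γ := m.map toGap) hβ hρ ?_ ?_ ?_ ?_
  · have := h.real_toVel 0 0
    rw [← single] at this
    simpa using this
  · have := h.real_toVel 0 1
    rw [← single] at this
    simpa using this
  · have := h.real_toVel 0 (-1)
    rw [← single] at this
    simpa using this
  · have hr : MeasurableSet reachEv := MeasurableSet.iUnion measurableSet_firstEv
    rw [hitProb, measureReal_congr (h.originReached_ae_eq hm), Measure.real,
      ← h.measurePreserving_toWorld.measure_preimage hr.nullMeasurableSet]
    rfl

end BallisticAnnihilation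

/-! ### Conclusion. -/

theorem mainTheorem7 {Ω : Type*} [MeasurableSpace Ω] (μ : MeasureTheory.Measure Ω)
    [MeasureTheory.IsProbabilityMeasure μ]
    (m : MeasureTheory.Measure ℝ) [MeasureTheory.IsProbabilityMeasure m]
    (hm : ∀ᵐ d ∂m, 0 < d) (p : ℝ) (hp0 : 0 < p) (hp1 : p < 1)
    (x : ℕ → Ω → ℝ) (v s : ℕ → Ω → ℤ)
    (hmodel : BallisticAnnihilation.IsBallisticModel μ m p x v s) :
    MeasureTheory.NullMeasurableSet (BallisticAnnihilation.originReached x v s) μ ∧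
    (1 - BallisticAnnihilation.hitProb μ x v s) *
      (1 - p * (1 + BallisticAnnihilation.hitProb μ x v s) ^ 2) = 0 ∧
    (BallisticAnnihilation.hitProb μ x v s = 1 ∨
      BallisticAnnihilation.hitProb μ x v s = 1 / √p - 1) ∧
    (p ≤ 1 / 4 → BallisticAnnihilation.hitProb μ x v s = 1) := by
  have heq := hmodel.hitProb_equation hm
  have hq0 : 0 ≤ BallisticAnnihilation.hitProb μ x v s := measureReal_nonneg
  have hq1 : BallisticAnnihilation.hitProb μ x v s ≤ 1 := measureReal_le_one
  refine ⟨hmodel.nullMeasurableSet_originReached hm, heq, ?_, fun hp => ?_⟩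
  · refine (mul_eq_zero.1 heq).imp (fun h => by linarith) fun h => ?_
    have hs : 0 < √p := Real.sqrt_pos.2 hp0
    have h1 : (√p * (1 + BallisticAnnihilation.hitProb μ x v s)) ^ 2 = 1 := by
      rw [mul_pow, Real.sq_sqrt hp0.le]
      linarith
    have h2 : √p * (1 + BallisticAnnihilation.hitProb μ x v s) = 1 :=
      (pow_eq_one_iff_of_nonneg (by positivity) two_ne_zero).1 h1
    rw [eq_sub_iff_add_eq, eq_div_iff hs.ne']
    linarith
  · rcases mul_eq_zero.1 heq with h | h
    · linarith
    · refine le_antisymm hq1 ?_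
      -- For `p ≤ 1/4` and `q < 1`, `p (1 + q)² < 1`, so the second factor cannot vanish.
      by_contra hlt
      push Not at hlt
      nlinarith [mul_le_mul_of_nonneg_right hp
        (sq_nonneg (1 + BallisticAnnihilation.hitProb μ x v s))]
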